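/- Fix an integer $d\ge 1$, real numbers $c>0$, $\theta>0$ and $\delta$ with $\frac d2<\delta<d$, and let $V(x)=c\|x\|^\delta$ on $\mathbb R^d$, where $\|\cdot\|$ is the Euclidean norm. *Canonical measure.* A spatial partition of $n$ is a family $\boldsymbol\lambda=(\lambda_x)_{x\in\mathbb Z^d}$ of integer partitions whose parts add up to $n$ in total; $r_{xj}$ denotes the number of parts of $\lambda_x$ equal to $j$. For $L>0$ let $\mathbb P_{L,n}$ be the measure on spatial partitions of $n$ with $$\mathbb P_{L,n}(\boldsymbol\lambda)=\frac1{Z_{L,n}}\prod_{x\in\mathbb Z^d}\prod_{j\ge1}\frac1{r_{xj}!}\Bigl(\frac{\theta}{j}\,e^{-jV(x/L)}\Bigr)^{r_{xj}},$$ where $Z_{L,n}$ is the sum of the weights, and let $H_0=\sum_{j\ge1} j\,r_{0j}$ be the occupation number of the origin. *Critical densities.* Let $z_{\rm c}$ be the radius of convergence of $\rho(z)=\sum_{j\ge1}\theta z^j\int_{\mathbb R^d}e^{-jV(x)}\,dx$, and put $\rho_{\rm c}=\rho(z_{\rm c})$. Let $(R_{xj})_{x\in\mathbb Z^d,\,j\ge1}$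 be, under $\mathbb P_L^{z}$, independent Poisson variables with parameters $\frac{\theta}{j}z^je^{-jV(x/L)}$, and let $$\rho_{\rm c}^L=\frac1{L^d}\,\mathbb E_L^{z_{\rm c}}\Bigl[\sum_{x\in\mathbb Z^d\setminus\{0\}}\sum_{j\ge1}j\,R_{xj}\Bigr].$$ *Random series.* Let $(G_x)_{x\in\mathbb Z^d}$ be i.i.d. $\mathrm{Gamma}(\theta,1)$ variables, with density $\Gamma(\theta)^{-1}t^{\theta-1}e^{-t}$ on $t\ge 0$. Let $\rho>\rho_{\rm c}$, and for $n\ge 1$ define $L$ by $n=\rho L^d$. Then there is a random variable $$Y=\sum_{x\in\mathbb Z^d\setminus\{0\}}\frac{\theta-G_x}{\|x\|^\delta},$$ meaning that for every increasing sequence $(\Lambda_k)$ of finite sets with union $\mathbb Z^d$ the partial sums over $\Lambda_k\setminus\{0\}$ converge almost surely to $Y$. Moreover $Z_{L,n}$ is finite and positive, so that $\mathbb P_{L,n}$ is a probability measure, and as $n\to\infty$ the law under $\mathbb P_{L,n}$ of $$\frac{H_0-(\rho-\rho_{\rm c}^L)L^d}{L^\delta}$$ converges weakly to the law of $\frac1c\,Y$.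 In particular, for $c=1$ the limit is $\sum_{x\neq0}(\theta-G_x)/\|x\|^\delta$. -/

import Mathlib

open MeasureTheory ProbabilityTheory Filter Topology
open scoped ENNReal NNReal

noncomputable section

namespace SpatialPartitions

/-- The lattice `ℤ^d` of sites. -/
abbrev Site (d : ℕ) : Type := Fin d → ℤ

/-- The rescaled position `x / L ∈ ℝ^d` of the site `x`. -/
def rescale {d : ℕ} (L : ℝ) (x : Site d) : EuclideanSpace ℝ (Fin d) :=
  WithLp.toLp 2 (fun i => (x i : ℝ) / L)

/-- The Euclidean norm of a site. -/
def siteNorm {d : ℕ} (x : Site d) : ℝ := ‖(WithLp.toLp 2 (fun i => (x i : ℝ)) : EuclideanSpace ℝ (Fin d))‖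

/-- A spatial partition: at each site `x` an integer partition `p x`, given as the multiset of its
parts (positive integers), empty at all but finitely many sites. -/
abbrev SpatialPartition (d : ℕ) : Type := Site d →₀ Multiset ℕ+

namespace SpatialPartition

variable {d : ℕ}

/-- `r_{xj}`: the number of parts of size `j` at the site `x`. -/
def mult (p : SpatialPartition d) (x : Site d) (j : ℕ+) : ℕ := (p x).count j

/-- `η_x`: the total number of particles at the site `x`, the sum of the parts of `p x`. -/
def occupation (p : SpatialPartition d) (x : Site d) : ℕ := ((p x).map (fun j : ℕ+ => (j : ℕ))).sum

/-- The total number of particles `∑_x η_x`. -/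
def size (p : SpatialPartition d) : ℕ := ∑ x ∈ p.support, p.occupation x

/-- The Boltzmann weight `∏_x ∏_j (1 / r_{xj}!) ((θ_j / j) exp (- j V(x/L)))^{r_{xj}}`; the factors
with `r_{xj} = 0`, which are equal to `1`, are left out of the product. -/
def weight (V : EuclideanSpace ℝ (Fin d) → ℝ) (θ : ℕ+ → ℝ) (L : ℝ) (p : SpatialPartition d) : ℝ :=
  ∏ x ∈ p.support, ∏ j ∈ (p x).toFinset,
    (1 / ((p.mult x j).factorial : ℝ)) *
      (θ j / (j : ℝ) * Real.exp (-(j : ℝ) * V (rescale L x))) ^ p.mult x j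

end SpatialPartition

/-- The canonical configuration space: spatial partitions of the integer `n`. -/
def Configuration (d n : ℕ) : Type := {p : SpatialPartition d // p.size = n}

instance (d n : ℕ) : MeasurableSpace (Configuration d n) := ⊤

variable {d : ℕ}

/-- The partition function `Z_{L,n}`. -/
def partitionFunction (V : EuclideanSpace ℝ (Fin d) → ℝ) (θ : ℕ+ → ℝ) (L : ℝ) (n : ℕ) : ℝ≥0∞ :=
  ∑' p : Configuration d n, ENNReal.ofReal (p.1.weight V θ L)

/-- The canonical measure `P_{L,n}`, giving each spatial partition `p` of `n` the mass
`weight p / Z_{L,n}`. -/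
def canonicalMeasure (V : EuclideanSpace ℝ (Fin d) → ℝ) (θ : ℕ+ → ℝ) (L : ℝ) (n : ℕ) :
    Measure (Configuration d n) :=
  Measure.sum fun p : Configuration d n =>
    (ENNReal.ofReal (p.1.weight V θ L) / partitionFunction V θ L n) • Measure.dirac p

/-- The random variable `H_0` on the canonical configuration space: the occupation of the
origin. -/
def originOccupation {n : ℕ} (p : Configuration d n) : ℕ := p.1.occupation 0

/-- The density `ρ(z) = ∑_{j ≥ 1} θ_j z^j ∫ exp (- j V(x)) dx`, with values in `[0, ∞]`. -/
def density (V : EuclideanSpace ℝ (Fin d) → ℝ) (θ : ℕ+ → ℝ) (z : ℝ≥0∞) : ℝ≥0∞ :=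
  ∑' j : ℕ+, ENNReal.ofReal (θ j) * z ^ (j : ℕ) *
    ∫⁻ x : EuclideanSpace ℝ (Fin d), ENNReal.ofReal (Real.exp (-(j : ℝ) * V x))

/-- `z_c`: the radius of convergence of the power series `ρ(z)` (its coefficients are
nonnegative). -/
def criticalFugacity (V : EuclideanSpace ℝ (Fin d) → ℝ) (θ : ℕ+ → ℝ) : ℝ≥0∞ :=
  sSup {z : ℝ≥0∞ | density V θ z < ∞}

/-- The transition density `ρ_c = ρ(z_c)`. -/
def criticalDensity (V : EuclideanSpace ℝ (Fin d) → ℝ) (θ : ℕ+ → ℝ) : ℝ≥0∞ :=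
  density V θ (criticalFugacity V θ)

/-- The grand-canonical measure `P_L^z`, under which the coordinates `R_{xj}` are independent
Poisson variables with parameters `(θ_j / j) z^j exp (- j V(x/L))`. -/
def grandCanonicalMeasure (V : EuclideanSpace ℝ (Fin d) → ℝ) (θ : ℕ+ → ℝ) (L : ℝ) (z : ℝ≥0) :
    Measure (Site d × ℕ+ → ℕ) :=
  Measure.infinitePi fun q : Site d × ℕ+ =>
    poissonMeasure (Real.toNNReal
      (θ q.2 / (q.2 : ℝ) * (z : ℝ) ^ (q.2 : ℕ) * Real.exp (-(q.2 : ℝ) * V (rescale L q.1))))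

/-- `M = ∑_{x ≠ 0} H_x = ∑_{x ≠ 0} ∑_j j R_{xj}`: the number of particles away from the origin. -/
def particlesOffOrigin (R : Site d × ℕ+ → ℕ) : ℝ≥0∞ :=
  ∑' x : {x : Site d // x ≠ 0}, ∑' j : ℕ+, (j : ℝ≥0∞) * (R (x.1, j) : ℝ≥0∞)

/-- `ρ_c^L = L^{-d} E_L^{z_c}(M)` (used when `z_c` and the expectation are finite). -/
def finiteCriticalDensity (V : EuclideanSpace ℝ (Fin d) → ℝ) (θ : ℕ+ → ℝ) (L : ℝ) : ℝ :=
  (∫⁻ R, particlesOffOrigin R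
      ∂(grandCanonicalMeasure V θ L (criticalFugacity V θ).toNNReal)).toReal / L ^ d

/-- The trap potential `V(x) = c ‖x‖^δ`. -/
def trap (d : ℕ) (c δ : ℝ) (x : EuclideanSpace ℝ (Fin d)) : ℝ := c * ‖x‖ ^ δ

/-- The length `L` with `n = ρ L^d`. -/
def length (d : ℕ) (ρ : ℝ) (n : ℕ) : ℝ := ((n : ℝ) / ρ) ^ (1 / (d : ℝ))

/-- The partial sum `∑_{x ∈ Λ, x ≠ 0} (θ - G_x) / ‖x‖^δ`. -/
def partialSum {Ω : Type*} (δ θ : ℝ) (G : Site d → Ω → ℝ) (Λ : Finset (Site d)) (ω : Ω) : ℝ :=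
  ∑ x ∈ Λ.erase 0, (θ - G x ω) / siteNorm x ^ δ

/-- `Y` is the sum of the random series `∑_{x ≠ 0} (θ - G_x) / ‖x‖^δ`: it is the almost sure limit
of the partial sums along every increasing sequence of finite domains exhausting `ℤ^d`. -/
def IsRandomSeriesSum {Ω : Type*} [MeasurableSpace Ω] (P : Measure Ω) (δ θ : ℝ)
    (G : Site d → Ω → ℝ) (Y : Ω → ℝ) : Prop :=
  ∀ Λ : ℕ → Finset (Site d), Monotone Λ → (∀ x, ∃ k, x ∈ Λ k) →
    ∀ᵐ ω ∂P, Tendsto (fun k => partialSum δ θ G (Λ k) ω) atTop (𝓝 (Y ω))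

end SpatialPartitions

end

/-! The exponential formula turns the total weight with fugacity `u x` at each site into `∏_x (1 -
e^{-V(x/L)} u x)^{-θ}`. At the origin `V = 0`, so `k` particles there carry the weight `a_k =
θ(θ+1)⋯(θ+k-1)/k!`. At `x ≠ 0` put `l_x = 1/(e^{V(x/L)} - 1)`; then `1 - e^{-V} z = (1 + l_x (1 -
z))/(1 + l_x)`, and `(1 + l_x s)^{-θ}` is the Laplace transform of `l_x G_x` with `G_x` a
`Gamma(θ,1)` variable. Hence, up to a constant, the number `M` of particles off the origin has the
generating function of a Poisson variable with random intensity `∑ l_x G_x`. Under the canonical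
measure `H_0` is therefore exactly `n - M`, with the law of `M` reweighted by `a_{n-M}/a_n`
(`splitWeight_eq`, `tsum_configuration_eq`, `integral_canonicalMeasure`). The gamma variables can be
the given ones for every `n`, so the limit can be proved by mean square estimates on a coupling.

The mean of `M` is `θ ∑ l_x = ρ_c^L L^d`, so the normalized variable is `L^{-δ} (θ ∑ l_x - M)`.
Three facts remain. (1) `L^{-δ} l_x` increases at most to, and converges to, `c⁻¹ ‖x‖^{-δ}`, which
is square summable because `2δ > d`; so the centred intensity converges to `Y/c` in mean square. (2)
The Poisson noise has variance `θ ∑ l_x`, of order `n`, and `L^{-2δ} n → 0`, again because `2δ > d`.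
(3) With `β = ρ_c/ρ < 1`, the tilt `a_{n-M}/a_n` is close to the constant `(1-β)^{θ-1}` when `M/n`
is near `β`, is bounded while `M ≤ γ n` with `γ < 1`, and is at most of order `n` otherwise; an
exponential bound of rate `n^{1-δ/d}`, where `δ < d` enters, beats this factor `n`. So the tilt is
asymptotically constant in mean and cancels in the normalized expectation
(`tendsto_tilted_integral`).

That `M/n` concentrates at `ρ_c/ρ` comes from `z_c = 1`, `ρ_c = θ ∫ 1/(e^V - 1)` and convergence of
Riemann sums (`tendsto_riemann_sum`). The series `Y` exists by convergence of `L²`-bounded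
martingales (`exists_series`). -/

noncomputable section

namespace SpatialPartitions

/-! ### The exponential formula and generating functions of spatial partitions -/

section Exponential

variable {ι : Type*}

/-- Splitting a finitely supported family at a site outside a given finite set. -/
def splitSupport [DecidableEq ι] {a : ι} {s : Finset ι} (ha : a ∉ s) :
    ℕ × {r : ι →₀ ℕ // r.support ⊆ s} ≃ {r : ι →₀ ℕ // r.support ⊆ insert a s} where
  toFun p := ⟨Finsupp.single a p.1 + p.2.1, by
    refine Finsupp.support_add.trans (Finset.union_subset ?_ ?_)
    · exact Finsupp.support_single_subset.trans (by simp)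
    · exact p.2.2.trans (Finset.subset_insert _ _)⟩
  invFun r := ⟨r.1 a, r.1.erase a, by
    rw [Finsupp.support_erase]
    intro x hx
    have := r.2 (Finset.mem_of_mem_erase hx)
    simpa [Finset.ne_of_mem_erase hx] using this⟩
  left_inv p := by
    obtain ⟨k, r, hr⟩ := p
    have h0 : r a = 0 := by
      by_contra h
      exact ha (hr (Finsupp.mem_support_iff.2 h))
    ext x
    · simp [h0]
    · by_cases hx : x = a
      · subst hx; simp [h0]
      · simp [Finsupp.erase_ne hx]
  right_inv r := by
    ext x
    by_cases hx : x = a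
    · subst hx; simp
    · simp [Finsupp.erase_ne hx, Finsupp.single_eq_of_ne hx]

lemma tsum_prod_of_support_subset (f : ι → ℕ → ℝ≥0∞) (hf : ∀ i, f i 0 = 1) (s : Finset ι) :
    ∑' r : {r : ι →₀ ℕ // r.support ⊆ s}, r.1.prod f = ∏ i ∈ s, ∑' k, f i k := by
  classical
  induction s using Finset.induction_on with
  | empty =>
    have : Unique {r : ι →₀ ℕ // r.support ⊆ ∅} :=
      { default := ⟨0, by simp⟩
        uniq := fun r => by
          ext1
          simpa using r.2 }
    rw [tsum_eq_single (⟨0, by simp⟩ : {r : ι →₀ ℕ // r.support ⊆ ∅})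
      (fun r hr => (hr (Subsingleton.elim _ _)).elim)]
    simp
  | insert a s ha ih =>
    rw [Finset.prod_insert ha, ← ih, ← (splitSupport ha).tsum_eq,
      ENNReal.tsum_prod (f := fun k r => (splitSupport ha (k, r)).1.prod f),
      ← ENNReal.tsum_mul_right]
    refine tsum_congr fun k => ?_
    rw [← ENNReal.tsum_mul_left]
    refine tsum_congr fun r => ?_
    change (Finsupp.single a k + r.1).prod f = _
    rw [Finsupp.prod_add_index_of_disjoint, Finsupp.prod_single_index (hf a)]
    rw [Finset.disjoint_left]
    intro x hx hx'
    have := Finsupp.support_single_subset hx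
    rw [Finset.mem_singleton] at this
    subst this
    exact ha (r.2 hx')

/-- Since `f i 0 = 1`, every factor is at least `1`, so the finite products increase to `B`. Any
finite set of families lives on a common finite support, which gives one inequality; restriction to
a finite support gives the other. -/
lemma tsum_prod_eq_of_tendsto (f : ι → ℕ → ℝ≥0∞) (hf : ∀ i, f i 0 = 1) {B : ℝ≥0∞}
    (hB : Tendsto (fun s : Finset ι => ∏ i ∈ s, ∑' k, f i k) atTop (𝓝 B)) :
    ∑' r : ι →₀ ℕ, r.prod f = B := by
  classical
  have hone : ∀ i, 1 ≤ ∑' k, f i k := fun i => (hf i).symm.le.trans (ENNReal.le_tsum 0)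
  have hmono : Monotone fun s : Finset ι => ∏ i ∈ s, ∑' k, f i k := fun s t hst =>
    Finset.prod_le_prod_of_subset_of_one_le' hst fun i _ _ => hone i
  apply le_antisymm
  · refine ENNReal.summable.tsum_le_of_sum_le fun F => ?_
    set s : Finset ι := F.biUnion Finsupp.support
    refine le_trans ?_ (hmono.ge_of_tendsto hB s)
    rw [← tsum_prod_of_support_subset f hf s]
    have h : ∀ r ∈ F, r.support ⊆ s := fun r hr => Finset.subset_biUnion_of_mem Finsupp.support hr
    have : ∑ r ∈ F, r.prod f =
        ∑ r ∈ F.subtype (fun r : ι →₀ ℕ => r.support ⊆ s), r.1.prod f := by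
      exact (Finset.sum_subtype_of_mem (fun r : ι →₀ ℕ => r.prod f) h).symm
    rw [this]
    exact ENNReal.sum_le_tsum _
  · refine le_of_tendsto' hB fun s => ?_
    rw [← tsum_prod_of_support_subset f hf s]
    exact ENNReal.tsum_comp_le_tsum_of_injective Subtype.val_injective _

lemma tsum_pow_div_factorial {t : ℝ} (ht : 0 ≤ t) :
    ∑' k : ℕ, ENNReal.ofReal (1 / (k.factorial : ℝ) * t ^ k) = ENNReal.ofReal (Real.exp t) := by
  have h := NormedSpace.expSeries_div_hasSum_exp t
  rw [← Real.exp_eq_exp_ℝ] at h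
  rw [← h.tsum_eq, ENNReal.ofReal_tsum_of_nonneg (fun k => by positivity) h.summable]
  refine tsum_congr fun k => ?_
  congr 1
  ring

/-- The exponential formula: summing products of Poisson weights over all finitely supported
families gives the exponential of the total rate. -/
lemma tsum_prod_poisson_weight {t : ι → ℝ} (ht : ∀ i, 0 ≤ t i) (hs : Summable t) :
    ∑' r : ι →₀ ℕ, r.prod (fun i k => ENNReal.ofReal (1 / (k.factorial : ℝ) * t i ^ k)) =
      ENNReal.ofReal (Real.exp (∑' i, t i)) := by
  refine tsum_prod_eq_of_tendsto _ (fun i => by simp) ?_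
  have : (fun s : Finset ι => ∏ i ∈ s, ∑' k : ℕ,
      ENNReal.ofReal (1 / (k.factorial : ℝ) * t i ^ k)) =
      fun s => ENNReal.ofReal (Real.exp (∑ i ∈ s, t i)) := by
    ext s
    rw [Real.exp_sum, ENNReal.ofReal_prod_of_nonneg fun i _ => (Real.exp_pos _).le]
    exact Finset.prod_congr rfl fun i _ => tsum_pow_div_factorial (ht i)
  rw [this]
  exact ENNReal.tendsto_ofReal ((Real.continuous_exp.tendsto _).comp hs.hasSum)

end Exponential

variable {d : ℕ}

/-- A spatial partition as a finitely supported family of multiplicities. -/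
def multiplicityEquiv (d : ℕ) : SpatialPartition d ≃ (Site d × ℕ+ →₀ ℕ) :=
  (Finsupp.mapRange.equiv (Multiset.toFinsupp (α := ℕ+)).toEquiv (by simp)).trans
    Finsupp.curryEquiv.symm

lemma multiplicityEquiv_apply (p : SpatialPartition d) (x : Site d) (j : ℕ+) :
    multiplicityEquiv d p (x, j) = p.mult x j := rfl

lemma multiplicityEquiv_prod {M : Type*} [CommMonoid M] (p : SpatialPartition d)
    (f : Site d × ℕ+ → ℕ → M) (hf : ∀ i, f i 0 = 1) :
    (multiplicityEquiv d p).prod f =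
      ∏ x ∈ p.support, ∏ j ∈ (p x).toFinset, f (x, j) (p.mult x j) := by
  classical
  set J : Finset ℕ+ := p.support.biUnion fun x => (p x).toFinset
  rw [Finsupp.prod_of_support_subset (s := p.support ×ˢ J) _ _ _ (fun i _ => hf i),
    Finset.prod_product]
  · refine Finset.prod_congr rfl fun x hx => ?_
    symm
    refine Finset.prod_subset
      (Finset.subset_biUnion_of_mem (fun x => (p x).toFinset) hx) fun j _ hj => ?_
    rw [show p.mult x j = 0 from Multiset.count_eq_zero.2 (by simpa using hj), hf]
  · rintro ⟨x, j⟩ h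
    rw [Finsupp.mem_support_iff, multiplicityEquiv_apply, SpatialPartition.mult,
      Multiset.count_ne_zero] at h
    have hx : x ∈ p.support := by
      rw [Finsupp.mem_support_iff]
      rintro h0
      simp [h0] at h
    exact Finset.mem_product.2 ⟨hx, Finset.mem_biUnion.2 ⟨x, hx, by simpa using h⟩⟩

lemma SpatialPartition.occupation_eq_sum (p : SpatialPartition d) (x : Site d) :
    p.occupation x = ∑ j ∈ (p x).toFinset, p.mult x j * (j : ℕ) := by
  rw [SpatialPartition.occupation, Finset.sum_multiset_map_count]
  rfl

/-- The weight with an additional fugacity at each site, as a product over multiplicities. -/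
lemma weight_mul_prod_fugacity (V : EuclideanSpace ℝ (Fin d) → ℝ) (θ L : ℝ) (u : Site d → ℝ)
    (p : SpatialPartition d) :
    p.weight V (fun _ => θ) L * ∏ x ∈ p.support, u x ^ p.occupation x =
      (multiplicityEquiv d p).prod (fun i k => 1 / (k.factorial : ℝ) *
        (θ / (i.2 : ℝ) * (Real.exp (-V (rescale L i.1)) * u i.1) ^ (i.2 : ℕ)) ^ k) := by
  rw [multiplicityEquiv_prod _ _ (fun i => by simp), SpatialPartition.weight,
    ← Finset.prod_mul_distrib]
  refine Finset.prod_congr rfl fun x _ => ?_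
  rw [p.occupation_eq_sum, ← Finset.prod_pow_eq_pow_sum, ← Finset.prod_mul_distrib]
  refine Finset.prod_congr rfl fun j _ => ?_
  rw [mul_assoc, mul_comm (p.mult x j), pow_mul, ← mul_pow, mul_pow (Real.exp _),
    ← Real.exp_nat_mul]
  dsimp only
  rw [mul_assoc (θ / (j : ℝ)), mul_neg, neg_mul]

lemma weight_pos (V : EuclideanSpace ℝ (Fin d) → ℝ) {θ : ℝ} (hθ : 0 < θ) (L : ℝ)
    (p : SpatialPartition d) : 0 < p.weight V (fun _ => θ) L := by
  unfold SpatialPartition.weight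
  refine Finset.prod_pos fun x _ => Finset.prod_pos fun j _ => ?_
  have := j.pos
  positivity

/-- The generating function of spatial partitions with a fugacity at each site. -/
lemma tsum_weight_mul_fugacity (V : EuclideanSpace ℝ (Fin d) → ℝ) {θ : ℝ} (hθ : 0 < θ) (L : ℝ)
    {u : Site d → ℝ} (hu : ∀ x, 0 ≤ u x)
    (hs : Summable fun i : Site d × ℕ+ =>
      θ / (i.2 : ℝ) * (Real.exp (-V (rescale L i.1)) * u i.1) ^ (i.2 : ℕ)) :
    ∑' p : SpatialPartition d, ENNReal.ofReal (p.weight V (fun _ => θ) L *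
        ∏ x ∈ p.support, u x ^ p.occupation x) =
      ENNReal.ofReal (Real.exp (∑' i : Site d × ℕ+,
        θ / (i.2 : ℝ) * (Real.exp (-V (rescale L i.1)) * u i.1) ^ (i.2 : ℕ))) := by
  have ht : ∀ i : Site d × ℕ+,
      0 ≤ θ / (i.2 : ℝ) * (Real.exp (-V (rescale L i.1)) * u i.1) ^ (i.2 : ℕ) := fun i => by
    have := hu i.1
    positivity
  rw [← tsum_prod_poisson_weight ht hs, ← (multiplicityEquiv d).tsum_eq]
  refine tsum_congr fun p => ?_
  rw [weight_mul_prod_fugacity, Finsupp.prod, Finsupp.prod,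
    ENNReal.ofReal_prod_of_nonneg]
  intro i _
  have := ht i
  positivity

/-- Two power series with nonnegative coefficients that are finite and agree on `(0, 1)` have
the same coefficients. -/
lemma eq_of_tsum_mul_pow_eq {b b' : ℕ → ℝ≥0∞}
    (hfin : ∀ z : ℝ≥0, 0 < z → z < 1 → ∑' m, b m * (z : ℝ≥0∞) ^ m ≠ ∞)
    (h : ∀ z : ℝ≥0, 0 < z → z < 1 →
      ∑' m, b m * (z : ℝ≥0∞) ^ m = ∑' m, b' m * (z : ℝ≥0∞) ^ m) : b = b' := by
  -- Constant terms are compared by letting `z → 0`: for `z < 1/2` the rest of the series is at most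
  -- `z * K`, with `K` the shifted series at `1/2`.
  have key : ∀ b b' : ℕ → ℝ≥0∞,
      (∀ z : ℝ≥0, 0 < z → z < 1 → ∑' m, b' m * (z : ℝ≥0∞) ^ m ≠ ∞) →
      (∀ z : ℝ≥0, 0 < z → z < 1 →
        ∑' m, b m * (z : ℝ≥0∞) ^ m = ∑' m, b' m * (z : ℝ≥0∞) ^ m) → b 0 ≤ b' 0 := by
    intro b b' hfin h
    set K := ∑' m, b' (m + 1) * ((1 / 2 : ℝ≥0) : ℝ≥0∞) ^ m with hK
    have hKfin : K ≠ ∞ := by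
      intro hKt
      apply hfin (1 / 2) (by norm_num) (by norm_num)
      rw [tsum_eq_zero_add' ENNReal.summable]
      have : ∑' m, b' (m + 1) * ((1 / 2 : ℝ≥0) : ℝ≥0∞) ^ (m + 1) = K * (1 / 2 : ℝ≥0) := by
        rw [hK, ← ENNReal.tsum_mul_right]
        exact tsum_congr fun m => by rw [pow_succ, mul_assoc]
      rw [this, hKt, ENNReal.top_mul (by norm_num), add_top]
    have hbound : ∀ᶠ z : ℝ≥0 in 𝓝[>] 0, b 0 ≤ b' 0 + (z : ℝ≥0∞) * K := by
      filter_upwards [Ioo_mem_nhdsGT (show (0 : ℝ≥0) < 1 / 2 by norm_num)] with z hz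
      have hz1 : z < 1 := hz.2.trans (by norm_num)
      calc b 0 ≤ ∑' m, b m * (z : ℝ≥0∞) ^ m := by
            simpa using ENNReal.le_tsum (f := fun m => b m * (z : ℝ≥0∞) ^ m) 0
        _ = ∑' m, b' m * (z : ℝ≥0∞) ^ m := h z hz.1 hz1
        _ = b' 0 + ∑' m, b' (m + 1) * (z : ℝ≥0∞) ^ (m + 1) := by
            rw [tsum_eq_zero_add' ENNReal.summable]; simp
        _ ≤ b' 0 + z * K := by
            gcongr
            rw [hK, ← ENNReal.tsum_mul_left]
            refine ENNReal.tsum_le_tsum fun m => ?_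
            rw [pow_succ', mul_left_comm]
            gcongr
            exact_mod_cast hz.2.le
    have hlim : Tendsto (fun z : ℝ≥0 => b' 0 + (z : ℝ≥0∞) * K) (𝓝[>] 0) (𝓝 (b' 0)) := by
      have h1 : Tendsto (fun z : ℝ≥0 => (z : ℝ≥0∞) * K) (𝓝 0) (𝓝 (((0 : ℝ≥0) : ℝ≥0∞) * K)) :=
        ENNReal.Tendsto.mul_const (ENNReal.tendsto_coe.2 tendsto_id) (Or.inr hKfin)
      have h2 := (tendsto_const_nhds (x := b' 0)).add
        (h1.mono_left (nhdsWithin_le_nhds (s := Set.Ioi (0 : ℝ≥0))))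
      simpa using h2
    exact ge_of_tendsto hlim hbound
  suffices H : ∀ m, ∀ b b' : ℕ → ℝ≥0∞,
      (∀ z : ℝ≥0, 0 < z → z < 1 → ∑' m, b m * (z : ℝ≥0∞) ^ m ≠ ∞) →
      (∀ z : ℝ≥0, 0 < z → z < 1 →
        ∑' m, b m * (z : ℝ≥0∞) ^ m = ∑' m, b' m * (z : ℝ≥0∞) ^ m) → b m = b' m from
    funext fun m => H m b b' hfin h
  intro m
  induction m with
  | zero =>
    intro b b' hfin h
    exact le_antisymm (key b b' (fun z h0 h1 => h z h0 h1 ▸ hfin z h0 h1) h)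
      (key b' b hfin fun z h0 h1 => (h z h0 h1).symm)
  | succ m ih =>
    intro b b' hfin h
    have h0 : b 0 = b' 0 := le_antisymm (key b b' (fun z h0 h1 => h z h0 h1 ▸ hfin z h0 h1) h)
      (key b' b hfin fun z h0 h1 => (h z h0 h1).symm)
    have hsplit : ∀ (b : ℕ → ℝ≥0∞) (z : ℝ≥0), ∑' m, b m * (z : ℝ≥0∞) ^ m =
        b 0 + z * ∑' m, b (m + 1) * (z : ℝ≥0∞) ^ m := by
      intro b z
      rw [tsum_eq_zero_add' ENNReal.summable, ← ENNReal.tsum_mul_left]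
      simp only [pow_zero, mul_one, pow_succ', mul_left_comm]
    -- Once the equal, finite constant terms are cancelled, the identity can be divided by `z` and
    -- induction applies to the shifted coefficients.
    refine ih (fun m => b (m + 1)) (fun m => b' (m + 1)) ?_ ?_
    · intro z hz0 hz1 htop
      apply hfin z hz0 hz1
      rw [hsplit, htop, ENNReal.mul_top (by exact_mod_cast hz0.ne'), add_top]
    · intro z hz0 hz1
      have h' := h z hz0 hz1
      have hne := hfin z hz0 hz1
      rw [hsplit] at hne
      rw [hsplit b, hsplit b', h0] at h'
      have hb0 : b' 0 ≠ ∞ := h0 ▸ (ENNReal.add_ne_top.1 hne).1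
      have h'' := (ENNReal.add_right_inj hb0).1 h'
      exact (ENNReal.mul_right_inj (by exact_mod_cast hz0.ne') ENNReal.coe_ne_top).1 h''

end SpatialPartitions

end

/-! ### Separating the origin from the other sites -/

noncomputable section

namespace SpatialPartitions

/-- The coefficients of `(1 - w)^{-θ}`. -/
def risingCoeff (θ : ℝ) (k : ℕ) : ℝ := (∏ j ∈ Finset.range k, (θ + j)) / k.factorial

lemma risingCoeff_pos {θ : ℝ} (hθ : 0 < θ) (k : ℕ) : 0 < risingCoeff θ k := by
  unfold risingCoeff
  refine div_pos (Finset.prod_pos fun j _ => by positivity) (by positivity)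

lemma ascPochhammer_smeval_eq_prod (θ : ℝ) (k : ℕ) :
    (ascPochhammer ℕ k).smeval θ = ∏ j ∈ Finset.range k, (θ + j) := by
  induction k with
  | zero => simp
  | succ k ih =>
    rw [Finset.prod_range_succ, ← ih, ascPochhammer_succ_right, Polynomial.smeval_mul,
      Polynomial.smeval_add, Polynomial.smeval_X, Polynomial.smeval_natCast]
    simp

lemma risingCoeff_eq_choose (θ : ℝ) (k : ℕ) : risingCoeff θ k = Ring.choose (θ + k - 1) k := by
  have h := Ring.factorial_nsmul_multichoose_eq_ascPochhammer θ k
  rw [ascPochhammer_smeval_eq_prod, Ring.multichoose_eq, nsmul_eq_mul] at h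
  rw [risingCoeff, ← h]
  field_simp

lemma hasSum_risingCoeff (θ : ℝ) {w : ℝ} (hw0 : 0 ≤ w) (hw1 : w < 1) :
    HasSum (fun k => risingCoeff θ k * w ^ k) ((1 - w) ^ (-θ)) := by
  have h := (Real.one_div_one_sub_rpow_hasFPowerSeriesOnBall_zero θ).hasSum (y := w) (by
    rw [Metric.mem_eball, edist_zero_right, ← ofReal_norm, Real.norm_of_nonneg hw0]
    exact ENNReal.ofReal_lt_one.2 hw1)
  rw [zero_add, one_div, ← Real.rpow_neg (by linarith)] at h
  have he : (fun k => risingCoeff θ k * w ^ k) = fun n : ℕ => FormalMultilinearSeries.ofScalars ℝ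
      (fun n : ℕ => Ring.choose (θ + n - 1) n) n fun _ => w := by
    ext k
    rw [FormalMultilinearSeries.ofScalars_apply_eq, risingCoeff_eq_choose, smul_eq_mul]
  rw [he]
  exact h

lemma tsum_risingCoeff {θ : ℝ} (hθ : 0 < θ) (w : ℝ≥0) (hw1 : w < 1) :
    ∑' k, ENNReal.ofReal (risingCoeff θ k) * (w : ℝ≥0∞) ^ k =
      ENNReal.ofReal ((1 - (w : ℝ)) ^ (-θ)) := by
  have h := hasSum_risingCoeff θ w.coe_nonneg (by exact_mod_cast hw1)
  have h0 : ∀ k, 0 ≤ risingCoeff θ k := fun k => (risingCoeff_pos hθ k).le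
  rw [← h.tsum_eq, ENNReal.ofReal_tsum_of_nonneg
    (fun k => mul_nonneg (h0 k) (pow_nonneg w.coe_nonneg k)) h.summable]
  refine tsum_congr fun k => ?_
  rw [ENNReal.ofReal_mul (h0 k), ENNReal.ofReal_pow w.coe_nonneg]
  simp

lemma hasSum_pnat_pow_div {y : ℝ} (hy0 : 0 ≤ y) (hy1 : y < 1) (θ : ℝ) :
    HasSum (fun j : ℕ+ => θ / (j : ℝ) * y ^ (j : ℕ)) (-(θ * Real.log (1 - y))) := by
  have h := (Real.hasSum_pow_div_log_of_abs_lt_one (x := y) (by rwa [abs_of_nonneg hy0])).mul_left θ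
  rw [mul_neg] at h
  rw [← Equiv.pnatEquivNat.symm.hasSum_iff]
  have he : (fun j : ℕ+ => θ / (j : ℝ) * y ^ (j : ℕ)) ∘ Equiv.pnatEquivNat.symm =
      fun n : ℕ => θ * (y ^ (n + 1) / ((n : ℝ) + 1)) := by
    ext n
    simp [Function.comp_apply]
    ring
  rw [he]
  exact h

variable {d : ℕ}

/-- The Bose factor `1 / (e^{V(x/L)} - 1)` of a site. -/
def siteRate (V : EuclideanSpace ℝ (Fin d) → ℝ) (L : ℝ) (x : Site d) : ℝ :=
  (Real.exp (V (rescale L x)) - 1)⁻¹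

/-- The number of particles of a spatial partition away from the origin. -/
def SpatialPartition.offOrigin (p : SpatialPartition d) : ℕ :=
  ∑ x ∈ p.support.erase 0, p.occupation x

lemma SpatialPartition.size_eq (p : SpatialPartition d) :
    p.size = p.occupation 0 + p.offOrigin := by
  unfold SpatialPartition.size SpatialPartition.offOrigin
  by_cases h : (0 : Site d) ∈ p.support
  · exact (Finset.add_sum_erase _ _ h).symm
  · rw [Finset.erase_eq_of_notMem h]
    have : p.occupation 0 = 0 := by
      simp [SpatialPartition.occupation, Finsupp.notMem_support_iff.1 h]
    omega

/-- The fugacity `w` at the origin and `z` elsewhere. -/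
def splitFugacity (w z : ℝ) (x : Site d) : ℝ := if x = 0 then w else z

lemma prod_splitFugacity (w z : ℝ) (p : SpatialPartition d) :
    ∏ x ∈ p.support, splitFugacity w z x ^ p.occupation x =
      w ^ p.occupation 0 * z ^ p.offOrigin := by
  unfold SpatialPartition.offOrigin
  have h1 : ∏ x ∈ p.support.erase 0, splitFugacity w z x ^ p.occupation x =
      z ^ ∑ x ∈ p.support.erase 0, p.occupation x := by
    rw [← Finset.prod_pow_eq_pow_sum]
    refine Finset.prod_congr rfl fun x hx => ?_
    rw [splitFugacity, if_neg (Finset.ne_of_mem_erase hx)]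
  rw [← h1]
  by_cases h : (0 : Site d) ∈ p.support
  · rw [← Finset.mul_prod_erase _ _ h, splitFugacity, if_pos rfl]
  · rw [Finset.erase_eq_of_notMem h]
    have : p.occupation 0 = 0 := by
      simp [SpatialPartition.occupation, Finsupp.notMem_support_iff.1 h]
    rw [this, pow_zero, one_mul]

/-- The total weight of the spatial partitions with `k` particles at the origin and `m`
elsewhere. -/
def splitWeight (V : EuclideanSpace ℝ (Fin d) → ℝ) (θ L : ℝ) (k m : ℕ) : ℝ≥0∞ :=
  ∑' p : SpatialPartition d, if p.occupation 0 = k ∧ p.offOrigin = m then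
    ENNReal.ofReal (p.weight V (fun _ => θ) L) else 0

lemma tsum_splitWeight_mul (V : EuclideanSpace ℝ (Fin d) → ℝ) (θ L : ℝ) (h : ℕ → ℕ → ℝ≥0∞) :
    ∑' m, ∑' k, splitWeight V θ L k m * h k m =
      ∑' p : SpatialPartition d, ENNReal.ofReal (p.weight V (fun _ => θ) L) *
        h (p.occupation 0) p.offOrigin := by
  have h1 : ∀ m, ∑' k, splitWeight V θ L k m * h k m =
      ∑' p : SpatialPartition d, ∑' k, if p.occupation 0 = k ∧ p.offOrigin = m then
        ENNReal.ofReal (p.weight V (fun _ => θ) L) * h k m else 0 := by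
    intro m
    rw [ENNReal.tsum_comm]
    refine tsum_congr fun k => ?_
    rw [splitWeight, ← ENNReal.tsum_mul_right]
    refine tsum_congr fun p => ?_
    split_ifs <;> simp
  simp_rw [h1]
  rw [ENNReal.tsum_comm]
  refine tsum_congr fun p => ?_
  rw [tsum_eq_single p.offOrigin, tsum_eq_single (p.occupation 0)]
  · simp
  · intro k hk
    simp [hk.symm]
  · intro m hm
    simp [hm.symm]

section Joint

variable {V : EuclideanSpace ℝ (Fin d) → ℝ} {θ L : ℝ}

lemma siteRate_zero (h0 : V (rescale L 0) = 0) : siteRate V L (0 : Site d) = 0 := by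
  simp [siteRate, h0]

lemma siteRate_pos {x : Site d} (hx : 0 < V (rescale L x)) : 0 < siteRate V L x := by
  unfold siteRate
  have := Real.one_lt_exp_iff.2 hx
  exact inv_pos.2 (by linarith)

lemma siteRate_nonneg (h0 : V (rescale L 0) = 0) (hpos : ∀ x : Site d, x ≠ 0 → 0 < V (rescale L x))
    (x : Site d) : 0 ≤ siteRate V L x := by
  by_cases hx : x = 0
  · subst hx; rw [siteRate_zero h0]
  · exact (siteRate_pos (hpos x hx)).le

/-- This rewriting is what brings in gamma variables: `1 + l (1 - z)` to the power `-θ` is a gamma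
Laplace transform at `1 - z`, while `1 + l` only contributes to a constant. -/
lemma log_one_sub_exp_mul {x : Site d} (hx : 0 < V (rescale L x)) {z : ℝ} (hz : z ≤ 1) :
    Real.log (1 - Real.exp (-V (rescale L x)) * z) =
      Real.log (1 + siteRate V L x * (1 - z)) - Real.log (1 + siteRate V L x) := by
  have hl := siteRate_pos hx
  have h1 : 0 < 1 + siteRate V L x * (1 - z) := by
    have := mul_nonneg hl.le (sub_nonneg.2 hz)
    linarith
  rw [← Real.log_div h1.ne' (by linarith)]
  congr 1
  have he := Real.one_lt_exp_iff.2 hx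
  have h2 : Real.exp (V (rescale L x)) - 1 ≠ 0 := by linarith
  have h3 : Real.exp (V (rescale L x)) ≠ 0 := (Real.exp_pos _).ne'
  rw [Real.exp_neg, siteRate, eq_div_iff (by
    have := inv_pos.2 (sub_pos.2 he)
    linarith)]
  field_simp
  ring

lemma summable_log_one_add_mul (h0 : V (rescale L 0) = 0)
    (hpos : ∀ x : Site d, x ≠ 0 → 0 < V (rescale L x))
    (hsum : Summable (siteRate V L : Site d → ℝ)) {s : ℝ} (hs : 0 ≤ s) :
    Summable fun x : Site d => Real.log (1 + siteRate V L x * s) := by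
  refine Summable.of_nonneg_of_le (fun x => ?_) (fun x => ?_) (hsum.mul_right s)
  · exact Real.log_nonneg (by
      have := mul_nonneg (siteRate_nonneg h0 hpos x) hs
      linarith)
  · have := mul_nonneg (siteRate_nonneg h0 hpos x) hs
    have := Real.log_le_sub_one_of_pos (show 0 < 1 + siteRate V L x * s by linarith)
    linarith

/-- Summing over `j` first gives a logarithm at each site. The terms are nonnegative, so summability
of these logarithms gives joint summability. The value `z = 1` is allowed off the origin, where
`e^{-V} < 1`; at the origin `w < 1` is needed. -/
lemma hasSum_split_rates (h0 : V (rescale L 0) = 0)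
    (hpos : ∀ x : Site d, x ≠ 0 → 0 < V (rescale L x))
    (hsum : Summable (siteRate V L : Site d → ℝ)) (hθ : 0 < θ)
    {w z : ℝ} (hw0 : 0 ≤ w) (hw1 : w < 1) (hz0 : 0 ≤ z) (hz1 : z ≤ 1) :
    HasSum (fun i : Site d × ℕ+ => θ / (i.2 : ℝ) *
        (Real.exp (-V (rescale L i.1)) * splitFugacity w z i.1) ^ (i.2 : ℕ))
      (-(θ * Real.log (1 - w)) + θ * ∑' x : Site d, Real.log (1 + siteRate V L x) -
        θ * ∑' x : Site d, Real.log (1 + siteRate V L x * (1 - z))) := by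
  set y : Site d → ℝ := fun x => Real.exp (-V (rescale L x)) * splitFugacity w z x with hy
  have hy0 : ∀ x, 0 ≤ y x := fun x => by
    simp only [hy, splitFugacity]; split_ifs <;> positivity
  have hy1 : ∀ x, y x < 1 := fun x => by
    simp only [hy, splitFugacity]
    split_ifs with hx
    · subst hx; simpa [h0] using hw1
    · calc _ ≤ Real.exp (-V (rescale L x)) * 1 := by gcongr
        _ < 1 := by simpa using hpos x hx
  have hfib : ∀ x, HasSum (fun j : ℕ+ => θ / (j : ℝ) * y x ^ (j : ℕ)) (-(θ * Real.log (1 - y x))) :=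
    fun x => hasSum_pnat_pow_div (hy0 x) (hy1 x) θ
  have hval : ∀ x, -(θ * Real.log (1 - y x)) = (if x = 0 then -(θ * Real.log (1 - w)) else 0) +
      θ * Real.log (1 + siteRate V L x) - θ * Real.log (1 + siteRate V L x * (1 - z)) := by
    intro x
    by_cases hx : x = 0
    · subst hx
      simp [hy, splitFugacity, h0, siteRate_zero h0]
    · simp only [hy, splitFugacity, if_neg hx, log_one_sub_exp_mul (hpos x hx) hz1]
      ring
  have htot : HasSum (fun x : Site d => -(θ * Real.log (1 - y x)))
      (-(θ * Real.log (1 - w)) + θ * ∑' x : Site d, Real.log (1 + siteRate V L x) -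
        θ * ∑' x : Site d, Real.log (1 + siteRate V L x * (1 - z))) := by
    simp_rw [hval]
    have hs1 := summable_log_one_add_mul h0 hpos hsum (s := 1) zero_le_one
    simp only [mul_one] at hs1
    have hs2 := summable_log_one_add_mul h0 hpos hsum (s := 1 - z) (by linarith)
    exact ((hasSum_ite_eq (0 : Site d) (-(θ * Real.log (1 - w)))).add (hs1.hasSum.mul_left θ)).sub
      (hs2.hasSum.mul_left θ)
  have hsummable : Summable (fun i : Site d × ℕ+ => θ / (i.2 : ℝ) * y i.1 ^ (i.2 : ℕ)) := by
    rw [summable_prod_of_nonneg]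
    · refine ⟨fun x => (hfib x).summable, ?_⟩
      simp_rw [(hfib _).tsum_eq]
      exact htot.summable
    · intro i
      have := hy0 i.1
      simp only [Pi.zero_apply]
      positivity
  have hH := hsummable.hasSum
  have := hH.prod_fiberwise hfib
  rw [htot.unique this]
  exact hH

lemma tsum_weight_split (h0 : V (rescale L 0) = 0)
    (hpos : ∀ x : Site d, x ≠ 0 → 0 < V (rescale L x))
    (hsum : Summable (siteRate V L : Site d → ℝ)) (hθ : 0 < θ)
    {w z : ℝ≥0} (hw1 : w < 1) (hz1 : z ≤ 1) :
    ∑' p : SpatialPartition d, ENNReal.ofReal (p.weight V (fun _ => θ) L) *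
        ((w : ℝ≥0∞) ^ p.occupation 0 * (z : ℝ≥0∞) ^ p.offOrigin) =
      ENNReal.ofReal ((1 - (w : ℝ)) ^ (-θ)) *
        ENNReal.ofReal (Real.exp (θ * ∑' x : Site d, Real.log (1 + siteRate V L x))) *
        ENNReal.ofReal (Real.exp
          (-(θ * ∑' x : Site d, Real.log (1 + siteRate V L x * (1 - z))))) := by
  have hw1' : (w : ℝ) < 1 := by exact_mod_cast hw1
  have h := hasSum_split_rates h0 hpos hsum hθ w.coe_nonneg hw1' z.coe_nonneg
    (by exact_mod_cast hz1)
  have hu : ∀ x : Site d, 0 ≤ splitFugacity (w : ℝ) (z : ℝ) x := fun x => by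
    unfold splitFugacity; split_ifs <;> positivity
  have key := tsum_weight_mul_fugacity V hθ L hu h.summable
  rw [h.tsum_eq] at key
  rw [Real.rpow_def_of_pos (by linarith), ← ENNReal.ofReal_mul (Real.exp_pos _).le,
    ← ENNReal.ofReal_mul (by positivity), ← Real.exp_add, ← Real.exp_add]
  refine Eq.trans (tsum_congr fun p => ?_) (key.trans ?_)
  · rw [prod_splitFugacity, ENNReal.ofReal_mul (weight_pos V hθ L p).le,
      ENNReal.ofReal_mul (by positivity), ENNReal.ofReal_pow w.coe_nonneg,
      ENNReal.ofReal_pow z.coe_nonneg]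
    simp
  · congr 2
    ring

/-- The weight of the spatial partitions with `k` particles at the origin and `m` elsewhere
factorizes; the factor `ν m` is determined by its generating function. -/
lemma splitWeight_eq (h0 : V (rescale L 0) = 0)
    (hpos : ∀ x : Site d, x ≠ 0 → 0 < V (rescale L x))
    (hsum : Summable (siteRate V L : Site d → ℝ)) (hθ : 0 < θ) {ν : ℕ → ℝ≥0∞}
    (hν : ∀ z : ℝ≥0, 0 < z → z < 1 → ∑' m, ν m * (z : ℝ≥0∞) ^ m = ENNReal.ofReal (Real.exp
      (-(θ * ∑' x : Site d, Real.log (1 + siteRate V L x * (1 - z)))))) (k m : ℕ) :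
    splitWeight V θ L k m = ENNReal.ofReal (risingCoeff θ k) *
      (ENNReal.ofReal (Real.exp (θ * ∑' x : Site d, Real.log (1 + siteRate V L x))) * ν m) := by
  set C := ENNReal.ofReal (Real.exp (θ * ∑' x : Site d, Real.log (1 + siteRate V L x))) with hC
  -- Uniqueness of coefficients is used twice: in `z` with `w` fixed, then in `w` with `m` fixed.
  have hstep : ∀ w : ℝ≥0, 0 < w → w < 1 → (fun m => ∑' k, splitWeight V θ L k m * (w : ℝ≥0∞) ^ k) =
      fun m => ENNReal.ofReal ((1 - (w : ℝ)) ^ (-θ)) * C * ν m := by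
    intro w hw0 hw1
    have hL : ∀ z : ℝ≥0, 0 < z → z < 1 →
        ∑' m, (∑' k, splitWeight V θ L k m * (w : ℝ≥0∞) ^ k) * (z : ℝ≥0∞) ^ m =
        ENNReal.ofReal ((1 - (w : ℝ)) ^ (-θ)) * C * ENNReal.ofReal (Real.exp
          (-(θ * ∑' x : Site d, Real.log (1 + siteRate V L x * (1 - z))))) := by
      intro z hz0 hz1
      simp_rw [← ENNReal.tsum_mul_right, mul_assoc]
      rw [tsum_splitWeight_mul V θ L fun k m => (w : ℝ≥0∞) ^ k * (z : ℝ≥0∞) ^ m, ← mul_assoc,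
        tsum_weight_split h0 hpos hsum hθ hw1 hz1.le]
    refine eq_of_tsum_mul_pow_eq (fun z hz0 hz1 => ?_) (fun z hz0 hz1 => ?_)
    · rw [hL z hz0 hz1]
      finiteness
    · rw [hL z hz0 hz1, ← hν z hz0 hz1, ← ENNReal.tsum_mul_left]
      simp only [mul_assoc]
  have hνfin : ν m ≠ ∞ := by
    intro htop
    have h := hν (1 / 2) (by norm_num) (by norm_num)
    have hle := ENNReal.le_tsum (f := fun m => ν m * ((1 / 2 : ℝ≥0) : ℝ≥0∞) ^ m) m
    rw [h] at hle
    simp only [htop] at hle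
    rw [ENNReal.top_mul (by positivity)] at hle
    exact ENNReal.ofReal_ne_top (top_le_iff.1 hle)
  have hrow : (fun k => splitWeight V θ L k m) =
      fun k => ENNReal.ofReal (risingCoeff θ k) * (C * ν m) := by
    refine eq_of_tsum_mul_pow_eq (fun w hw0 hw1 => ?_) (fun w hw0 hw1 => ?_)
    · rw [congrFun (hstep w hw0 hw1) m]
      finiteness
    · rw [congrFun (hstep w hw0 hw1) m, mul_assoc, ← tsum_risingCoeff hθ w hw1,
        ← ENNReal.tsum_mul_right]
      exact tsum_congr fun k => by ring
  exact congrFun hrow k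

end Joint

end SpatialPartitions

end

/-! ### Moments of gamma variables -/

noncomputable section

namespace SpatialPartitions

section Gamma

/-- All moments needed below have the property that `f` times the density is a multiple of another
gamma density, whose total mass is `1`. -/
lemma lintegral_gammaMeasure_eq {θ a r K : ℝ} {f : ℝ → ℝ} (hf : Measurable f) (ha : 0 < a)
    (hr : 0 < r) (hK : 0 ≤ K) (hθ : 0 < θ)
    (h : ∀ x, 0 < x → gammaPDFReal θ 1 x * f x = K * gammaPDFReal a r x) :
    ∫⁻ x, ENNReal.ofReal (f x) ∂gammaMeasure θ 1 = ENNReal.ofReal K := by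
  have hmeas : ∀ a r, Measurable (gammaPDF a r) := fun a r =>
    (measurable_gammaPDFReal a r).ennreal_ofReal
  rw [gammaMeasure, lintegral_withDensity_eq_lintegral_mul _ (hmeas θ 1) hf.ennreal_ofReal]
  have : ∀ᵐ x : ℝ, (gammaPDF θ 1 * fun x => ENNReal.ofReal (f x)) x =
      ENNReal.ofReal K * gammaPDF a r x := by
    filter_upwards [Measure.ae_ne volume 0] with x hx
    rcases lt_or_gt_of_ne hx with hx | hx
    · simp [gammaPDF_of_neg hx]
    · rw [Pi.mul_apply, gammaPDF, gammaPDF, ← ENNReal.ofReal_mul (gammaPDFReal_nonneg hθ one_pos x),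
        ← ENNReal.ofReal_mul hK, h x hx]
  rw [lintegral_congr_ae this, lintegral_const_mul _ (hmeas a r), lintegral_gammaPDF_eq_one ha hr,
    mul_one]

lemma lintegral_exp_gammaMeasure {θ s : ℝ} (hθ : 0 < θ) (hs : s < 1) :
    ∫⁻ x, ENNReal.ofReal (Real.exp (s * x)) ∂gammaMeasure θ 1 =
      ENNReal.ofReal ((1 - s) ^ (-θ)) := by
  have hs' : 0 < 1 - s := by linarith
  refine lintegral_gammaMeasure_eq (by fun_prop) hθ hs' (by positivity) hθ fun x hx => ?_
  have h1 : (1 - s) ^ (-θ) * (1 - s) ^ θ = 1 := by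
    rw [← Real.rpow_add hs', neg_add_cancel, Real.rpow_zero]
  have h2 : Real.exp (-(1 * x)) * Real.exp (s * x) = Real.exp (-((1 - s) * x)) := by
    rw [← Real.exp_add]; ring_nf
  simp only [gammaPDFReal, if_pos hx.le]
  calc _ = 1 / Real.Gamma θ * x ^ (θ - 1) * (Real.exp (-(1 * x)) * Real.exp (s * x)) := by
        rw [Real.one_rpow]; ring
    _ = ((1 - s) ^ (-θ) * (1 - s) ^ θ) / Real.Gamma θ * x ^ (θ - 1) *
          Real.exp (-((1 - s) * x)) := by rw [h1, h2]
    _ = _ := by ring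

lemma lintegral_id_gammaMeasure {θ : ℝ} (hθ : 0 < θ) :
    ∫⁻ x, ENNReal.ofReal x ∂gammaMeasure θ 1 = ENNReal.ofReal θ := by
  refine lintegral_gammaMeasure_eq measurable_id (a := θ + 1) (by linarith) one_pos hθ.le hθ
    fun x hx => ?_
  have hG := Real.Gamma_pos_of_pos hθ
  simp only [gammaPDFReal, if_pos hx.le, Real.Gamma_add_one hθ.ne', Real.rpow_sub_one hx.ne',
    add_sub_cancel_right, Real.one_rpow]
  field_simp

lemma lintegral_sq_gammaMeasure {θ : ℝ} (hθ : 0 < θ) :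
    ∫⁻ x, ENNReal.ofReal (x ^ 2) ∂gammaMeasure θ 1 = ENNReal.ofReal (θ * (θ + 1)) := by
  refine lintegral_gammaMeasure_eq (by fun_prop) (a := θ + 1 + 1) (by linarith) one_pos
    (by positivity) hθ fun x hx => ?_
  have hG := Real.Gamma_pos_of_pos hθ
  have h1 : (0 : ℝ) < θ + 1 := by linarith
  simp only [gammaPDFReal, if_pos hx.le, Real.Gamma_add_one h1.ne', Real.Gamma_add_one hθ.ne',
    Real.rpow_sub_one hx.ne', add_sub_cancel_right, Real.one_rpow, Real.rpow_add_one hx.ne']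
  field_simp

lemma gammaMeasure_ae_nonneg (θ : ℝ) : ∀ᵐ x ∂gammaMeasure θ 1, 0 ≤ x := by
  rw [gammaMeasure, ae_withDensity_iff (f := gammaPDF θ 1)
    (measurable_gammaPDFReal θ 1).ennreal_ofReal]
  refine ae_of_all _ fun x hx => ?_
  by_contra h
  exact hx (gammaPDF_of_neg (not_le.1 h))

end Gamma

variable {d : ℕ} {Ω : Type*} [MeasurableSpace Ω]

/-- A family of independent, measurable, nonnegative `Gamma(θ, 1)` variables. -/
structure IsGammaFamily (P : Measure Ω) (θ : ℝ) (G : Site d → Ω → ℝ) : Prop where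
  measurable : ∀ x, Measurable (G x)
  nonneg : ∀ x ω, 0 ≤ G x ω
  hasLaw : ∀ x, HasLaw (G x) (gammaMeasure θ 1) P
  indep : iIndepFun G P

/-- The given variables are only almost everywhere measurable and nonnegative. The positive part of
a measurable version has both properties everywhere, which the kernel and the filtration below
require. -/
lemma exists_isGammaFamily {P : Measure Ω} {θ : ℝ} {G : Site d → Ω → ℝ}
    (hG : ∀ x, HasLaw (G x) (gammaMeasure θ 1) P) (hindep : iIndepFun G P) :
    ∃ G' : Site d → Ω → ℝ, IsGammaFamily P θ G' ∧ ∀ x, G x =ᵐ[P] G' x := by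
  have hmk : ∀ x, G x =ᵐ[P] (hG x).aemeasurable.mk (G x) := fun x => (hG x).aemeasurable.ae_eq_mk
  have heq : ∀ x, G x =ᵐ[P] fun ω => max 0 ((hG x).aemeasurable.mk (G x) ω) := by
    intro x
    have h0 : ∀ᵐ ω ∂P, 0 ≤ G x ω := by
      have h := gammaMeasure_ae_nonneg θ
      rw [← (hG x).map_eq] at h
      exact ae_of_ae_map (hG x).aemeasurable h
    filter_upwards [hmk x, h0] with ω h1 h2
    rw [← h1, max_eq_right h2]
  refine ⟨fun x ω => max 0 ((hG x).aemeasurable.mk (G x) ω), ⟨fun x => ?_,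
    fun x ω => le_max_left _ _,
    fun x => (hG x).congr (heq x).symm, hindep.congr heq⟩, heq⟩
  exact measurable_const.max (hG x).aemeasurable.measurable_mk

namespace IsGammaFamily

variable {P : Measure Ω} {θ : ℝ} {G : Site d → Ω → ℝ}

lemma lintegral_eq (hG : IsGammaFamily P θ G) (hθ : 0 < θ) (x : Site d) :
    ∫⁻ ω, ENNReal.ofReal (G x ω) ∂P = ENNReal.ofReal θ := by
  rw [← lintegral_id_gammaMeasure hθ]
  exact (hG.hasLaw x).lintegral_comp (f := fun y => ENNReal.ofReal y) (by fun_prop)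

lemma lintegral_sq_eq (hG : IsGammaFamily P θ G) (hθ : 0 < θ) (x : Site d) :
    ∫⁻ ω, ENNReal.ofReal (G x ω ^ 2) ∂P = ENNReal.ofReal (θ * (θ + 1)) := by
  rw [← lintegral_sq_gammaMeasure hθ]
  exact (hG.hasLaw x).lintegral_comp (f := fun y => ENNReal.ofReal (y ^ 2)) (by fun_prop)

lemma lintegral_exp_eq (hG : IsGammaFamily P θ G) (hθ : 0 < θ) {s : ℝ} (hs : s < 1) (x : Site d) :
    ∫⁻ ω, ENNReal.ofReal (Real.exp (s * G x ω)) ∂P = ENNReal.ofReal ((1 - s) ^ (-θ)) := by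
  rw [← lintegral_exp_gammaMeasure hθ hs]
  exact (hG.hasLaw x).lintegral_comp (f := fun y => ENNReal.ofReal (Real.exp (s * y)))
    (by fun_prop)

lemma memLp_two (hG : IsGammaFamily P θ G) (hθ : 0 < θ) (x : Site d) : MemLp (G x) 2 P := by
  rw [memLp_two_iff_integrable_sq (hG.measurable x).aestronglyMeasurable]
  refine ⟨((hG.measurable x).pow_const 2).aestronglyMeasurable, ?_⟩
  rw [hasFiniteIntegral_iff_ofReal (ae_of_all _ fun ω => sq_nonneg _), hG.lintegral_sq_eq hθ]
  exact ENNReal.ofReal_lt_top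

lemma integral_eq (hG : IsGammaFamily P θ G) (hθ : 0 < θ) (x : Site d) : P[G x] = θ := by
  rw [integral_eq_lintegral_of_nonneg_ae (ae_of_all _ (hG.nonneg x))
    (hG.measurable x).aestronglyMeasurable, hG.lintegral_eq hθ, ENNReal.toReal_ofReal hθ.le]

variable [IsProbabilityMeasure P]

lemma variance_eq (hG : IsGammaFamily P θ G) (hθ : 0 < θ) (x : Site d) : Var[G x; P] = θ := by
  have h2 : P[G x ^ 2] = θ * (θ + 1) := by
    simp only [Pi.pow_apply]
    rw [integral_eq_lintegral_of_nonneg_ae (ae_of_all _ fun ω => sq_nonneg (G x ω))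
      ((hG.measurable x).pow_const 2).aestronglyMeasurable, hG.lintegral_sq_eq hθ,
      ENNReal.toReal_ofReal (by positivity)]
  rw [variance_eq_sub (hG.memLp_two hθ x), h2, hG.integral_eq hθ]
  ring

lemma memLp_sum (hG : IsGammaFamily P θ G) (hθ : 0 < θ) (a : Site d → ℝ)
    (F : Finset (Site d)) :
    MemLp (fun ω => ∑ x ∈ F, a x * (θ - G x ω)) 2 P :=
  memLp_finsetSum F fun x _ => ((memLp_const θ).sub (hG.memLp_two hθ x)).const_mul (a x)

lemma integral_sum_eq_zero (hG : IsGammaFamily P θ G) (hθ : 0 < θ) (a : Site d → ℝ)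
    (F : Finset (Site d)) : ∫ ω, ∑ x ∈ F, a x * (θ - G x ω) ∂P = 0 := by
  have hint : ∀ x, Integrable (G x) P := fun x => (hG.memLp_two hθ x).integrable one_le_two
  rw [integral_finsetSum]
  · refine Finset.sum_eq_zero fun x _ => ?_
    rw [integral_const_mul, integral_sub (integrable_const _) (hint x), hG.integral_eq hθ]
    simp
  · exact fun x _ => ((integrable_const _).sub (hint x)).const_mul _

/-- Centred independent variables of variance `θ` are orthogonal, so mean square norms are `ℓ²`
norms of coefficients. Every mean square estimate of the random series rests on this. -/
lemma lintegral_sum_sq (hG : IsGammaFamily P θ G) (hθ : 0 < θ) (a : Site d → ℝ)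
    (F : Finset (Site d)) :
    ∫⁻ ω, ENNReal.ofReal ((∑ x ∈ F, a x * (θ - G x ω)) ^ 2) ∂P =
      ENNReal.ofReal (θ * ∑ x ∈ F, a x ^ 2) := by
  have hm : ∀ x, MemLp (fun ω => a x * (θ - G x ω)) 2 P := fun x =>
    ((memLp_const θ).sub (hG.memLp_two hθ x)).const_mul (a x)
  have hvar : Var[∑ x ∈ F, fun ω => a x * (θ - G x ω); P] = θ * ∑ x ∈ F, a x ^ 2 := by
    rw [IndepFun.variance_sum (fun x _ => hm x), Finset.mul_sum]
    · refine Finset.sum_congr rfl fun x _ => ?_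
      rw [variance_const_mul, variance_const_sub (hG.measurable x).aestronglyMeasurable,
        hG.variance_eq hθ]
      ring
    · intro x _ y _ hxy
      exact (hG.indep.indepFun hxy).comp (φ := fun t => a x * (θ - t)) (ψ := fun t => a y * (θ - t))
        (by fun_prop) (by fun_prop)
  have hS := hG.memLp_sum hθ a F
  have hfun : (∑ x ∈ F, fun ω => a x * (θ - G x ω)) = fun ω => ∑ x ∈ F, a x * (θ - G x ω) := by
    ext ω; simp
  rw [hfun, variance_of_integral_eq_zero hS.aestronglyMeasurable.aemeasurable
    (hG.integral_sum_eq_zero hθ a F)] at hvar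
  rw [← hvar, ofReal_integral_eq_lintegral_ofReal]
  · exact (memLp_two_iff_integrable_sq hS.aestronglyMeasurable).1 hS
  · exact ae_of_all _ fun ω => sq_nonneg _

/-- Second moment bound for an almost sure limit of finite linear combinations. -/
lemma lintegral_sq_le_of_tendsto (hG : IsGammaFamily P θ G) (hθ : 0 < θ) {a : ℕ → Site d → ℝ}
    {F : ℕ → Finset (Site d)} {S : Ω → ℝ} {b : ℕ → ℝ} {B : ℝ}
    (hlim : ∀ᵐ ω ∂P, Tendsto (fun k => ∑ x ∈ F k, a k x * (θ - G x ω)) atTop (𝓝 (S ω)))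
    (hb : ∀ k, ∑ x ∈ F k, a k x ^ 2 ≤ b k) (hB : Tendsto b atTop (𝓝 B)) :
    ∫⁻ ω, ENNReal.ofReal (S ω ^ 2) ∂P ≤ ENNReal.ofReal (θ * B) := by
  have hmeas : ∀ k, Measurable fun ω => ∑ x ∈ F k, a k x * (θ - G x ω) := fun k =>
    Finset.measurable_fun_sum _ fun x _ => ((hG.measurable x).const_sub θ).const_mul _
  calc ∫⁻ ω, ENNReal.ofReal (S ω ^ 2) ∂P
      = ∫⁻ ω, liminf (fun k => ENNReal.ofReal ((∑ x ∈ F k, a k x * (θ - G x ω)) ^ 2)) atTop ∂P := by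
        refine lintegral_congr_ae ?_
        filter_upwards [hlim] with ω hω
        exact (ENNReal.tendsto_ofReal (hω.pow 2)).liminf_eq.symm
    _ ≤ liminf (fun k => ∫⁻ ω, ENNReal.ofReal ((∑ x ∈ F k, a k x * (θ - G x ω)) ^ 2) ∂P) atTop :=
        -- Fatou's lemma: an almost sure limit keeps the second moment bound, with no uniform
        -- integrability.
        lintegral_liminf_le fun k => ((hmeas k).pow_const 2).ennreal_ofReal
    _ ≤ liminf (fun k => ENNReal.ofReal (θ * b k)) atTop := by
        refine liminf_le_liminf (Eventually.of_forall fun k => ?_)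
        rw [hG.lintegral_sum_sq hθ]
        exact ENNReal.ofReal_le_ofReal (mul_le_mul_of_nonneg_left (hb k) hθ.le)
    _ = ENNReal.ofReal (θ * B) := (ENNReal.tendsto_ofReal (hB.const_mul θ)).liminf_eq

end IsGammaFamily

end SpatialPartitions

end

/-! ### Almost sure convergence of the random series -/

noncomputable section

namespace SpatialPartitions

variable {d : ℕ}

/-- Increasing boxes exhausting the lattice. -/
def siteBox (d : ℕ) (k : ℕ) : Finset (Site d) := Finset.Icc (fun _ => -(k : ℤ)) fun _ => (k : ℤ)

lemma siteBox_mono : Monotone (siteBox d) := fun j k hjk =>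
  Finset.Icc_subset_Icc (fun _ => by simpa using hjk) fun _ => by simpa using hjk

lemma exists_mem_siteBox (x : Site d) : ∃ k, x ∈ siteBox d k := by
  refine ⟨∑ i, (x i).natAbs, Finset.mem_Icc.2 ⟨fun i => ?_, fun i => ?_⟩⟩ <;>
  · have := Finset.single_le_sum (f := fun i => (x i).natAbs) (fun _ _ => Nat.zero_le _)
      (Finset.mem_univ i)
    simp only at this ⊢
    omega

lemma tendsto_siteBox_atTop : Tendsto (siteBox d) atTop atTop :=
  tendsto_atTop_finset_of_monotone siteBox_mono exists_mem_siteBox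

variable {Ω : Type*} [MeasurableSpace Ω]

namespace IsGammaFamily

variable {P : Measure Ω} {θ : ℝ} {G : Site d → Ω → ℝ}

/-- The filtration generated by the variables in an increasing sequence of domains. -/
def domainFiltration (hG : IsGammaFamily P θ G) {Λ : ℕ → Finset (Site d)} (hΛ : Monotone Λ) :
    Filtration ℕ ‹MeasurableSpace Ω› where
  seq k := ⨆ x ∈ (Λ k : Set (Site d)), MeasurableSpace.comap (G x) inferInstance
  mono' _ _ hjk := biSup_mono fun _ hx => hΛ hjk hx
  le' _ := iSup₂_le fun x _ => (hG.measurable x).comap_le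

lemma measurable_sum_biSup {Ω : Type*} {G : Site d → Ω → ℝ} (θ : ℝ) (a : Site d → ℝ)
    (F : Finset (Site d)) :
    Measurable[⨆ x ∈ (F : Set (Site d)), MeasurableSpace.comap (G x) inferInstance]
      fun ω => ∑ x ∈ F, a x * (θ - G x ω) := by
  refine Finset.measurable_fun_sum _ fun x hx => ?_
  have h1 : Measurable[MeasurableSpace.comap (G x) inferInstance] (G x) :=
    comap_measurable (G x)
  have h2 : Measurable[⨆ x ∈ (F : Set (Site d)), MeasurableSpace.comap (G x) inferInstance] (G x) :=
    h1.mono (le_biSup (fun x => MeasurableSpace.comap (G x) inferInstance)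
      (Finset.mem_coe.2 hx)) le_rfl
  exact (h2.const_sub θ).const_mul _

variable [IsProbabilityMeasure P]

/-- An increment involves only the sites of `Λ (k + 1) \ Λ k`, hence is independent of the past and
has mean zero. -/
lemma martingale_sum (hG : IsGammaFamily P θ G) (hθ : 0 < θ) (a : Site d → ℝ)
    {Λ : ℕ → Finset (Site d)} (hΛ : Monotone Λ) :
    Martingale (fun k ω => ∑ x ∈ Λ k, a x * (θ - G x ω)) (hG.domainFiltration hΛ) P := by
  refine martingale_of_condExp_sub_eq_zero_nat
    (fun k => (measurable_sum_biSup θ a (Λ k)).stronglyMeasurable)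
    (fun k => (hG.memLp_sum hθ a (Λ k)).integrable one_le_two) fun k => ?_
  have hdiff : ((fun ω => ∑ x ∈ Λ (k + 1), a x * (θ - G x ω)) -
      fun ω => ∑ x ∈ Λ k, a x * (θ - G x ω)) =
      fun ω => ∑ x ∈ Λ (k + 1) \ Λ k, a x * (θ - G x ω) := by
    ext ω
    rw [Pi.sub_apply, sub_eq_iff_eq_add, Finset.sum_sdiff (hΛ k.le_succ)]
  have hind := indep_iSup_of_disjoint (μ := P) (fun x => (hG.measurable x).comap_le) hG.indep
    (S := ((Λ (k + 1) \ Λ k : Finset (Site d)) : Set (Site d))) (T := (Λ k : Set (Site d)))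
    (by rw [Finset.disjoint_coe]; exact Finset.sdiff_disjoint)
  rw [hdiff]
  have h := condExp_indep_eq (iSup₂_le fun x _ => (hG.measurable x).comap_le)
    ((hG.domainFiltration hΛ).le k)
    (measurable_sum_biSup θ a (Λ (k + 1) \ Λ k)).stronglyMeasurable hind
  rw [hG.integral_sum_eq_zero hθ] at h
  exact h

/-- The uniform `L¹` bound asked for by martingale convergence, obtained from the second moment
through `|s| ≤ 1 + s²`. -/
lemma eLpNorm_sum_le (hG : IsGammaFamily P θ G) (hθ : 0 < θ) {a : Site d → ℝ}
    (ha : Summable fun x => a x ^ 2) (F : Finset (Site d)) :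
    eLpNorm (fun ω => ∑ x ∈ F, a x * (θ - G x ω)) 1 P ≤
      ((1 + θ * ∑' x, a x ^ 2).toNNReal : ℝ≥0∞) := by
  rw [eLpNorm_one_eq_lintegral_enorm]
  have hm : Measurable fun ω => ∑ x ∈ F, a x * (θ - G x ω) :=
    Finset.measurable_fun_sum _ fun x _ => ((hG.measurable x).const_sub θ).const_mul _
  calc ∫⁻ ω, ‖∑ x ∈ F, a x * (θ - G x ω)‖ₑ ∂P
      ≤ ∫⁻ ω, (1 + ENNReal.ofReal ((∑ x ∈ F, a x * (θ - G x ω)) ^ 2)) ∂P := by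
        refine lintegral_mono fun ω => ?_
        simp only
        rw [← ofReal_norm, Real.norm_eq_abs, ← ENNReal.ofReal_one,
          ← ENNReal.ofReal_add zero_le_one (sq_nonneg _)]
        refine ENNReal.ofReal_le_ofReal ?_
        nlinarith [sq_abs (∑ x ∈ F, a x * (θ - G x ω)),
          sq_nonneg (|∑ x ∈ F, a x * (θ - G x ω)| - 1)]
    _ = 1 + ENNReal.ofReal (θ * ∑ x ∈ F, a x ^ 2) := by
        rw [lintegral_add_left measurable_const, hG.lintegral_sum_sq hθ]
        simp
    _ ≤ ENNReal.ofReal (1 + θ * ∑' x, a x ^ 2) := by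
        rw [← ENNReal.ofReal_one, ← ENNReal.ofReal_add zero_le_one
          (mul_nonneg hθ.le (Finset.sum_nonneg fun x _ => sq_nonneg _))]
        refine ENNReal.ofReal_le_ofReal ?_
        have := ha.sum_le_tsum F fun x _ => sq_nonneg _
        nlinarith

lemma exists_ae_tendsto (hG : IsGammaFamily P θ G) (hθ : 0 < θ) {a : Site d → ℝ}
    (ha : Summable fun x => a x ^ 2) {Λ : ℕ → Finset (Site d)} (hΛ : Monotone Λ) :
    ∃ Y : Ω → ℝ, Measurable Y ∧
      ∀ᵐ ω ∂P, Tendsto (fun k => ∑ x ∈ Λ k, a x * (θ - G x ω)) atTop (𝓝 (Y ω)) :=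
  measurable_limit_of_tendsto_metrizable_ae
    (fun k => (Finset.measurable_fun_sum (Λ k) fun x _ =>
      ((hG.measurable x).const_sub θ).const_mul (a x)).aemeasurable)
    ((hG.martingale_sum hθ a hΛ).submartingale.exists_ae_tendsto_of_bdd
      fun k => hG.eLpNorm_sum_le hθ ha (Λ k))

/-- Limits along two exhausting sequences of domains agree almost surely. -/
lemma ae_eq_of_tendsto (hG : IsGammaFamily P θ G) (hθ : 0 < θ) {a : Site d → ℝ}
    (ha : Summable fun x => a x ^ 2) {Λ Λ' : ℕ → Finset (Site d)}
    (hΛ : Tendsto Λ atTop atTop) (hΛ' : Tendsto Λ' atTop atTop) {Y Y' : Ω → ℝ}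
    (hY : ∀ᵐ ω ∂P, Tendsto (fun k => ∑ x ∈ Λ k, a x * (θ - G x ω)) atTop (𝓝 (Y ω)))
    (hY' : ∀ᵐ ω ∂P, Tendsto (fun k => ∑ x ∈ Λ' k, a x * (θ - G x ω)) atTop (𝓝 (Y' ω)))
    (hm : AEMeasurable Y P) (hm' : AEMeasurable Y' P) : Y =ᵐ[P] Y' := by
  classical
  -- The coefficients of the difference of the two partial sums. They vanish on `Λ k ∩ Λ' k`, so
  -- their squares sum to at most the tail of `∑ a²` outside the intersection, which tends to `0`.
  set e : ℕ → Site d → ℝ := fun k x =>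
    a x * ((if x ∈ Λ k then 1 else 0) - (if x ∈ Λ' k then 1 else 0)) with he
  have hlim : ∀ᵐ ω ∂P, Tendsto (fun k => ∑ x ∈ Λ k ∪ Λ' k, e k x * (θ - G x ω)) atTop
      (𝓝 (Y ω - Y' ω)) := by
    filter_upwards [hY, hY'] with ω h1 h2
    refine (h1.sub h2).congr fun k => ?_
    have h3 : ∀ x, e k x * (θ - G x ω) = (if x ∈ Λ k then a x * (θ - G x ω) else 0) -
        if x ∈ Λ' k then a x * (θ - G x ω) else 0 := fun x => by
      simp only [he]; split_ifs <;> ring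
    simp_rw [h3]
    rw [Finset.sum_sub_distrib, Finset.sum_ite_mem, Finset.sum_ite_mem,
      Finset.union_inter_cancel_left,
      Finset.union_inter_cancel_right]
  have hb : ∀ k, ∑ x ∈ Λ k ∪ Λ' k, e k x ^ 2 ≤
      (∑' x, a x ^ 2) - ∑ x ∈ Λ k ∩ Λ' k, a x ^ 2 := by
    intro k
    rw [le_sub_iff_add_le]
    have h1 : ∑ x ∈ Λ k ∪ Λ' k, e k x ^ 2 + ∑ x ∈ Λ k ∩ Λ' k, a x ^ 2 ≤
        ∑ x ∈ Λ k ∪ Λ' k, a x ^ 2 := by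
      have h2 : ∑ x ∈ Λ k ∩ Λ' k, a x ^ 2 =
          ∑ x ∈ Λ k ∪ Λ' k, if x ∈ Λ k ∩ Λ' k then a x ^ 2 else 0 := by
        rw [Finset.sum_ite_mem, Finset.inter_eq_right.2
          (Finset.inter_subset_left.trans Finset.subset_union_left)]
      rw [h2, ← Finset.sum_add_distrib]
      refine Finset.sum_le_sum fun x _ => ?_
      simp only [he, Finset.mem_inter]
      by_cases hx : x ∈ Λ k <;> by_cases hx' : x ∈ Λ' k <;> simp [hx, hx', sq_nonneg]
    exact h1.trans (ha.sum_le_tsum _ fun x _ => sq_nonneg _)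
  have hB : Tendsto (fun k => (∑' x, a x ^ 2) - ∑ x ∈ Λ k ∩ Λ' k, a x ^ 2) atTop (𝓝 0) := by
    have hI : Tendsto (fun k => Λ k ∩ Λ' k) atTop atTop := by
      rw [tendsto_atTop] at hΛ hΛ' ⊢
      intro s
      filter_upwards [hΛ s, hΛ' s] with k h1 h2
      exact Finset.subset_inter h1 h2
    have := (ha.hasSum.comp hI).const_sub (∑' x, a x ^ 2)
    simpa using this
  have h0 := hG.lintegral_sq_le_of_tendsto hθ hlim hb hB
  rw [mul_zero, ENNReal.ofReal_zero, nonpos_iff_eq_zero,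
    lintegral_eq_zero_iff' (AEMeasurable.ennreal_ofReal (by fun_prop))] at h0
  filter_upwards [h0] with ω hω
  have h1 : (Y ω - Y' ω) ^ 2 ≤ 0 := ENNReal.ofReal_eq_zero.1 hω
  have h2 := pow_eq_zero_iff (two_ne_zero) |>.1 (le_antisymm h1 (sq_nonneg _))
  linarith

/-- A random series with square summable coefficients has an almost sure sum, the same along
all exhausting sequences of domains. -/
lemma exists_series (hG : IsGammaFamily P θ G) (hθ : 0 < θ) {a : Site d → ℝ}
    (ha : Summable fun x => a x ^ 2) :
    ∃ Y : Ω → ℝ, Measurable Y ∧ ∀ Λ : ℕ → Finset (Site d), Monotone Λ → (∀ x, ∃ k, x ∈ Λ k) →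
      ∀ᵐ ω ∂P, Tendsto (fun k => ∑ x ∈ Λ k, a x * (θ - G x ω)) atTop (𝓝 (Y ω)) := by
  obtain ⟨Y, hYm, hY⟩ := hG.exists_ae_tendsto hθ ha (siteBox_mono (d := d))
  refine ⟨Y, hYm, fun Λ hΛ hex => ?_⟩
  obtain ⟨Y', hYm', hY'⟩ := hG.exists_ae_tendsto hθ ha hΛ
  have heq := hG.ae_eq_of_tendsto hθ ha (tendsto_atTop_finset_of_monotone hΛ hex)
    (tendsto_atTop_finset_of_monotone siteBox_mono exists_mem_siteBox) hY' hY
    hYm'.aemeasurable hYm.aemeasurable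
  filter_upwards [hY', heq] with ω h1 h2
  rwa [h2] at h1

end IsGammaFamily

end SpatialPartitions

end

/-! ### Poisson variables with random intensity -/

noncomputable section

namespace SpatialPartitions

section Poisson

lemma lintegral_poissonMeasure (r : ℝ≥0) (f : ℕ → ℝ≥0∞) :
    ∫⁻ m, f m ∂poissonMeasure r = ∑' m, poissonMeasure r {m} * f m := by
  rw [lintegral_countable']
  exact tsum_congr fun m => mul_comm _ _

lemma lintegral_pow_poissonMeasure (r : ℝ≥0) {z : ℝ} (hz : 0 ≤ z) :
    ∫⁻ m, ENNReal.ofReal (z ^ m) ∂poissonMeasure r = ENNReal.ofReal (Real.exp (r * (z - 1))) := by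
  have h := (NormedSpace.expSeries_div_hasSum_exp (r * z : ℝ)).mul_left (Real.exp (-r))
  rw [← Real.exp_eq_exp_ℝ, ← Real.exp_add] at h
  rw [lintegral_poissonMeasure, show (r : ℝ) * (z - 1) = -r + r * z by ring, ← h.tsum_eq,
    ENNReal.ofReal_tsum_of_nonneg (fun m => by positivity) h.summable]
  refine tsum_congr fun m => ?_
  rw [poissonMeasure_singleton, ← ENNReal.ofReal_mul (by positivity)]
  congr 1
  ring

lemma poissonMeasure_singleton_succ_mul (r : ℝ≥0) (m : ℕ) :
    poissonMeasure r {m + 1} * ((m + 1 : ℕ) : ℝ≥0∞) = r * poissonMeasure r {m} := by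
  rw [poissonMeasure_singleton, poissonMeasure_singleton, ← ENNReal.ofReal_natCast,
    ← ENNReal.ofReal_mul (by positivity), ← ENNReal.ofReal_coe_nnreal,
    ← ENNReal.ofReal_mul (by positivity)]
  congr 1
  rw [Nat.factorial_succ]
  push_cast
  field_simp
  ring

/-- Stein–Chen identity for the Poisson distribution. -/
lemma lintegral_mul_poissonMeasure (r : ℝ≥0) (f : ℕ → ℝ≥0∞) :
    ∫⁻ m, (m : ℝ≥0∞) * f m ∂poissonMeasure r = r * ∫⁻ m, f (m + 1) ∂poissonMeasure r := by
  rw [lintegral_poissonMeasure, lintegral_poissonMeasure, tsum_eq_zero_add' ENNReal.summable,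
    ← ENNReal.tsum_mul_left]
  simp only [Nat.cast_zero, zero_mul, mul_zero, zero_add]
  refine tsum_congr fun m => ?_
  rw [← mul_assoc, poissonMeasure_singleton_succ_mul, mul_assoc]

lemma lintegral_natCast_poissonMeasure (r : ℝ≥0) :
    ∫⁻ m, (m : ℝ≥0∞) ∂poissonMeasure r = r := by
  have := lintegral_mul_poissonMeasure r fun _ => 1
  simpa using this

lemma lintegral_sq_sub_poissonMeasure (r : ℝ≥0) :
    ∫⁻ m, ENNReal.ofReal (((m : ℝ) - r) ^ 2) ∂poissonMeasure r = r := by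
  have h2 : ∫⁻ m, (m : ℝ≥0∞) * m ∂poissonMeasure r = r * (r + 1) := by
    rw [lintegral_mul_poissonMeasure r fun m => (m : ℝ≥0∞)]
    push_cast
    rw [lintegral_add_right _ measurable_const, lintegral_natCast_poissonMeasure]
    simp
  -- The square is expanded with the cross term moved to the left, so that no subtraction occurs in
  -- `ℝ≥0∞`.
  have hsum : ∫⁻ m : ℕ, (ENNReal.ofReal (((m : ℝ) - r) ^ 2) + 2 * r * m) ∂poissonMeasure r =
      ∫⁻ m : ℕ, ((m : ℝ≥0∞) * m + r * r) ∂poissonMeasure r := by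
    refine lintegral_congr fun m => ?_
    have h1 : (2 * r * m : ℝ≥0∞) = ENNReal.ofReal (2 * r * m) := by
      rw [ENNReal.ofReal_mul (by positivity), ENNReal.ofReal_mul (by positivity)]
      simp
    have h3 : ((m : ℝ≥0∞) * m + r * r) = ENNReal.ofReal ((m : ℝ) * m + r * r) := by
      rw [ENNReal.ofReal_add (by positivity) (by positivity), ENNReal.ofReal_mul (by positivity),
        ENNReal.ofReal_mul (by positivity)]
      simp
    rw [h1, h3, ← ENNReal.ofReal_add (sq_nonneg _) (by positivity)]
    congr 1
    ring
  rw [lintegral_add_left measurable_from_nat, lintegral_add_left measurable_from_nat, h2,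
    lintegral_const_mul _ measurable_from_nat, lintegral_natCast_poissonMeasure,
    lintegral_const, measure_univ, mul_one] at hsum
  have hne : (2 * r * r : ℝ≥0∞) ≠ ∞ := by finiteness
  refine (ENNReal.add_left_inj hne).1 (hsum.trans ?_)
  ring

end Poisson

lemma neg_log_one_sub_le {u : ℝ} (hu : u ≤ 1 / 2) :
    -Real.log (1 - u) ≤ u + 2 * u ^ 2 := by
  have h := Real.one_sub_inv_le_log_of_pos (show 0 < 1 - u by linarith)
  have h2 : (1 - u)⁻¹ ≤ 1 + u + 2 * u ^ 2 := by
    rw [inv_le_iff_one_le_mul₀ (by linarith)]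
    nlinarith [mul_nonneg (sq_nonneg u) (show 0 ≤ 1 - 2 * u by linarith)]
  linarith

variable {d : ℕ} {Ω : Type*} [MeasurableSpace Ω]

/-- The random intensity `∑_x l_x G_x`. -/
def mixedRate (l : Site d → ℝ) (G : Site d → Ω → ℝ) (ω : Ω) : ℝ≥0 :=
  (∑' x, ENNReal.ofReal (l x * G x ω)).toNNReal

namespace IsGammaFamily

variable {P : Measure Ω} {θ : ℝ} {G : Site d → Ω → ℝ} {l : Site d → ℝ}

lemma measurable_mixedRate (hG : IsGammaFamily P θ G) (l : Site d → ℝ) :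
    Measurable (mixedRate l G) := by
  refine Measurable.ennreal_toNNReal (Measurable.tsum fun x => ?_)
  exact ((hG.measurable x).const_mul _).ennreal_ofReal

lemma lintegral_tsum_eq (hG : IsGammaFamily P θ G) (hθ : 0 < θ) (hl : ∀ x, 0 ≤ l x)
    (hs : Summable l) :
    ∫⁻ ω, ∑' x, ENNReal.ofReal (l x * G x ω) ∂P = ENNReal.ofReal (θ * ∑' x, l x) := by
  rw [lintegral_tsum fun x => ((hG.measurable x).const_mul _).ennreal_ofReal.aemeasurable,
    ← tsum_mul_left, ENNReal.ofReal_tsum_of_nonneg (fun x => mul_nonneg hθ.le (hl x))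
    (hs.mul_left θ)]
  refine tsum_congr fun x => ?_
  simp_rw [ENNReal.ofReal_mul (hl x)]
  rw [lintegral_const_mul _ (hG.measurable x).ennreal_ofReal, hG.lintegral_eq hθ,
    ← ENNReal.ofReal_mul (hl x), mul_comm]

lemma ae_tsum_ne_top (hG : IsGammaFamily P θ G) (hθ : 0 < θ) (hl : ∀ x, 0 ≤ l x)
    (hs : Summable l) : ∀ᵐ ω ∂P, ∑' x, ENNReal.ofReal (l x * G x ω) ≠ ∞ := by
  have hm : Measurable fun ω => ∑' x, ENNReal.ofReal (l x * G x ω) :=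
    Measurable.tsum fun x => ((hG.measurable x).const_mul _).ennreal_ofReal
  have := ae_lt_top hm (by rw [hG.lintegral_tsum_eq hθ hl hs]; exact ENNReal.ofReal_ne_top)
  filter_upwards [this] with ω hω using hω.ne

/-- The series has finite mean, so the default value of `toNNReal` at `∞` is taken only on a null
set. -/
lemma ae_hasSum_mixedRate (hG : IsGammaFamily P θ G) (hθ : 0 < θ) (hl : ∀ x, 0 ≤ l x)
    (hs : Summable l) : ∀ᵐ ω ∂P, HasSum (fun x => l x * G x ω) (mixedRate l G ω) := by
  filter_upwards [hG.ae_tsum_ne_top hθ hl hs] with ω hω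
  have h0 : ∀ x, 0 ≤ l x * G x ω := fun x => mul_nonneg (hl x) (hG.nonneg x ω)
  have h1 := (ENNReal.summable_toReal hω).hasSum
  rw [← ENNReal.tsum_toReal_eq fun x => ENNReal.ofReal_ne_top] at h1
  rw [← ENNReal.coe_toNNReal_eq_toReal] at h1
  simp only [ENNReal.toReal_ofReal (h0 _)] at h1
  exact h1

lemma lintegral_mixedRate (hG : IsGammaFamily P θ G) (hθ : 0 < θ) (hl : ∀ x, 0 ≤ l x)
    (hs : Summable l) :
    ∫⁻ ω, (mixedRate l G ω : ℝ≥0∞) ∂P = ENNReal.ofReal (θ * ∑' x, l x) := by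
  rw [← hG.lintegral_tsum_eq hθ hl hs]
  refine lintegral_congr_ae ?_
  filter_upwards [hG.ae_tsum_ne_top hθ hl hs] with ω hω
  exact ENNReal.coe_toNNReal hω

lemma lintegral_exp_sum (hG : IsGammaFamily P θ G) (hθ : 0 < θ) {s : ℝ}
    (hs : ∀ x, s * l x < 1) (F : Finset (Site d)) :
    ∫⁻ ω, ENNReal.ofReal (Real.exp (s * ∑ x ∈ F, l x * G x ω)) ∂P =
      ENNReal.ofReal (Real.exp (-(θ * ∑ x ∈ F, Real.log (1 - s * l x)))) := by
  have h1 : ∀ ω, ENNReal.ofReal (Real.exp (s * ∑ x ∈ F, l x * G x ω)) =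
      ∏ x ∈ F, ENNReal.ofReal (Real.exp (s * l x * G x ω)) := by
    intro ω
    rw [Finset.mul_sum, Real.exp_sum, ENNReal.ofReal_prod_of_nonneg fun _ _ => (Real.exp_pos _).le]
    simp only [mul_assoc]
  simp_rw [h1]
  rw [lintegral_prod_eq_prod_lintegral_of_indepFun F
    (fun x ω => ENNReal.ofReal (Real.exp (s * l x * G x ω)))
    (hG.indep.comp (fun x t => ENNReal.ofReal (Real.exp (s * l x * t))) (by fun_prop))
    fun x => ((hG.measurable x).const_mul _).exp.ennreal_ofReal]
  rw [Finset.mul_sum, ← Finset.sum_neg_distrib, Real.exp_sum,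
    ENNReal.ofReal_prod_of_nonneg fun _ _ => (Real.exp_pos _).le]
  refine Finset.prod_congr rfl fun x _ => ?_
  rw [hG.lintegral_exp_eq hθ (hs x), Real.rpow_def_of_pos (by linarith [hs x])]
  congr 2
  ring

/-- An exponential moment bound for the random intensity. -/
lemma lintegral_exp_mixedRate_le (hG : IsGammaFamily P θ G) (hθ : 0 < θ) (hl : ∀ x, 0 ≤ l x)
    (hs : Summable l) (hs2 : Summable fun x => l x ^ 2) {t : ℝ} (ht : 0 ≤ t)
    (htl : ∀ x, t * l x ≤ 1 / 2) :
    ∫⁻ ω, ENNReal.ofReal (Real.exp (mixedRate l G ω * t)) ∂P ≤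
      ENNReal.ofReal (Real.exp (θ * (t * ∑' x, l x + 2 * t ^ 2 * ∑' x, l x ^ 2))) := by
  have hlt : ∀ x, t * l x < 1 := fun x => (htl x).trans_lt (by norm_num)
  calc ∫⁻ ω, ENNReal.ofReal (Real.exp (mixedRate l G ω * t)) ∂P
      -- Only an upper bound is wanted, so Fatou's lemma along boxes suffices. On a box the moment
      -- factorizes, and `t * l x ≤ 1/2` makes the logarithms quadratic errors.
      = ∫⁻ ω, liminf (fun k => ENNReal.ofReal
          (Real.exp (t * ∑ x ∈ siteBox d k, l x * G x ω))) atTop ∂P := by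
        refine lintegral_congr_ae ?_
        filter_upwards [hG.ae_hasSum_mixedRate hθ hl hs] with ω hω
        refine (Tendsto.liminf_eq ?_).symm
        refine ENNReal.tendsto_ofReal ((Real.continuous_exp.tendsto _).comp ?_)
        rw [mul_comm]
        exact (hω.comp tendsto_siteBox_atTop).const_mul t
    _ ≤ liminf (fun k => ∫⁻ ω, ENNReal.ofReal
          (Real.exp (t * ∑ x ∈ siteBox d k, l x * G x ω)) ∂P) atTop := by
        refine lintegral_liminf_le fun k => ?_
        have : Measurable fun ω => ∑ x ∈ siteBox d k, l x * G x ω :=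
          Finset.measurable_fun_sum _ fun x _ => (hG.measurable x).const_mul _
        exact (this.const_mul _).exp.ennreal_ofReal
    _ ≤ liminf (fun _ : ℕ => ENNReal.ofReal
          (Real.exp (θ * (t * ∑' x, l x + 2 * t ^ 2 * ∑' x, l x ^ 2)))) atTop := by
        refine liminf_le_liminf (Eventually.of_forall fun k => ?_)
        rw [hG.lintegral_exp_sum hθ hlt]
        refine ENNReal.ofReal_le_ofReal (Real.exp_le_exp.2 ?_)
        rw [← mul_neg, ← Finset.sum_neg_distrib]
        refine mul_le_mul_of_nonneg_left ?_ hθ.le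
        calc ∑ x ∈ siteBox d k, -Real.log (1 - t * l x)
            ≤ ∑ x ∈ siteBox d k, (t * l x + 2 * (t * l x) ^ 2) :=
              Finset.sum_le_sum fun x _ => neg_log_one_sub_le (htl x)
          _ = t * ∑ x ∈ siteBox d k, l x + 2 * t ^ 2 * ∑ x ∈ siteBox d k, l x ^ 2 := by
              rw [Finset.sum_add_distrib, Finset.mul_sum, Finset.mul_sum]
              congr 1
              exact Finset.sum_congr rfl fun x _ => by ring
          _ ≤ _ := by
              have h1 := hs.sum_le_tsum (siteBox d k) fun x _ => hl x
              have h2 := hs2.sum_le_tsum (siteBox d k) fun x _ => sq_nonneg _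
              gcongr
    _ = _ := liminf_const _

/-- The Poisson distribution with random intensity, as a kernel. -/
def poissonKernel (hG : IsGammaFamily P θ G) (l : Site d → ℝ) : Kernel Ω ℕ where
  toFun ω := poissonMeasure (mixedRate l G ω)
  measurable' := by
    refine Measure.measurable_of_measurable_coe _ fun s hs => ?_
    have h : ∀ r : ℝ≥0, poissonMeasure r s = ∑' m, ENNReal.ofReal
        (Real.exp (-r) * r ^ m / (m.factorial)) * (Measure.dirac m s) := by
      intro r
      rw [poissonMeasure, Measure.sum_apply _ hs]
      rfl
    simp_rw [h]
    have hm := hG.measurable_mixedRate l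
    refine Measurable.tsum fun m => Measurable.mul_const ?_ _
    fun_prop

instance (hG : IsGammaFamily P θ G) (l : Site d → ℝ) : IsMarkovKernel (hG.poissonKernel l) :=
  ⟨fun ω => inferInstanceAs (IsProbabilityMeasure (poissonMeasure (mixedRate l G ω)))⟩

/-- The joint law of the gamma variables and a count which is Poisson given its intensity. -/
def jointLaw (hG : IsGammaFamily P θ G) (l : Site d → ℝ) : Measure (Ω × ℕ) :=
  P ⊗ₘ hG.poissonKernel l

lemma lintegral_jointLaw_snd (hG : IsGammaFamily P θ G) (l : Site d → ℝ) (f : ℕ → ℝ≥0∞) :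
    ∫⁻ q, f q.2 ∂hG.jointLaw l = ∑' m, hG.jointLaw l (Prod.snd ⁻¹' {m}) * f m := by
  have h : ∫⁻ m, f m ∂((hG.jointLaw l).map Prod.snd) = ∫⁻ q, f q.2 ∂hG.jointLaw l :=
    lintegral_map measurable_from_nat measurable_snd
  rw [← h, lintegral_countable']
  refine tsum_congr fun m => ?_
  rw [Measure.map_apply measurable_snd (measurableSet_singleton m), mul_comm]

variable [IsProbabilityMeasure P]

/-- The Laplace transform of the random intensity. -/
lemma lintegral_exp_neg_mixedRate (hG : IsGammaFamily P θ G) (hθ : 0 < θ) (hl : ∀ x, 0 ≤ l x)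
    (hs : Summable l) {s : ℝ} (hs0 : 0 ≤ s) (hlog : Summable fun x => Real.log (1 + l x * s)) :
    ∫⁻ ω, ENNReal.ofReal (Real.exp (mixedRate l G ω * (-s))) ∂P =
      ENNReal.ofReal (Real.exp (-(θ * ∑' x, Real.log (1 + l x * s)))) := by
  have hlt : ∀ x, -s * l x < 1 := fun x => by nlinarith [mul_nonneg hs0 (hl x)]
  have hR : Tendsto (fun k => ∫⁻ ω, ENNReal.ofReal
      (Real.exp (-s * ∑ x ∈ siteBox d k, l x * G x ω)) ∂P) atTop
      (𝓝 (ENNReal.ofReal (Real.exp (-(θ * ∑' x, Real.log (1 + l x * s)))))) := by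
    simp_rw [hG.lintegral_exp_sum hθ hlt]
    refine ENNReal.tendsto_ofReal ((Real.continuous_exp.tendsto _).comp ?_)
    have := ((hlog.hasSum.comp tendsto_siteBox_atTop).const_mul θ).neg
    refine this.congr fun k => ?_
    simp only [Function.comp_apply]
    congr 2
    refine Finset.sum_congr rfl fun x _ => ?_
    ring_nf
  refine tendsto_nhds_unique ?_ hR
  -- With a negative exponent the integrands are bounded by `1`, so equality passes to the limit.
  refine tendsto_lintegral_of_dominated_convergence (fun _ => 1) (fun k => ?_) (fun k => ?_)
    (by simp) ?_
  · have : Measurable fun ω => ∑ x ∈ siteBox d k, l x * G x ω :=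
      Finset.measurable_fun_sum _ fun x _ => (hG.measurable x).const_mul _
    exact (this.const_mul _).exp.ennreal_ofReal
  · refine ae_of_all _ fun ω => ?_
    rw [ENNReal.ofReal_le_one, Real.exp_le_one_iff]
    have : 0 ≤ ∑ x ∈ siteBox d k, l x * G x ω :=
      Finset.sum_nonneg fun x _ => mul_nonneg (hl x) (hG.nonneg x ω)
    nlinarith
  · filter_upwards [hG.ae_hasSum_mixedRate hθ hl hs] with ω hω
    refine ENNReal.tendsto_ofReal ((Real.continuous_exp.tendsto _).comp ?_)
    rw [mul_comm]
    exact (hω.comp tendsto_siteBox_atTop).const_mul (-s)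

/-- Mean square distance between the centred intensity and a random series. -/
lemma lintegral_sq_mixedRate_sub_le (hG : IsGammaFamily P θ G) (hθ : 0 < θ) (hl : ∀ x, 0 ≤ l x)
    (hs : Summable l) (κ : ℝ) {a : Site d → ℝ} {Y : Ω → ℝ}
    (hY : ∀ᵐ ω ∂P, Tendsto (fun k => ∑ x ∈ siteBox d k, a x * (θ - G x ω)) atTop (𝓝 (Y ω)))
    (ha : Summable fun x => (κ * l x - a x) ^ 2) :
    ∫⁻ ω, ENNReal.ofReal ((κ * (θ * ∑' x, l x - mixedRate l G ω) - Y ω) ^ 2) ∂P ≤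
      ENNReal.ofReal (θ * ∑' x, (κ * l x - a x) ^ 2) := by
  refine hG.lintegral_sq_le_of_tendsto hθ (a := fun _ x => κ * l x - a x) (F := siteBox d)
    (b := fun k => ∑ x ∈ siteBox d k, (κ * l x - a x) ^ 2) ?_ (fun k => le_rfl)
    (ha.hasSum.comp tendsto_siteBox_atTop)
  filter_upwards [hY, hG.ae_hasSum_mixedRate hθ hl hs] with ω h1 h2
  have h3 := (((hs.hasSum.mul_left θ).sub h2).mul_left κ).comp tendsto_siteBox_atTop
  refine (h3.sub h1).congr fun k => ?_
  simp only [Function.comp_apply]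
  rw [← Finset.sum_sub_distrib]
  exact Finset.sum_congr rfl fun x _ => by ring

instance (hG : IsGammaFamily P θ G) (l : Site d → ℝ) : IsProbabilityMeasure (hG.jointLaw l) := by
  unfold jointLaw; infer_instance

lemma lintegral_jointLaw (hG : IsGammaFamily P θ G) (l : Site d → ℝ) {f : Ω × ℕ → ℝ≥0∞}
    (hf : Measurable f) :
    ∫⁻ q, f q ∂hG.jointLaw l = ∫⁻ ω, ∫⁻ m, f (ω, m) ∂poissonMeasure (mixedRate l G ω) ∂P :=
  Measure.lintegral_compProd hf

/-- Given the intensity, the variance of the count equals the intensity, whose mean is `θ ∑ l`. -/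
lemma lintegral_jointLaw_sq (hG : IsGammaFamily P θ G) (hθ : 0 < θ) (hl : ∀ x, 0 ≤ l x)
    (hs : Summable l) :
    ∫⁻ q, ENNReal.ofReal (((q.2 : ℝ) - mixedRate l G q.1) ^ 2) ∂hG.jointLaw l =
      ENNReal.ofReal (θ * ∑' x, l x) := by
  have hm := hG.measurable_mixedRate l
  rw [hG.lintegral_jointLaw l (by fun_prop)]
  simp only [lintegral_sq_sub_poissonMeasure]
  exact hG.lintegral_mixedRate hθ hl hs

lemma lintegral_jointLaw_pow_le (hG : IsGammaFamily P θ G) (hθ : 0 < θ) (hl : ∀ x, 0 ≤ l x)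
    (hs : Summable l) (hs2 : Summable fun x => l x ^ 2) {t : ℝ} (ht : 0 ≤ t)
    (htl : ∀ x, t * l x ≤ 1 / 2) :
    ∫⁻ q, ENNReal.ofReal ((1 + t) ^ q.2) ∂hG.jointLaw l ≤
      ENNReal.ofReal (Real.exp (θ * (t * ∑' x, l x + 2 * t ^ 2 * ∑' x, l x ^ 2))) := by
  rw [hG.lintegral_jointLaw l (by fun_prop)]
  simp only [lintegral_pow_poissonMeasure _ (show 0 ≤ 1 + t by linarith), add_sub_cancel_left]
  exact hG.lintegral_exp_mixedRate_le hθ hl hs hs2 ht htl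

/-- Given the intensity `Λ`, the generating function is `exp(-(1 - z) Λ)`. The result is exactly the
function that characterizes `ν` in `splitWeight_eq`; this is the link between partitions and gamma
variables. -/
lemma tsum_jointLaw_mul_pow (hG : IsGammaFamily P θ G) (hθ : 0 < θ) (hl : ∀ x, 0 ≤ l x)
    (hs : Summable l) (z : ℝ≥0) (hz : z < 1)
    (hlog : Summable fun x => Real.log (1 + l x * (1 - z))) :
    ∑' m, hG.jointLaw l (Prod.snd ⁻¹' {m}) * (z : ℝ≥0∞) ^ m =
      ENNReal.ofReal (Real.exp (-(θ * ∑' x, Real.log (1 + l x * (1 - z))))) := by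
  have hz' : (z : ℝ) < 1 := by exact_mod_cast hz
  have h := hG.lintegral_exp_neg_mixedRate hθ hl hs (sub_nonneg.2 hz'.le) hlog
  rw [← h, ← hG.lintegral_jointLaw_snd l fun m => (z : ℝ≥0∞) ^ m,
    hG.lintegral_jointLaw l (by fun_prop)]
  refine lintegral_congr fun ω => ?_
  rw [neg_sub, ← lintegral_pow_poissonMeasure _ z.coe_nonneg]
  refine lintegral_congr fun m => ?_
  rw [ENNReal.ofReal_pow z.coe_nonneg, ENNReal.ofReal_coe_nnreal]

end IsGammaFamily

end SpatialPartitions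

end

/-! ### The canonical measure as a tilted Poisson mixture -/

noncomputable section

namespace SpatialPartitions

variable {d : ℕ}

lemma SpatialPartition.exists_size_eq (d n : ℕ) : ∃ p : SpatialPartition d, p.size = n := by
  classical
  refine ⟨Finsupp.single 0 (Multiset.replicate n 1), ?_⟩
  rw [SpatialPartition.size_eq]
  have h1 : SpatialPartition.occupation (d := d) (Finsupp.single 0 (Multiset.replicate n 1)) 0
      = n := by
    simp [SpatialPartition.occupation]
  have h2 : SpatialPartition.offOrigin (d := d) (Finsupp.single 0 (Multiset.replicate n 1))
      = 0 := by
    refine Finset.sum_eq_zero fun x hx => ?_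
    exact absurd
      (Finset.mem_singleton.1 (Finsupp.support_single_subset (Finset.mem_of_mem_erase hx)))
      (Finset.ne_of_mem_erase hx)
  rw [h1, h2, add_zero]

lemma SpatialPartition.eq_zero_of_size_eq_zero {p : SpatialPartition d} (h : p.size = 0) :
    p = 0 := by
  ext1 x
  by_contra hx
  have h1 : p.occupation x = 0 :=
    Finset.sum_eq_zero_iff.1 h x (Finsupp.mem_support_iff.2 hx)
  obtain ⟨j, hj⟩ := Multiset.exists_mem_of_ne_zero hx
  have h2 := Multiset.sum_eq_zero_iff.1 h1 (j : ℕ) (Multiset.mem_map_of_mem _ hj)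
  exact j.ne_zero h2

lemma partitionFunction_ne_zero (V : EuclideanSpace ℝ (Fin d) → ℝ) {θ : ℝ} (hθ : 0 < θ) (L : ℝ)
    (n : ℕ) : partitionFunction V (fun _ => θ) L n ≠ 0 := by
  obtain ⟨p, hp⟩ := SpatialPartition.exists_size_eq d n
  have h := ENNReal.le_tsum (f := fun p : Configuration d n =>
    ENNReal.ofReal (p.1.weight V (fun _ => θ) L)) ⟨p, hp⟩
  exact ((ENNReal.ofReal_pos.2 (weight_pos V hθ L p)).trans_le h).ne'

/-- Treated apart because `length d ρ 0` is `0` in positive dimension: all rescaled positions then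
collapse to the origin and the rates are no longer positive. -/
lemma partitionFunction_zero_ne_top (V : EuclideanSpace ℝ (Fin d) → ℝ) (θ L : ℝ) :
    partitionFunction V (fun _ => θ) L 0 ≠ ∞ := by
  have : Subsingleton (Configuration d 0) := ⟨fun p q => Subtype.ext
    ((SpatialPartition.eq_zero_of_size_eq_zero p.2).trans
      (SpatialPartition.eq_zero_of_size_eq_zero q.2).symm)⟩
  have : Finite (Configuration d 0) := Finite.of_subsingleton
  have := Fintype.ofFinite (Configuration d 0)
  rw [partitionFunction, tsum_fintype]
  exact (ENNReal.sum_lt_top.2 fun p _ => ENNReal.ofReal_lt_top).ne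

instance (d n : ℕ) : MeasurableSingletonClass (Configuration d n) := ⟨fun _ => trivial⟩

lemma lintegral_canonicalMeasure (V : EuclideanSpace ℝ (Fin d) → ℝ) (θ L : ℝ) (n : ℕ)
    (f : Configuration d n → ℝ≥0∞) :
    ∫⁻ p, f p ∂canonicalMeasure V (fun _ => θ) L n =
      (∑' p : Configuration d n, ENNReal.ofReal (p.1.weight V (fun _ => θ) L) * f p) /
        partitionFunction V (fun _ => θ) L n := by
  rw [canonicalMeasure, lintegral_sum_measure, ENNReal.div_eq_inv_mul, ← ENNReal.tsum_mul_left]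
  refine tsum_congr fun p => ?_
  rw [lintegral_smul_measure, lintegral_dirac, smul_eq_mul, ENNReal.div_eq_inv_mul, mul_assoc]

lemma isProbabilityMeasure_canonicalMeasure (V : EuclideanSpace ℝ (Fin d) → ℝ) {θ : ℝ}
    (hθ : 0 < θ) (L : ℝ) (n : ℕ) (htop : partitionFunction V (fun _ => θ) L n ≠ ∞) :
    IsProbabilityMeasure (canonicalMeasure V (fun _ => θ) L n) := by
  constructor
  rw [← lintegral_one, lintegral_canonicalMeasure]
  simp only [mul_one]
  exact ENNReal.div_self (partitionFunction_ne_zero V hθ L n) htop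

lemma measurable_originOccupation (d n : ℕ) :
    Measurable (originOccupation : Configuration d n → ℕ) := fun _ _ => trivial

/-- The relative weight of leaving `n - m` particles at the origin. -/
def tilt (θ : ℝ) (n m : ℕ) : ℝ :=
  if m ≤ n then risingCoeff θ (n - m) / risingCoeff θ n else 0

lemma tilt_nonneg {θ : ℝ} (hθ : 0 < θ) (n m : ℕ) : 0 ≤ tilt θ n m := by
  unfold tilt
  split_ifs
  · exact (div_pos (risingCoeff_pos hθ _) (risingCoeff_pos hθ _)).le
  · exact le_rfl

lemma exists_tilt_le (θ : ℝ) (n : ℕ) : ∃ C, ∀ m, tilt θ n m ≤ C := by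
  obtain ⟨C, hC⟩ := (((Set.finite_Iic n).image (tilt θ n)).bddAbove)
  refine ⟨max C 0, fun m => ?_⟩
  by_cases hm : m ≤ n
  · exact (hC ⟨m, hm, rfl⟩).trans (le_max_left _ _)
  · rw [tilt, if_neg hm]; exact le_max_right _ _

section

variable {Ω : Type*} [MeasurableSpace Ω] {P : Measure Ω} [IsProbabilityMeasure P]
  {θ L : ℝ} {G : Site d → Ω → ℝ} {V : EuclideanSpace ℝ (Fin d) → ℝ}

/-- The constant is `a_n ∏ (1 + l_x)^θ`; it does not depend on `f` and disappears after
normalization. The truncated subtraction `n - q.2` is harmless, because the tilt vanishes when `q.2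
> n`. -/
lemma tsum_configuration_eq (hG : IsGammaFamily P θ G) (hθ : 0 < θ) (h0 : V (rescale L 0) = 0)
    (hpos : ∀ x : Site d, x ≠ 0 → 0 < V (rescale L x))
    (hsum : Summable (siteRate V L : Site d → ℝ)) (n : ℕ) :
    ∃ C : ℝ≥0∞, C ≠ 0 ∧ C ≠ ∞ ∧ ∀ f : ℕ → ℝ≥0∞,
      ∑' p : Configuration d n, ENNReal.ofReal (p.1.weight V (fun _ => θ) L) *
        f (originOccupation p) =
      C * ∫⁻ q, ENNReal.ofReal (tilt θ n q.2) * f (n - q.2) ∂hG.jointLaw (siteRate V L) := by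
  have hl := siteRate_nonneg h0 hpos
  have ha := risingCoeff_pos hθ n
  set ν : ℕ → ℝ≥0∞ := fun m => hG.jointLaw (siteRate V L) (Prod.snd ⁻¹' {m}) with hν
  set C := ENNReal.ofReal (Real.exp (θ * ∑' x : Site d, Real.log (1 + siteRate V L x))) with hC
  have hsplit := splitWeight_eq (ν := ν) h0 hpos hsum hθ fun z hz0 hz1 =>
    hG.tsum_jointLaw_mul_pow hθ hl hsum z hz1
      (summable_log_one_add_mul h0 hpos hsum (sub_nonneg.2 (by exact_mod_cast hz1.le)))
  refine ⟨C * ENNReal.ofReal (risingCoeff θ n), ?_, by finiteness, fun f => ?_⟩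
  · exact mul_ne_zero (ENNReal.ofReal_pos.2 (Real.exp_pos _)).ne' (ENNReal.ofReal_pos.2 ha).ne'
  rw [hG.lintegral_jointLaw_snd _ fun m => ENNReal.ofReal (tilt θ n m) * f (n - m)]
  have hL : ∑' p : Configuration d n, ENNReal.ofReal (p.1.weight V (fun _ => θ) L) *
        f (originOccupation p) =
      ∑' p : SpatialPartition d, ENNReal.ofReal (p.weight V (fun _ => θ) L) *
        (if p.occupation 0 + p.offOrigin = n then f (p.occupation 0) else 0) := by
    have := tsum_subtype {p : SpatialPartition d | p.size = n} fun p =>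
      ENNReal.ofReal (p.weight V (fun _ => θ) L) * f (p.occupation 0)
    refine Eq.trans this (tsum_congr fun p => ?_)
    rw [Set.indicator_apply]
    simp only [Set.mem_ofPred_eq, p.size_eq]
    split_ifs <;> simp
  rw [hL, ← tsum_splitWeight_mul V θ L fun k m => if k + m = n then f k else 0,
    ← ENNReal.tsum_mul_left]
  refine tsum_congr fun m => ?_
  rw [tilt]
  split_ifs with hm
  · rw [tsum_eq_single (n - m)]
    · rw [if_pos (Nat.sub_add_cancel hm), hsplit, ENNReal.ofReal_div_of_pos ha]
      have h1 : ENNReal.ofReal (risingCoeff θ n) ≠ 0 := (ENNReal.ofReal_pos.2 ha).ne'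
      calc _ = (C * ν m * ENNReal.ofReal (risingCoeff θ (n - m)) * f (n - m)) * 1 := by ring
        _ = (C * ν m * ENNReal.ofReal (risingCoeff θ (n - m)) * f (n - m)) *
            (ENNReal.ofReal (risingCoeff θ n) * (ENNReal.ofReal (risingCoeff θ n))⁻¹) := by
          rw [ENNReal.mul_inv_cancel h1 ENNReal.ofReal_ne_top]
        _ = _ := by rw [ENNReal.div_eq_inv_mul]; ring
    · intro k hk
      rw [if_neg (by omega), mul_zero]
  · simp only [ENNReal.ofReal_zero, zero_mul, mul_zero]
    refine ENNReal.tsum_eq_zero.2 fun k => ?_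
    rw [if_neg (by omega), mul_zero]

lemma lintegral_tilt_ne_top (hG : IsGammaFamily P θ G) (l : Site d → ℝ) (n : ℕ) :
    ∫⁻ q, ENNReal.ofReal (tilt θ n q.2) ∂hG.jointLaw l ≠ ∞ := by
  obtain ⟨C, hC⟩ := exists_tilt_le θ n
  have h : ∫⁻ q, ENNReal.ofReal (tilt θ n q.2) ∂hG.jointLaw l ≤
      ∫⁻ _, ENNReal.ofReal C ∂hG.jointLaw l :=
    lintegral_mono fun q => ENNReal.ofReal_le_ofReal (hC q.2)
  refine (h.trans_lt ?_).ne
  simp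

lemma integrable_tilt_mul (hG : IsGammaFamily P θ G) (hθ : 0 < θ) (l : Site d → ℝ) (n : ℕ)
    {g : Ω × ℕ → ℝ} (hg : Measurable g) {K : ℝ} (hK : ∀ q, |g q| ≤ K) :
    Integrable (fun q => tilt θ n q.2 * g q) (hG.jointLaw l) := by
  obtain ⟨C, hC⟩ := exists_tilt_le θ n
  refine Integrable.of_bound (C := C * K) ?_ (ae_of_all _ fun q => ?_)
  · exact (((measurable_from_nat (f := tilt θ n)).comp measurable_snd).mul hg).aestronglyMeasurable
  · rw [norm_mul, Real.norm_of_nonneg (tilt_nonneg hθ n q.2), Real.norm_eq_abs]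
    exact mul_le_mul (hC _) (hK q) (abs_nonneg _) ((tilt_nonneg hθ n q.2).trans (hC _))

lemma partitionFunction_ne_top (hG : IsGammaFamily P θ G) (hθ : 0 < θ) (h0 : V (rescale L 0) = 0)
    (hpos : ∀ x : Site d, x ≠ 0 → 0 < V (rescale L x))
    (hsum : Summable (siteRate V L : Site d → ℝ)) (n : ℕ) :
    partitionFunction V (fun _ => θ) L n ≠ ∞ := by
  obtain ⟨C, hC0, hC, h⟩ := tsum_configuration_eq hG hθ h0 hpos hsum n
  have h1 := h fun _ => 1
  simp only [mul_one] at h1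
  rw [partitionFunction, h1]
  exact ENNReal.mul_ne_top hC (lintegral_tilt_ne_top hG _ n)

/-- Under the canonical measure the occupation of the origin is distributed as `n - M` under the
tilted joint law. -/
lemma integral_canonicalMeasure (hG : IsGammaFamily P θ G) (hθ : 0 < θ)
    (h0 : V (rescale L 0) = 0) (hpos : ∀ x : Site d, x ≠ 0 → 0 < V (rescale L x))
    (hsum : Summable (siteRate V L : Site d → ℝ)) (n : ℕ) (g : ℕ → ℝ) :
    0 < ∫ q, tilt θ n q.2 ∂hG.jointLaw (siteRate V L) ∧
    ∫ p, g (originOccupation p) ∂canonicalMeasure V (fun _ => θ) L n =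
      (∫ q, tilt θ n q.2 * g (n - q.2) ∂hG.jointLaw (siteRate V L)) /
        ∫ q, tilt θ n q.2 ∂hG.jointLaw (siteRate V L) := by
  obtain ⟨C, hC0, hC, h⟩ := tsum_configuration_eq hG hθ h0 hpos hsum n
  set Q := hG.jointLaw (siteRate V L) with hQ
  set I := ∫⁻ q, ENNReal.ofReal (tilt θ n q.2) ∂Q with hI
  have hItop : I ≠ ∞ := lintegral_tilt_ne_top hG _ n
  have hZ : partitionFunction V (fun _ => θ) L n = C * I := by
    have h1 := h fun _ => 1
    simp only [mul_one] at h1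
    rw [partitionFunction, h1]
  have hI0 : I ≠ 0 := by
    intro hI0
    rw [hI0, mul_zero] at hZ
    exact partitionFunction_ne_zero V hθ L n hZ
  have hmt : Measurable fun q : Ω × ℕ => tilt θ n q.2 :=
    (measurable_from_nat (f := tilt θ n)).comp measurable_snd
  have hIr : ∫ q, tilt θ n q.2 ∂Q = I.toReal :=
    integral_eq_lintegral_of_nonneg_ae (ae_of_all _ fun q => tilt_nonneg hθ n q.2)
      hmt.aestronglyMeasurable
  refine ⟨hIr ▸ ENNReal.toReal_pos hI0 hItop, ?_⟩
  have hms : Measurable fun q : Ω × ℕ => n - q.2 :=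
    (measurable_from_nat (f := fun m => n - m)).comp measurable_snd
  -- The identity for nonnegative functions, applied to indicators, identifies two laws on `ℕ`; real
  -- integrands then follow by change of variables.
  have hmeas : (canonicalMeasure V (fun _ => θ) L n).map originOccupation =
      (Q.withDensity fun q => ENNReal.ofReal (tilt θ n q.2) / I).map fun q => n - q.2 := by
    refine Measure.ext fun s hs => ?_
    have hf : Measurable (s.indicator (1 : ℕ → ℝ≥0∞)) := measurable_one.indicator hs
    rw [← lintegral_indicator_one hs, ← lintegral_indicator_one hs,
      lintegral_map hf (measurable_originOccupation d n),
      lintegral_map hf hms, lintegral_canonicalMeasure, h, hZ,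
      lintegral_withDensity_eq_lintegral_mul _
        (f := fun q : Ω × ℕ => ENNReal.ofReal (tilt θ n q.2) / I)
        (by fun_prop) (g := fun q : Ω × ℕ => s.indicator (1 : ℕ → ℝ≥0∞) (n - q.2)) (hf.comp hms),
      ENNReal.mul_div_mul_left _ _ hC0 hC, ENNReal.div_eq_inv_mul,
      ← lintegral_const_mul _ (by fun_prop)]
    refine lintegral_congr fun q => ?_
    rw [Pi.mul_apply, ENNReal.div_eq_inv_mul, mul_assoc]
  have hg : ∀ μ : Measure ℕ, AEStronglyMeasurable g μ := fun μ =>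
    (measurable_from_nat (f := g)).aestronglyMeasurable
  calc ∫ p, g (originOccupation p) ∂canonicalMeasure V (fun _ => θ) L n
      = ∫ k, g k ∂(canonicalMeasure V (fun _ => θ) L n).map originOccupation :=
        (integral_map (measurable_originOccupation d n).aemeasurable (hg _)).symm
    _ = ∫ q, g (n - q.2) ∂Q.withDensity fun q => ENNReal.ofReal (tilt θ n q.2) / I := by
        rw [hmeas, integral_map hms.aemeasurable (hg _)]
    _ = ∫ q, (ENNReal.ofReal (tilt θ n q.2) / I).toReal • g (n - q.2) ∂Q := by
        rw [integral_withDensity_eq_integral_toReal_smul (by fun_prop)]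
        exact ae_of_all _ fun q => ENNReal.div_lt_top ENNReal.ofReal_ne_top hI0
    _ = _ := by
        rw [hIr, ← integral_div]
        refine integral_congr_ae (ae_of_all _ fun q => ?_)
        simp only [ENNReal.toReal_div, ENNReal.toReal_ofReal (tilt_nonneg hθ n q.2), smul_eq_mul]
        ring

end

end SpatialPartitions

end

/-! ### Bounds and asymptotics of the tilt -/

noncomputable section

namespace SpatialPartitions

variable {θ : ℝ}

lemma risingCoeff_succ_mul (θ : ℝ) (k : ℕ) :
    ((k : ℝ) + 1) * risingCoeff θ (k + 1) = (θ + k) * risingCoeff θ k := by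
  unfold risingCoeff
  rw [Finset.prod_range_succ, Nat.factorial_succ]
  push_cast
  field_simp

/-- The coefficients themselves decrease when `θ < 1`; after multiplication by `k` they increase for
every `θ > 0`. -/
lemma monotone_mul_risingCoeff (hθ : 0 < θ) : Monotone fun k : ℕ => (k : ℝ) * risingCoeff θ k := by
  refine monotone_nat_of_le_succ fun k => ?_
  push_cast
  rw [risingCoeff_succ_mul]
  exact mul_le_mul_of_nonneg_right (by linarith) (risingCoeff_pos hθ k).le

/-- For `k ≥ 1`, `k + 1 ≤ 2k` costs the factor `2`. At `k = 0` monotonicity says nothing about `a_0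
= 1`, which is compared with `a_1 = θ` and costs `θ⁻¹`. -/
lemma succ_mul_risingCoeff_le (hθ : 0 < θ) {k n : ℕ} (hn : 1 ≤ n) (hk : k ≤ n) :
    ((k : ℝ) + 1) * risingCoeff θ k ≤ (2 + θ⁻¹) * (n * risingCoeff θ n) := by
  have hmono := monotone_mul_risingCoeff hθ
  have hn0 : 0 ≤ (n : ℝ) * risingCoeff θ n := mul_nonneg n.cast_nonneg (risingCoeff_pos hθ n).le
  rcases Nat.eq_zero_or_pos k with rfl | hk0
  · have h1 : θ ≤ n * risingCoeff θ n := by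
      have := hmono hn
      simpa [risingCoeff] using this
    have h2 : 1 ≤ θ⁻¹ * (n * risingCoeff θ n) := by
      rw [← inv_mul_cancel₀ hθ.ne']
      exact mul_le_mul_of_nonneg_left h1 (inv_pos.2 hθ).le
    simp only [risingCoeff, Finset.range_zero, Finset.prod_empty, Nat.factorial_zero,
      Nat.cast_one, Nat.cast_zero, div_one, zero_add, one_mul]
    unfold risingCoeff at h2 hn0
    linarith
  · have h1 := hmono hk
    simp only at h1
    have h2 : (1 : ℝ) ≤ k := by exact_mod_cast hk0
    have h3 := risingCoeff_pos hθ k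
    have h4 : 0 ≤ θ⁻¹ * (n * risingCoeff θ n) := by positivity
    nlinarith

lemma tilt_le (hθ : 0 < θ) {n m : ℕ} (hn : 1 ≤ n) (hm : m ≤ n) :
    tilt θ n m ≤ (2 + θ⁻¹) * n / ((n : ℝ) - m + 1) := by
  have h := succ_mul_risingCoeff_le hθ hn (Nat.sub_le n m)
  rw [Nat.cast_sub hm] at h
  have h1 : (m : ℝ) ≤ n := by exact_mod_cast hm
  rw [tilt, if_pos hm, div_le_div_iff₀ (risingCoeff_pos hθ n) (by linarith)]
  linarith

lemma tilt_le_mul (hθ : 0 < θ) {n : ℕ} (hn : 1 ≤ n) (m : ℕ) :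
    tilt θ n m ≤ (2 + θ⁻¹) * n := by
  have h0 : 0 ≤ (2 + θ⁻¹) * n := by positivity
  by_cases hm : m ≤ n
  · refine (tilt_le hθ hn hm).trans (div_le_self h0 ?_)
    have h1 : (m : ℝ) ≤ n := by exact_mod_cast hm
    linarith
  · rw [tilt, if_neg hm]; exact h0

lemma tilt_le_of_le (hθ : 0 < θ) {n : ℕ} (hn : 1 ≤ n) {m : ℕ} {γ : ℝ} (hγ : γ < 1)
    (hm : m ≤ γ * n) : tilt θ n m ≤ (2 + θ⁻¹) / (1 - γ) := by
  have hn' : (1 : ℝ) ≤ n := by exact_mod_cast hn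
  have hmn : (m : ℝ) ≤ n := by nlinarith
  refine (tilt_le hθ hn (by exact_mod_cast hmn)).trans ?_
  have hA : 0 < 2 + θ⁻¹ := by positivity
  rw [div_le_div_iff₀ (by linarith) (by linarith), mul_assoc]
  refine mul_le_mul_of_nonneg_left ?_ hA.le
  linarith

/-- Euler's limit formula for the Gamma function; the factor `k / (θ + k)` corrects for its one
extra term. -/
lemma tendsto_risingCoeff_mul_rpow (hθ : 0 < θ) :
    Tendsto (fun k : ℕ => risingCoeff θ k * (k : ℝ) ^ (1 - θ)) atTop (𝓝 (Real.Gamma θ)⁻¹) := by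
  have h1 := (Real.GammaSeq_tendsto_Gamma θ).inv₀ (Real.Gamma_pos_of_pos hθ).ne'
  have h2 : Tendsto (fun k : ℕ => (k : ℝ) / (θ + k)) atTop (𝓝 1) := by
    have := tendsto_natCast_div_add_atTop (𝕜 := ℝ) θ
    simpa only [add_comm] using this
  have h3 := h1.mul h2
  rw [mul_one] at h3
  refine h3.congr' ?_
  filter_upwards [eventually_ge_atTop 1] with k hk
  have hk' : (0 : ℝ) < k := by exact_mod_cast hk
  have hP : 0 < ∏ j ∈ Finset.range k, (θ + (j : ℝ)) := Finset.prod_pos fun j _ => by positivity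
  rw [Real.GammaSeq, risingCoeff, Finset.prod_range_succ, Real.rpow_sub hk', Real.rpow_one]
  have h4 : 0 < (k : ℝ) ^ θ := Real.rpow_pos_of_pos hk' θ
  have h5 : 0 < θ + (k : ℝ) := by positivity
  field_simp

lemma eventually_abs_tilt_sub_le (hθ : 0 < θ) {β : ℝ} (hβ : β < 1) {ε : ℝ} (hε : 0 < ε) :
    ∃ η > 0, ∀ᶠ n : ℕ in atTop, ∀ m : ℕ, |(m : ℝ) / n - β| < η →
      |tilt θ n m - (1 - β) ^ (θ - 1)| < ε := by
  -- A limit along pairs with `n → ∞` and `m/n → β` encodes uniformity in `m`; a basis of this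
  -- filter yields the threshold for `n` and the radius `η`.
  set F : Filter (ℕ × ℕ) := comap Prod.fst atTop ⊓ comap (fun p => (p.2 : ℝ) / p.1) (𝓝 β) with hF
  have hn : Tendsto (fun p : ℕ × ℕ => (p.1 : ℝ)) F atTop :=
    tendsto_natCast_atTop_atTop.comp (tendsto_comap.mono_left inf_le_left)
  have hn' : Tendsto (fun p : ℕ × ℕ => p.1) F atTop := tendsto_comap.mono_left inf_le_left
  have hr : Tendsto (fun p : ℕ × ℕ => (p.2 : ℝ) / p.1) F (𝓝 β) :=
    tendsto_comap.mono_left inf_le_right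
  have hgood : ∀ᶠ p : ℕ × ℕ in F, 1 ≤ p.1 ∧ p.2 < p.1 := by
    filter_upwards [hn'.eventually_ge_atTop 1, hr.eventually_lt_const hβ] with p h1 h2
    have h1' : (0 : ℝ) < p.1 := by exact_mod_cast h1
    rw [div_lt_one h1'] at h2
    exact ⟨h1, by exact_mod_cast h2⟩
  have hk : Tendsto (fun p : ℕ × ℕ => p.1 - p.2) F atTop := by
    rw [← tendsto_natCast_atTop_iff (R := ℝ)]
    refine (hn.atTop_mul_pos (sub_pos.2 hβ) (hr.const_sub 1)).congr' ?_
    filter_upwards [hgood] with p hp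
    have h1' : (p.1 : ℝ) ≠ 0 := by
      have : (0 : ℝ) < p.1 := by exact_mod_cast hp.1
      exact this.ne'
    rw [Nat.cast_sub hp.2.le]
    field_simp
  have hG := (inv_pos.2 (Real.Gamma_pos_of_pos hθ)).ne'
  have hlim : Tendsto (fun p : ℕ × ℕ => tilt θ p.1 p.2) F (𝓝 ((1 - β) ^ (θ - 1))) := by
    have h1 := ((tendsto_risingCoeff_mul_rpow hθ).comp hk).div
      ((tendsto_risingCoeff_mul_rpow hθ).comp hn') hG
    have h2 : Tendsto (fun p : ℕ × ℕ => (1 - (p.2 : ℝ) / p.1) ^ (θ - 1)) F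
        (𝓝 ((1 - β) ^ (θ - 1))) :=
      (hr.const_sub 1).rpow_const (Or.inl (sub_pos.2 hβ).ne')
    have h3 := h1.mul h2
    rw [div_self hG, one_mul] at h3
    refine h3.congr' ?_
    filter_upwards [hgood] with p hp
    have hp1 : (0 : ℝ) < p.1 := by exact_mod_cast hp.1
    have hp2 : (0 : ℝ) < (p.1 : ℝ) - p.2 := by
      rw [sub_pos]; exact_mod_cast hp.2
    have h4 : 1 - (p.2 : ℝ) / p.1 = ((p.1 : ℝ) - p.2) / p.1 := by field_simp
    simp only [Pi.div_apply, Function.comp_apply]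
    rw [tilt, if_pos hp.2.le, Nat.cast_sub hp.2.le, h4, Real.div_rpow hp2.le hp1.le,
      show (1 : ℝ) - θ = -(θ - 1) by ring, Real.rpow_neg hp2.le, Real.rpow_neg hp1.le]
    have h5 := Real.rpow_pos_of_pos hp2 (θ - 1)
    have h6 := Real.rpow_pos_of_pos hp1 (θ - 1)
    have h7 := risingCoeff_pos hθ p.1
    field_simp
  have hev := hlim.eventually (Metric.ball_mem_nhds _ hε)
  rw [hF, ((atTop_basis.comap Prod.fst).inf (Metric.nhds_basis_ball.comap _)).eventually_iff] at hev
  obtain ⟨⟨N, η⟩, ⟨-, hη⟩, h⟩ := hev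
  refine ⟨η, hη, ?_⟩
  filter_upwards [eventually_ge_atTop N] with n hnN m hm
  have := h (x := (n, m)) ⟨hnN, hm⟩
  exact this

end SpatialPartitions

end

/-! ### The limit theorem for abstract rates -/

noncomputable section

namespace SpatialPartitions

/-- Going through `lintegral` makes the bound available without separate integrability proofs for
`g`, `h₁`, `h₂`. -/
lemma integral_le_of_le_add {α : Type*} [MeasurableSpace α] {Q : Measure α}
    [IsProbabilityMeasure Q] {g h₁ h₂ : α → ℝ} {ε C₁ C₂ D₁ D₂ : ℝ} (hε : 0 ≤ ε) (hC₁ : 0 ≤ C₁)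
    (hC₂ : 0 ≤ C₂) (hD₁ : 0 ≤ D₁) (hD₂ : 0 ≤ D₂) (hg0 : ∀ x, 0 ≤ g x)
    (hg : Measurable g) (hm₁ : Measurable h₁) (hm₂ : Measurable h₂) (hh₁ : ∀ x, 0 ≤ h₁ x)
    (hh₂ : ∀ x, 0 ≤ h₂ x) (hle : ∀ x, g x ≤ ε + C₁ * h₁ x + C₂ * h₂ x)
    (hi₁ : ∫⁻ x, ENNReal.ofReal (h₁ x) ∂Q ≤ ENNReal.ofReal D₁)
    (hi₂ : ∫⁻ x, ENNReal.ofReal (h₂ x) ∂Q ≤ ENNReal.ofReal D₂) :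
    ∫ x, g x ∂Q ≤ ε + C₁ * D₁ + C₂ * D₂ := by
  rw [integral_eq_lintegral_of_nonneg_ae (ae_of_all _ hg0) hg.aestronglyMeasurable]
  refine ENNReal.toReal_le_of_le_ofReal (by positivity) ?_
  calc ∫⁻ x, ENNReal.ofReal (g x) ∂Q
      ≤ ∫⁻ x, (ENNReal.ofReal ε + ENNReal.ofReal C₁ * ENNReal.ofReal (h₁ x) +
          ENNReal.ofReal C₂ * ENNReal.ofReal (h₂ x)) ∂Q := by
        refine lintegral_mono fun x => ?_
        have h1 := mul_nonneg hC₁ (hh₁ x)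
        have h2 := mul_nonneg hC₂ (hh₂ x)
        rw [← ENNReal.ofReal_mul hC₁, ← ENNReal.ofReal_mul hC₂, ← ENNReal.ofReal_add hε h1,
          ← ENNReal.ofReal_add (add_nonneg hε h1) h2]
        exact ENNReal.ofReal_le_ofReal (hle x)
    _ = ENNReal.ofReal ε + ENNReal.ofReal C₁ * ∫⁻ x, ENNReal.ofReal (h₁ x) ∂Q +
          ENNReal.ofReal C₂ * ∫⁻ x, ENNReal.ofReal (h₂ x) ∂Q := by
        rw [lintegral_add_left (by fun_prop), lintegral_add_left (by fun_prop),
          lintegral_const_mul _ (by fun_prop), lintegral_const_mul _ (by fun_prop)]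
        simp
    _ ≤ ENNReal.ofReal ε + ENNReal.ofReal C₁ * ENNReal.ofReal D₁ +
          ENNReal.ofReal C₂ * ENNReal.ofReal D₂ := by gcongr
    _ = ENNReal.ofReal (ε + C₁ * D₁ + C₂ * D₂) := by
        rw [← ENNReal.ofReal_mul hC₁, ← ENNReal.ofReal_mul hC₂,
          ← ENNReal.ofReal_add hε (by positivity), ← ENNReal.ofReal_add (by positivity)
          (by positivity)]

lemma tendsto_zero_of_forall_le_add {g : ℕ → ℝ} (hg : ∀ᶠ n in atTop, 0 ≤ g n)
    (h : ∀ ε > 0, ∃ u : ℕ → ℝ, Tendsto u atTop (𝓝 0) ∧ ∀ᶠ n in atTop, g n ≤ ε + u n) :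
    Tendsto g atTop (𝓝 0) := by
  rw [Metric.tendsto_nhds]
  intro ε hε
  obtain ⟨u, hu, hgu⟩ := h (ε / 2) (half_pos hε)
  filter_upwards [hg, hgu, hu.eventually_lt_const (half_pos hε)] with n h1 h2 h3
  rw [Real.dist_eq, sub_zero, abs_of_nonneg h1]
  linarith

variable {d : ℕ} {Ω : Type*} [MeasurableSpace Ω] {P : Measure Ω} [IsProbabilityMeasure P]
  {θ : ℝ} {G : Site d → Ω → ℝ}

namespace IsGammaFamily

lemma lintegral_jointLaw_fst (hG : IsGammaFamily P θ G) (l : Site d → ℝ) {f : Ω → ℝ≥0∞}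
    (hf : Measurable f) : ∫⁻ q, f q.1 ∂hG.jointLaw l = ∫⁻ ω, f ω ∂P := by
  rw [hG.lintegral_jointLaw l (f := fun q => f q.1) (hf.comp measurable_fst)]
  simp

/-- Mean square distance between the centred count and a random series. -/
lemma lintegral_sq_count_sub_le (hG : IsGammaFamily P θ G) (hθ : 0 < θ) {l : Site d → ℝ}
    (hl : ∀ x, 0 ≤ l x) (hs : Summable l) (κ e : ℝ) {a : Site d → ℝ} {Y : Ω → ℝ}
    (hYm : Measurable Y)
    (hY : ∀ᵐ ω ∂P, Tendsto (fun k => ∑ x ∈ siteBox d k, a x * (θ - G x ω)) atTop (𝓝 (Y ω)))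
    (ha : Summable fun x => (κ * l x - a x) ^ 2) :
    ∫⁻ q, ENNReal.ofReal ((κ * (θ * ∑' x, l x - q.2) - Y q.1 - e) ^ 2) ∂hG.jointLaw l ≤
      ENNReal.ofReal (3 * (κ ^ 2 * (θ * ∑' x, l x) + θ * ∑' x, (κ * l x - a x) ^ 2 + e ^ 2)) := by
  have hm := hG.measurable_mixedRate l
  have hμ : 0 ≤ θ * ∑' x, l x := mul_nonneg hθ.le (tsum_nonneg hl)
  have hS : 0 ≤ θ * ∑' x, (κ * l x - a x) ^ 2 := mul_nonneg hθ.le (tsum_nonneg fun x => sq_nonneg _)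
  calc ∫⁻ q, ENNReal.ofReal ((κ * (θ * ∑' x, l x - q.2) - Y q.1 - e) ^ 2) ∂hG.jointLaw l
      ≤ ∫⁻ q, (ENNReal.ofReal (3 * κ ^ 2) *
            ENNReal.ofReal (((q.2 : ℝ) - mixedRate l G q.1) ^ 2) +
          ENNReal.ofReal 3 * ENNReal.ofReal
            ((κ * (θ * ∑' x, l x - mixedRate l G q.1) - Y q.1) ^ 2) +
          ENNReal.ofReal (3 * e ^ 2)) ∂hG.jointLaw l := by
        refine lintegral_mono fun q => ?_
        rw [← ENNReal.ofReal_mul (by positivity), ← ENNReal.ofReal_mul (by positivity),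
          ← ENNReal.ofReal_add (by positivity) (by positivity),
          ← ENNReal.ofReal_add (by positivity) (by positivity)]
        refine ENNReal.ofReal_le_ofReal ?_
        set A := κ * ((q.2 : ℝ) - mixedRate l G q.1) with hA
        set B := κ * (θ * ∑' x, l x - mixedRate l G q.1) - Y q.1 with hB
        have h1 : κ * (θ * ∑' x, l x - q.2) - Y q.1 - e = B - A - e := by rw [hA, hB]; ring
        have h2 : 3 * κ ^ 2 * ((q.2 : ℝ) - mixedRate l G q.1) ^ 2 = 3 * A ^ 2 := by rw [hA]; ring
        rw [h1, h2]
        -- `(B - A - e)² ≤ 3 (A² + B² + e²)`: Poisson noise, error of the intensity and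
        -- deterministic shift are separated.
        nlinarith [sq_nonneg (A + B), sq_nonneg (B + e), sq_nonneg (A - e)]
    _ = ENNReal.ofReal (3 * κ ^ 2) * ENNReal.ofReal (θ * ∑' x, l x) +
          ENNReal.ofReal 3 * ∫⁻ ω, ENNReal.ofReal
            ((κ * (θ * ∑' x, l x - mixedRate l G ω) - Y ω) ^ 2) ∂P +
          ENNReal.ofReal (3 * e ^ 2) := by
        rw [lintegral_add_left (by fun_prop), lintegral_add_left (by fun_prop),
          lintegral_const_mul _ (by fun_prop), lintegral_const_mul _ (by fun_prop),
          hG.lintegral_jointLaw_sq hθ hl hs, hG.lintegral_jointLaw_fst l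
          (f := fun ω => ENNReal.ofReal ((κ * (θ * ∑' x, l x - mixedRate l G ω) - Y ω) ^ 2))
          (by fun_prop)]
        simp
    _ ≤ ENNReal.ofReal (3 * κ ^ 2) * ENNReal.ofReal (θ * ∑' x, l x) +
          ENNReal.ofReal 3 * ENNReal.ofReal (θ * ∑' x, (κ * l x - a x) ^ 2) +
          ENNReal.ofReal (3 * e ^ 2) := by
        gcongr
        exact hG.lintegral_sq_mixedRate_sub_le hθ hl hs κ hY ha
    _ = _ := by
        rw [← ENNReal.ofReal_mul (by positivity), ← ENNReal.ofReal_mul (by positivity),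
          ← ENNReal.ofReal_add (by positivity) (by positivity),
          ← ENNReal.ofReal_add (by positivity) (by positivity)]
        congr 1
        ring

/-- Exponential tail bound for the count. -/
lemma lintegral_tail_le (hG : IsGammaFamily P θ G) (hθ : 0 < θ) {l : Site d → ℝ}
    (hl : ∀ x, 0 ≤ l x) (hs : Summable l) (hs2 : Summable fun x => l x ^ 2) {t : ℝ} (ht : 0 ≤ t)
    (htl : ∀ x, t * l x ≤ 1 / 2) {y : ℝ} (hy : 0 ≤ y) :
    ∫⁻ q, ENNReal.ofReal (if y ≤ (q.2 : ℝ) then 1 else 0) ∂hG.jointLaw l ≤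
      ENNReal.ofReal (Real.exp (t * (θ * ∑' x, l x) + 2 * θ * (t ^ 2 * ∑' x, l x ^ 2) -
        t * y + t ^ 2 * y)) := by
  -- Markov's inequality for `(1 + t)^m`, with the simpler exponent coming from `log (1 + t) ≥ t -
  -- t²`.
  have hpt : ∀ m : ℕ, ENNReal.ofReal (if y ≤ (m : ℝ) then 1 else 0) ≤
      ENNReal.ofReal (Real.exp (-(t * y) + t ^ 2 * y)) * ENNReal.ofReal ((1 + t) ^ m) := by
    intro m
    rw [← ENNReal.ofReal_mul (Real.exp_pos _).le]
    refine ENNReal.ofReal_le_ofReal ?_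
    split_ifs with h
    · have h1 : t - t ^ 2 ≤ Real.log (1 + t) := by
        have := Real.one_sub_inv_le_log_of_pos (show 0 < 1 + t by linarith)
        have h2 : (1 + t)⁻¹ ≤ 1 - t + t ^ 2 := by
          rw [inv_le_iff_one_le_mul₀ (by linarith)]
          nlinarith [pow_nonneg ht 3]
        linarith
      have h3 : (1 + t) ^ m = Real.exp (m * Real.log (1 + t)) := by
        rw [Real.exp_nat_mul, Real.exp_log (by linarith)]
      rw [h3, ← Real.exp_add]
      refine Real.one_le_exp ?_
      have h4 : 0 ≤ Real.log (1 + t) := Real.log_nonneg (by linarith)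
      nlinarith
    · positivity
  calc ∫⁻ q, ENNReal.ofReal (if y ≤ (q.2 : ℝ) then 1 else 0) ∂hG.jointLaw l
      ≤ ∫⁻ q, ENNReal.ofReal (Real.exp (-(t * y) + t ^ 2 * y)) *
          ENNReal.ofReal ((1 + t) ^ q.2) ∂hG.jointLaw l := lintegral_mono fun q => hpt q.2
    _ ≤ ENNReal.ofReal (Real.exp (-(t * y) + t ^ 2 * y)) *
          ENNReal.ofReal (Real.exp (θ * (t * ∑' x, l x + 2 * t ^ 2 * ∑' x, l x ^ 2))) := by
        rw [lintegral_const_mul _ (by fun_prop)]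
        gcongr
        exact hG.lintegral_jointLaw_pow_le hθ hl hs hs2 ht htl
    _ = _ := by
        rw [← ENNReal.ofReal_mul (Real.exp_pos _).le, ← Real.exp_add]
        congr 2
        ring

end IsGammaFamily

/-- Asymptotic conditions on a sequence of rates under which the canonical fluctuations converge. -/
structure RatesConverge (θ β : ℝ) (a : Site d → ℝ) (l : ℕ → Site d → ℝ) (κ t : ℕ → ℝ) : Prop where
  nonneg : ∀ᶠ n in atTop, ∀ x, 0 ≤ l n x
  summable : ∀ᶠ n in atTop, Summable (l n)
  summable_sq : ∀ᶠ n in atTop, Summable fun x => l n x ^ 2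
  summable_sub : ∀ᶠ n in atTop, Summable fun x => (κ n * l n x - a x) ^ 2
  tendsto_sub : Tendsto (fun n => ∑' x, (κ n * l n x - a x) ^ 2) atTop (𝓝 0)
  tendsto_mean : Tendsto (fun n : ℕ => (θ * ∑' x, l n x) / n) atTop (𝓝 β)
  tendsto_scale : Tendsto (fun n : ℕ => κ n ^ 2 * n) atTop (𝓝 0)
  t_nonneg : ∀ᶠ n in atTop, 0 ≤ t n
  t_mul_le : ∀ᶠ n in atTop, ∀ x, t n * l n x ≤ 1 / 2
  t_sq_le : ∃ B, ∀ᶠ n in atTop, t n ^ 2 * ∑' x, l n x ^ 2 ≤ B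
  t_sq_mul : Tendsto (fun n : ℕ => t n ^ 2 * n) atTop (𝓝 0)
  t_mul_atTop : Tendsto (fun n : ℕ => t n * n) atTop atTop
  tendsto_exp : ∀ ε > 0, Tendsto (fun n : ℕ => n * Real.exp (-(ε * (t n * n)))) atTop (𝓝 0)

namespace RatesConverge

variable {β : ℝ} {a : Site d → ℝ} {l : ℕ → Site d → ℝ} {κ t : ℕ → ℝ}

/-- Mean square convergence of the rescaled centred count to `Y`, read through a Lipschitz function.
Only the scale `κ` matters here; the parameter `t` serves the exponential bound for the tilt. -/
lemma tendsto_integral_sub (h : RatesConverge θ β a l κ t) (hG : IsGammaFamily P θ G)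
    (hθ : 0 < θ) {Y : Ω → ℝ} (hYm : Measurable Y)
    (hY : ∀ᵐ ω ∂P, Tendsto (fun k => ∑ x ∈ siteBox d k, a x * (θ - G x ω)) atTop (𝓝 (Y ω)))
    {f : ℝ → ℝ} {K : ℝ≥0} (hf : LipschitzWith K f) :
    Tendsto (fun n => ∫ q, |f (κ n * (θ * ∑' x, l n x - q.2)) - f (Y q.1)| ∂hG.jointLaw (l n))
      atTop (𝓝 0) := by
  have hfm : Measurable f := hf.continuous.measurable
  refine tendsto_zero_of_forall_le_add
    (Eventually.of_forall fun n => integral_nonneg fun q => abs_nonneg _) fun ε hε => ?_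
  set D : ℕ → ℝ := fun n => 3 * (κ n ^ 2 * (θ * ∑' x, l n x) +
    θ * ∑' x, (κ n * l n x - a x) ^ 2 + 0 ^ 2) with hD
  have hDlim : Tendsto D atTop (𝓝 0) := by
    have h1 : Tendsto (fun n => κ n ^ 2 * (θ * ∑' x, l n x)) atTop (𝓝 0) := by
      have := h.tendsto_scale.mul h.tendsto_mean
      rw [zero_mul] at this
      refine this.congr' ?_
      filter_upwards [eventually_ge_atTop 1] with n hn
      have hn' : (n : ℝ) ≠ 0 := by positivity
      field_simp
    have := ((h1.add (h.tendsto_sub.const_mul θ)).add_const (0 ^ 2)).const_mul 3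
    simpa [hD] using this
  refine ⟨fun n => K ^ 2 / (4 * ε) * D n + 0 * 0,
    by simpa using hDlim.const_mul (K ^ 2 / (4 * ε)), ?_⟩
  filter_upwards [h.nonneg, h.summable, h.summable_sub] with n h1 h2 h3
  have hD0 : 0 ≤ D n := by
    have h4 : 0 ≤ ∑' x, l n x := tsum_nonneg h1
    have h5 : 0 ≤ ∑' x, (κ n * l n x - a x) ^ 2 := tsum_nonneg fun x => sq_nonneg _
    simp only [hD]
    positivity
  rw [← add_assoc]
  refine integral_le_of_le_add (h₁ := fun q : Ω × ℕ =>
      (κ n * (θ * ∑' x, l n x - q.2) - Y q.1 - 0) ^ 2) (h₂ := fun _ => 0) hε.le (by positivity)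
    le_rfl hD0 le_rfl (fun q => abs_nonneg _) (by fun_prop) (by fun_prop) measurable_const
    (fun q => sq_nonneg _) (fun _ => le_rfl) (fun q => ?_)
    (hG.lintegral_sq_count_sub_le hθ h1 h2 (κ n) 0 hYm hY h3) (by simp)
  have hL := hf.dist_le_mul (κ n * (θ * ∑' x, l n x - q.2)) (Y q.1)
  rw [Real.dist_eq, Real.dist_eq] at hL
  set u := |κ n * (θ * ∑' x, l n x - q.2) - Y q.1| with hu
  have h6 : (κ n * (θ * ∑' x, l n x - q.2) - Y q.1 - 0) ^ 2 = u ^ 2 := by rw [hu, sq_abs, sub_zero]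
  rw [h6]
  -- Young's inequality replaces the first moment by the second, at the price of an arbitrary `ε`.
  have h7 : K * u ≤ ε + K ^ 2 / (4 * ε) * u ^ 2 := by
    have : ε + K ^ 2 / (4 * ε) * u ^ 2 - K * u = (2 * ε - K * u) ^ 2 / (4 * ε) := by
      field_simp; ring
    have h8 : 0 ≤ (2 * ε - K * u) ^ 2 / (4 * ε) := by positivity
    linarith
  linarith

/-- Three regions: for `M/n` within `η` of `β` the tilt is `ε`-close to its limit; away from `β` but
with `M < γ n` it is bounded, and Chebyshev applies; for `M ≥ γ n` it is at most of order `n`, and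
the exponential tail applies. -/
lemma tendsto_integral_tilt_sub (h : RatesConverge θ β a l κ t) (hG : IsGammaFamily P θ G)
    (hθ : 0 < θ) (hβ0 : 0 ≤ β) (hβ : β < 1) :
    Tendsto (fun n => ∫ q, |tilt θ n q.2 - (1 - β) ^ (θ - 1)| ∂hG.jointLaw (l n))
      atTop (𝓝 0) := by
  set w := (1 - β) ^ (θ - 1) with hw
  have hw0 : 0 ≤ w := Real.rpow_nonneg (by linarith) _
  set A := 2 + θ⁻¹ with hA
  have hA0 : 0 < A := by positivity
  -- Any point strictly between `β` and `1` would do: beyond `β` for the tail bound, below `1` for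
  -- boundedness of the tilt.
  set γ := (1 + β) / 2 with hγ
  have hγ1 : γ < 1 := by rw [hγ]; linarith
  have hγ0 : 0 ≤ γ := by rw [hγ]; linarith
  set K₁ := A / (1 - γ) + w with hK₁
  have hK₁0 : 0 ≤ K₁ := add_nonneg (div_nonneg hA0.le (by linarith)) hw0
  refine tendsto_zero_of_forall_le_add
    (Eventually.of_forall fun n => integral_nonneg fun q => abs_nonneg _) fun ε hε => ?_
  obtain ⟨η, hη, hev⟩ := eventually_abs_tilt_sub_le hθ hβ hε
  obtain ⟨B, hB⟩ := h.t_sq_le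
  set D₁ : ℕ → ℝ := fun n => 3 * (((n : ℝ)⁻¹) ^ 2 * (θ * ∑' x, l n x) +
    θ * ∑' x, ((n : ℝ)⁻¹ * l n x - 0) ^ 2 + ((θ * ∑' x, l n x) / n - β) ^ 2) with hD₁
  set D₂ : ℕ → ℝ := fun n => Real.exp (t n * (θ * ∑' x, l n x) +
    2 * θ * (t n ^ 2 * ∑' x, l n x ^ 2) - t n * (γ * n) + t n ^ 2 * (γ * n)) with hD₂
  have hD₁lim : Tendsto D₁ atTop (𝓝 0) := by
    have h1 : Tendsto (fun n : ℕ => ((n : ℝ)⁻¹) ^ 2 * (θ * ∑' x, l n x)) atTop (𝓝 0) := by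
      have := (tendsto_inv_atTop_nhds_zero_nat (𝕜 := ℝ)).mul h.tendsto_mean
      rw [zero_mul] at this
      refine this.congr fun n => ?_
      ring
    have h2 : Tendsto (fun n : ℕ => ∑' x, ((n : ℝ)⁻¹ * l n x - 0) ^ 2) atTop (𝓝 0) := by
      have h3 : Tendsto (fun n : ℕ => B * ((t n * n)⁻¹) ^ 2) atTop (𝓝 0) := by
        simpa using ((tendsto_inv_atTop_zero.comp h.t_mul_atTop).pow 2).const_mul B
      refine squeeze_zero' (Eventually.of_forall fun n => tsum_nonneg fun x => sq_nonneg _) ?_ h3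
      filter_upwards [hB, h.t_mul_atTop.eventually_gt_atTop 0] with n hn hpos
      have hn0 : (n : ℝ) ≠ 0 := fun h0 => by simp [h0] at hpos
      have ht0 : t n ≠ 0 := fun h0 => by simp [h0] at hpos
      have h4 : ∑' x, ((n : ℝ)⁻¹ * l n x - 0) ^ 2 = ((n : ℝ)⁻¹) ^ 2 * ∑' x, l n x ^ 2 := by
        rw [← tsum_mul_left]
        exact tsum_congr fun x => by ring
      rw [h4]
      -- The bound on `t² ∑ l²` and `t n → ∞` together give `∑ l² = o(n²)`, with no further
      -- hypothesis.
      have h5 : ((n : ℝ)⁻¹) ^ 2 * ∑' x, l n x ^ 2 =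
          (t n ^ 2 * ∑' x, l n x ^ 2) * ((t n * n)⁻¹) ^ 2 := by
        field_simp
      rw [h5]
      exact mul_le_mul_of_nonneg_right hn (sq_nonneg _)
    have h3 : Tendsto (fun n : ℕ => ((θ * ∑' x, l n x) / n - β) ^ 2) atTop (𝓝 0) := by
      simpa using (h.tendsto_mean.sub_const β).pow 2
    simpa [hD₁] using ((h1.add (h2.const_mul θ)).add h3).const_mul 3
  have hD₂lim : Tendsto (fun n : ℕ => (n : ℝ) * D₂ n) atTop (𝓝 0) := by
    set ε' := (γ - β) / 2 with hε'
    have hε'0 : 0 < ε' := by rw [hε', hγ]; linarith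
    -- In the exponent, `2 θ B` bounds the quadratic term and `1` bounds `t² γ n`; half of the gap
    -- `γ - β` is left as the decay rate in `t n`.
    have h1 := (h.tendsto_exp ε' hε'0).const_mul (Real.exp (2 * θ * B + 1))
    rw [mul_zero] at h1
    refine squeeze_zero' (Eventually.of_forall fun n => by positivity) ?_ h1
    filter_upwards [hB, h.tendsto_mean.eventually_lt_const (show β < β + ε' by linarith),
      h.t_sq_mul.eventually_lt_const one_pos, h.t_nonneg,
      eventually_ge_atTop 1] with n h2 h3 h4 h5 h6
    have h6' : (0 : ℝ) < n := by exact_mod_cast h6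
    rw [mul_left_comm, ← Real.exp_add]
    refine mul_le_mul_of_nonneg_left (Real.exp_le_exp.2 ?_) h6'.le
    rw [div_lt_iff₀ h6'] at h3
    have h7 : t n * (θ * ∑' x, l n x) ≤ t n * ((β + ε') * n) := mul_le_mul_of_nonneg_left h3.le h5
    have h8 : 2 * θ * (t n ^ 2 * ∑' x, l n x ^ 2) ≤ 2 * θ * B :=
      mul_le_mul_of_nonneg_left h2 (by positivity)
    have h9 : t n ^ 2 * (γ * n) ≤ 1 := by
      have : t n ^ 2 * (γ * n) = γ * (t n ^ 2 * n) := by ring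
      rw [this]
      have h10 : 0 ≤ t n ^ 2 * n := by positivity
      nlinarith
    have h11 : t n * ((β + ε') * n) - t n * (γ * n) = -(ε' * (t n * n)) := by rw [hε']; ring
    linarith
  refine ⟨fun n => K₁ * (η ^ 2)⁻¹ * D₁ n + A * n * D₂ n, ?_, ?_⟩
  · have := (hD₁lim.const_mul (K₁ * (η ^ 2)⁻¹)).add (hD₂lim.const_mul A)
    simpa only [mul_zero, add_zero, mul_assoc] using this
  filter_upwards [h.nonneg, h.summable, h.summable_sq, h.t_nonneg, h.t_mul_le, hev,
    eventually_ge_atTop 1] with n h1 h2 h3 h4 h5 h6 h7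
  have h7' : (0 : ℝ) < n := by exact_mod_cast h7
  have hmt : Measurable fun q : Ω × ℕ => tilt θ n q.2 :=
    (measurable_from_nat (f := tilt θ n)).comp measurable_snd
  have hD₁0 : 0 ≤ D₁ n := by
    have h8 : 0 ≤ ∑' x, l n x := tsum_nonneg h1
    have h9 : 0 ≤ ∑' x, ((n : ℝ)⁻¹ * l n x - 0) ^ 2 := tsum_nonneg fun x => sq_nonneg _
    simp only [hD₁]
    positivity
  have hsum0 : Summable fun x => ((n : ℝ)⁻¹ * l n x - 0) ^ 2 := by
    refine (h3.mul_left (((n : ℝ)⁻¹) ^ 2)).congr fun x => ?_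
    ring
  -- The same mean square bound with scale `1/n` and zero limit series is a law of large numbers;
  -- the shift recentres at `β` instead of the exact mean.
  have hI₁ := hG.lintegral_sq_count_sub_le hθ h1 h2 ((n : ℝ)⁻¹) ((θ * ∑' x, l n x) / n - β)
    (a := fun _ => 0) (Y := fun _ => 0) measurable_const (by simp) hsum0
  have hI₂ := hG.lintegral_tail_le hθ h1 h2 h3 h4 h5 (y := γ * n) (by positivity)
  have hite : Measurable fun q : Ω × ℕ => if γ * n ≤ (q.2 : ℝ) then (1 : ℝ) else 0 :=
    (measurable_from_nat (f := fun m : ℕ => if γ * n ≤ (m : ℝ) then (1 : ℝ) else 0)).comp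
      measurable_snd
  rw [← add_assoc]
  refine integral_le_of_le_add hε.le (by positivity) (by positivity) hD₁0 (Real.exp_pos _).le
    (fun q => abs_nonneg _) (by fun_prop) (by fun_prop) hite (fun q => sq_nonneg _)
    (fun q => by split_ifs <;> norm_num) (fun q => ?_) hI₁ hI₂
  have h8 : (n : ℝ)⁻¹ * (θ * ∑' x, l n x - q.2) - 0 - ((θ * ∑' x, l n x) / n - β) =
      -((q.2 : ℝ) / n - β) := by ring
  rw [h8, neg_sq]
  have h9 : 0 ≤ K₁ * (η ^ 2)⁻¹ * ((q.2 : ℝ) / n - β) ^ 2 := by positivity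
  have htn := tilt_nonneg hθ n q.2
  by_cases hclose : |(q.2 : ℝ) / n - β| < η
  · have h10 := (h6 q.2 hclose).le
    have h11 : 0 ≤ A * n * (if γ * n ≤ (q.2 : ℝ) then 1 else 0) := by positivity
    linarith
  · have h10 : K₁ ≤ K₁ * (η ^ 2)⁻¹ * ((q.2 : ℝ) / n - β) ^ 2 := by
      rw [mul_assoc]
      refine le_mul_of_one_le_right hK₁0 ?_
      rw [← sq_abs ((q.2 : ℝ) / n - β), ← inv_pow, ← mul_pow]
      refine one_le_pow₀ ?_
      rw [← inv_mul_cancel₀ hη.ne']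
      exact mul_le_mul_of_nonneg_left (not_lt.1 hclose) (inv_pos.2 hη).le
    by_cases hlarge : γ * n ≤ (q.2 : ℝ)
    · rw [if_pos hlarge, mul_one, abs_sub_le_iff]
      have h11 := tilt_le_mul hθ h7 q.2
      have h12 : w ≤ K₁ := by
        rw [hK₁]
        have : 0 ≤ A / (1 - γ) := div_nonneg hA0.le (by linarith)
        linarith
      have h13 : 0 ≤ A * n := by positivity
      constructor <;> linarith
    · rw [if_neg hlarge, mul_zero, abs_sub_le_iff]
      have h11 := tilt_le_of_le hθ h7 hγ1 (not_le.1 hlarge).le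
      have h12 : 0 ≤ A / (1 - γ) := div_nonneg hA0.le (by linarith)
      rw [hK₁] at h10
      rw [← hA] at h11
      constructor <;> linarith

/-- Convergence of tilted expectations of bounded Lipschitz functions. -/
lemma tendsto_tilted_integral (h : RatesConverge θ β a l κ t) (hG : IsGammaFamily P θ G)
    (hθ : 0 < θ) (hβ0 : 0 ≤ β) (hβ : β < 1) {Y : Ω → ℝ} (hYm : Measurable Y)
    (hY : ∀ᵐ ω ∂P, Tendsto (fun k => ∑ x ∈ siteBox d k, a x * (θ - G x ω)) atTop (𝓝 (Y ω)))
    {f : ℝ → ℝ} {K : ℝ≥0} (hf : LipschitzWith K f) {C : ℝ} (hC : ∀ x y, |f x - f y| ≤ C) :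
    Tendsto (fun n => (∫ q, tilt θ n q.2 * f (κ n * (θ * ∑' x, l n x - q.2)) ∂hG.jointLaw (l n)) /
      ∫ q, tilt θ n q.2 ∂hG.jointLaw (l n)) atTop (𝓝 (∫ ω, f (Y ω) ∂P)) := by
  set w := (1 - β) ^ (θ - 1) with hw
  have hw0 : 0 < w := Real.rpow_pos_of_pos (by linarith) _
  have hfm : Measurable f := hf.continuous.measurable
  have hC0 : 0 ≤ C := (abs_nonneg _).trans (hC 0 0)
  have hA := h.tendsto_integral_sub hG hθ hYm hY hf
  have hB := h.tendsto_integral_tilt_sub hG hθ hβ0 hβ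
  rw [← hw] at hB
  have hfb : ∀ x, |f x| ≤ |f 0| + C := fun x => by
    have h1 := hC x 0
    have h2 := abs_sub_abs_le_abs_sub (f x) (f 0)
    linarith
  have hmt : ∀ n, Measurable fun q : Ω × ℕ => tilt θ n q.2 := fun n =>
    (measurable_from_nat (f := tilt θ n)).comp measurable_snd
  have hti : ∀ n, Integrable (fun q : Ω × ℕ => tilt θ n q.2) (hG.jointLaw (l n)) := fun n => by
    have := integrable_tilt_mul hG hθ (l n) n (g := fun _ => 1) measurable_const (K := 1) (by simp)
    simpa using this
  have hmean : Tendsto (fun n => ∫ q, tilt θ n q.2 ∂hG.jointLaw (l n)) atTop (𝓝 w) := by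
    rw [tendsto_iff_norm_sub_tendsto_zero]
    refine squeeze_zero (fun n => norm_nonneg _) (fun n => ?_) hB
    have : ∫ q, tilt θ n q.2 ∂hG.jointLaw (l n) - w =
        ∫ q, (tilt θ n q.2 - w) ∂hG.jointLaw (l n) := by
      rw [integral_sub (hti n) (integrable_const _)]
      simp
    rw [this]
    exact norm_integral_le_integral_norm _
  have hfY : ∀ n, ∫ q : Ω × ℕ, f (Y q.1) ∂hG.jointLaw (l n) = ∫ ω, f (Y ω) ∂P := by
    intro n
    have h1 : (hG.jointLaw (l n)).map Prod.fst = P := Measure.fst_compProd _ _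
    calc ∫ q : Ω × ℕ, f (Y q.1) ∂hG.jointLaw (l n)
        = ∫ ω, f (Y ω) ∂(hG.jointLaw (l n)).map Prod.fst :=
          (integral_map measurable_fst.aemeasurable
            (hfm.comp hYm).aestronglyMeasurable).symm
      _ = _ := by rw [h1]
  set c₀ := ∫ ω, f (Y ω) ∂P with hc₀
  have hnum : Tendsto (fun n => ∫ q, tilt θ n q.2 * f (κ n * (θ * ∑' x, l n x - q.2))
      ∂hG.jointLaw (l n)) atTop (𝓝 (w * c₀)) := by
    rw [tendsto_iff_norm_sub_tendsto_zero]
    have hlim : Tendsto (fun n => w * (∫ q, |f (κ n * (θ * ∑' x, l n x - q.2)) - f (Y q.1)|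
        ∂hG.jointLaw (l n)) + (|f 0| + C) * ∫ q, |tilt θ n q.2 - w| ∂hG.jointLaw (l n))
        atTop (𝓝 0) := by
      simpa using (hA.const_mul w).add (hB.const_mul (|f 0| + C))
    refine squeeze_zero (fun n => norm_nonneg _) (fun n => ?_) hlim
    set X : Ω × ℕ → ℝ := fun q => κ n * (θ * ∑' x, l n x - q.2) with hX
    have hXm : Measurable X := by fun_prop
    have hi1 : Integrable (fun q => tilt θ n q.2 * f (X q)) (hG.jointLaw (l n)) :=
      integrable_tilt_mul hG hθ (l n) n (hfm.comp hXm) fun q => hfb _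
    have hi2 : Integrable (fun q : Ω × ℕ => f (Y q.1)) (hG.jointLaw (l n)) :=
      Integrable.of_bound (hfm.comp (hYm.comp measurable_fst)).aestronglyMeasurable (|f 0| + C)
        (ae_of_all _ fun q => hfb _)
    have hi3 : Integrable (fun q : Ω × ℕ => |f (X q) - f (Y q.1)|) (hG.jointLaw (l n)) :=
      Integrable.of_bound (by fun_prop) C (ae_of_all _ fun q => by
        rw [Real.norm_eq_abs, abs_abs]; exact hC _ _)
    have hi4 : Integrable (fun q : Ω × ℕ => |tilt θ n q.2 - w|) (hG.jointLaw (l n)) :=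
      ((hti n).sub (integrable_const w)).abs
    have heq : ∫ q, tilt θ n q.2 * f (X q) ∂hG.jointLaw (l n) - w * c₀ =
        ∫ q, (tilt θ n q.2 * f (X q) - w * f (Y q.1)) ∂hG.jointLaw (l n) := by
      rw [integral_sub hi1 (hi2.const_mul w), integral_const_mul, hfY]
    rw [heq, ← integral_const_mul, ← integral_const_mul,
      ← integral_add (hi3.const_mul w) (hi4.const_mul _)]
    refine norm_integral_le_of_norm_le ((hi3.const_mul w).add (hi4.const_mul _))
      (ae_of_all _ fun q => ?_)
    -- The error splits into one part controlled by convergence of the count and one by convergence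
    -- of the tilt, the latter using boundedness of `f`.
    have h1 : tilt θ n q.2 * f (X q) - w * f (Y q.1) =
        w * (f (X q) - f (Y q.1)) + f (X q) * (tilt θ n q.2 - w) := by ring
    rw [Real.norm_eq_abs, h1]
    refine (abs_add_le _ _).trans ?_
    rw [abs_mul, abs_mul, abs_of_pos hw0]
    gcongr
    exact hfb _
  have := hnum.div hmean hw0.ne'
  rwa [mul_div_cancel_left₀ _ hw0.ne'] at this

end RatesConverge

end SpatialPartitions

end

/-! ### Rates of the power-law trap -/

noncomputable section

namespace SpatialPartitions

variable {d : ℕ}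

/-! ### Lattice sums of the trap -/

lemma norm_rescale {L : ℝ} (hL : 0 ≤ L) (x : Site d) : ‖rescale L x‖ = siteNorm x / L := by
  have h : rescale L x = L⁻¹ • (WithLp.toLp 2 (fun i => (x i : ℝ)) : EuclideanSpace ℝ (Fin d)) := by
    ext i
    simp [rescale, div_eq_inv_mul]
  rw [h, norm_smul, norm_inv, Real.norm_of_nonneg hL, siteNorm, div_eq_inv_mul]

lemma siteNorm_zero : siteNorm (0 : Site d) = 0 := by
  have h : (WithLp.toLp 2 (fun i => ((0 : Site d) i : ℝ)) : EuclideanSpace ℝ (Fin d)) = 0 := by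
    ext i
    simp
  rw [siteNorm, h, norm_zero]

lemma siteNorm_nonneg (x : Site d) : 0 ≤ siteNorm x := norm_nonneg _

lemma one_le_siteNorm {x : Site d} (hx : x ≠ 0) : 1 ≤ siteNorm x := by
  obtain ⟨i, hi⟩ := Function.ne_iff.1 hx
  have h1 : (1 : ℝ) ≤ |(x i : ℝ)| := by
    rw [← Int.cast_abs]
    exact_mod_cast Int.one_le_abs hi
  have h2 := PiLp.norm_apply_le
    (WithLp.toLp 2 (fun i => (x i : ℝ)) : EuclideanSpace ℝ (Fin d)) i
  exact h1.trans (by simpa [siteNorm] using h2)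

lemma siteNorm_pos {x : Site d} (hx : x ≠ 0) : 0 < siteNorm x :=
  zero_lt_one.trans_le (one_le_siteNorm hx)

/-- Sites embed injectively in the `ℤ`-span of the standard basis, a lattice of rank `d`, where the
norm series is known to converge. -/
lemma summable_siteNorm_rpow {r : ℝ} (hr : r < -(d : ℝ)) :
    Summable fun x : Site d => siteNorm x ^ r := by
  set b := (EuclideanSpace.basisFun (Fin d) ℝ).toBasis with hb
  have hrank : Module.finrank ℤ (Submodule.span ℤ (Set.range b)) = d := by
    rw [ZLattice.rank ℝ]
    simp
  have h := ZLattice.summable_norm_rpow (Submodule.span ℤ (Set.range b)) r (by rwa [hrank])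
  have hmem : ∀ x : Site d, (WithLp.toLp 2 (fun i => (x i : ℝ)) : EuclideanSpace ℝ (Fin d)) ∈
      Submodule.span ℤ (Set.range b) := by
    intro x
    have : (WithLp.toLp 2 (fun i => (x i : ℝ)) : EuclideanSpace ℝ (Fin d)) = ∑ i, x i • b i := by
      ext j
      simp [hb, Finset.sum_apply, EuclideanSpace.basisFun_apply, Pi.single_apply]
    rw [this]
    exact Submodule.sum_mem _ fun i _ =>
      Submodule.smul_mem _ _ (Submodule.subset_span (Set.mem_range_self i))
  set f : Site d → Submodule.span ℤ (Set.range b) := fun x => ⟨_, hmem x⟩ with hf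
  have hval : ∀ x, (f x : EuclideanSpace ℝ (Fin d)) = WithLp.toLp 2 (fun i => (x i : ℝ)) :=
    fun x => rfl
  have hinj : Function.Injective f := by
    intro x y hxy
    ext i
    have h1 : (f x : EuclideanSpace ℝ (Fin d)) i = (f y : EuclideanSpace ℝ (Fin d)) i := by rw [hxy]
    rw [hval, hval] at h1
    exact Int.cast_injective (α := ℝ) h1
  refine (h.comp_injective hinj).congr fun x => ?_
  rw [Function.comp_apply, Submodule.coe_norm, hval, siteNorm]

/-- The limit `c⁻¹ ‖x‖^{-δ}` of the rescaled Bose factors. -/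
def siteCoeff (c δ : ℝ) (x : Site d) : ℝ := c⁻¹ * (siteNorm x ^ δ)⁻¹

section

variable {c δ L : ℝ}

lemma siteCoeff_nonneg (hc : 0 < c) (x : Site d) : 0 ≤ siteCoeff c δ x :=
  mul_nonneg (inv_nonneg.2 hc.le) (inv_nonneg.2 (Real.rpow_nonneg (siteNorm_nonneg x) δ))

/-- The conventions `0 ^ δ = 0` and `0⁻¹ = 0` let all series run over every site, the origin
contributing nothing. -/
lemma siteCoeff_zero (hδ : 0 < δ) : siteCoeff c δ (0 : Site d) = 0 := by
  simp [siteCoeff, siteNorm_zero, Real.zero_rpow hδ.ne']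

lemma siteCoeff_pos (hc : 0 < c) {x : Site d} (hx : x ≠ 0) : 0 < siteCoeff c δ x :=
  mul_pos (inv_pos.2 hc) (inv_pos.2 (Real.rpow_pos_of_pos (siteNorm_pos hx) δ))

lemma siteCoeff_le (hc : 0 < c) (hδ : 0 < δ) (x : Site d) : siteCoeff c δ x ≤ c⁻¹ := by
  by_cases hx : x = 0
  · rw [hx, siteCoeff_zero hδ]
    exact inv_nonneg.2 hc.le
  · exact mul_le_of_le_one_right (inv_nonneg.2 hc.le)
      (inv_le_one_of_one_le₀ (Real.one_le_rpow (one_le_siteNorm hx) hδ.le))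

lemma summable_siteCoeff_sq (hδ : (d : ℝ) / 2 < δ) :
    Summable fun x : Site d => siteCoeff c δ x ^ 2 := by
  have h := (summable_siteNorm_rpow (d := d) (r := -(2 * δ)) (by linarith)).mul_left (c⁻¹ ^ 2)
  refine h.congr fun x => ?_
  rw [siteCoeff, mul_pow, Real.rpow_neg (siteNorm_nonneg x), mul_comm 2 δ,
    Real.rpow_mul (siteNorm_nonneg x), Real.rpow_two, ← inv_pow (siteNorm x ^ δ)]

lemma trap_rescale (hL : 0 < L) (x : Site d) :
    trap d c δ (rescale L x) = (L ^ δ * siteCoeff c δ x)⁻¹ := by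
  rw [trap, norm_rescale hL.le, Real.div_rpow (siteNorm_nonneg x) hL.le, siteCoeff]
  simp only [mul_inv, inv_inv]
  ring

lemma trap_rescale_zero (hδ : 0 < δ) (L : ℝ) : trap d c δ (rescale L (0 : Site d)) = 0 := by
  have h : rescale L (0 : Site d) = 0 := by
    ext i
    simp [rescale]
  rw [h, trap, norm_zero, Real.zero_rpow hδ.ne', mul_zero]

lemma trap_rescale_pos (hc : 0 < c) (hL : 0 < L) {x : Site d} (hx : x ≠ 0) :
    0 < trap d c δ (rescale L x) := by
  rw [trap_rescale hL]
  exact inv_pos.2 (mul_pos (Real.rpow_pos_of_pos hL δ) (siteCoeff_pos hc hx))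

end

lemma inv_exp_inv_sub_one_le {w : ℝ} (hw : 0 ≤ w) : (Real.exp w⁻¹ - 1)⁻¹ ≤ w := by
  rcases hw.eq_or_lt with rfl | hw
  · simp
  · have h := Real.add_one_le_exp w⁻¹
    rw [inv_le_comm₀ (by linarith [inv_pos.2 hw]) hw]
    linarith

/-- The linear bound dominates the rescaled rates, but for `δ < d` it is not summable over the
lattice. The quadratic bound is, as soon as `2δ > d`, and gives summability of the rates. -/
lemma inv_exp_inv_sub_one_le_sq {w : ℝ} (hw : 0 ≤ w) : (Real.exp w⁻¹ - 1)⁻¹ ≤ 2 * w ^ 2 := by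
  rcases hw.eq_or_lt with rfl | hw
  · simp
  · have h := Real.quadratic_le_exp_of_nonneg (inv_nonneg.2 hw.le)
    have h' : (2 * w ^ 2)⁻¹ ≤ Real.exp w⁻¹ - 1 := by
      have : (2 * w ^ 2)⁻¹ = w⁻¹ ^ 2 / 2 := by field_simp
      rw [this]
      linarith [inv_pos.2 hw]
    rw [inv_le_comm₀ (lt_of_lt_of_le (by positivity) h') (by positivity)]
    exact h'

lemma tendsto_mul_inv_exp_sub_one :
    Tendsto (fun u : ℝ => u * (Real.exp u - 1)⁻¹) (𝓝[≠] 0) (𝓝 1) := by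
  have h := hasDerivAt_iff_tendsto_slope.1 (Real.hasDerivAt_exp 0)
  rw [Real.exp_zero] at h
  have h2 := h.inv₀ one_ne_zero
  rw [inv_one] at h2
  refine h2.congr fun u => ?_
  simp [slope_def_field]
  field_simp

section

variable {c δ L : ℝ}

lemma siteRate_trap_nonneg (hc : 0 < c) (hL : 0 < L) (x : Site d) :
    0 ≤ siteRate (trap d c δ) L x := by
  rw [siteRate, trap_rescale hL, inv_nonneg, sub_nonneg, Real.one_le_exp_iff, inv_nonneg]
  exact mul_nonneg (Real.rpow_nonneg hL.le δ) (siteCoeff_nonneg hc x)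

lemma siteRate_trap_le (hc : 0 < c) (hL : 0 < L) (x : Site d) :
    siteRate (trap d c δ) L x ≤ L ^ δ * siteCoeff c δ x := by
  rw [siteRate, trap_rescale hL]
  exact inv_exp_inv_sub_one_le (mul_nonneg (Real.rpow_nonneg hL.le δ) (siteCoeff_nonneg hc x))

lemma siteRate_trap_le_sq (hc : 0 < c) (hL : 0 < L) (x : Site d) :
    siteRate (trap d c δ) L x ≤ 2 * (L ^ δ * siteCoeff c δ x) ^ 2 := by
  rw [siteRate, trap_rescale hL]
  exact inv_exp_inv_sub_one_le_sq (mul_nonneg (Real.rpow_nonneg hL.le δ) (siteCoeff_nonneg hc x))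

lemma summable_siteRate_trap (hc : 0 < c) (hδ : (d : ℝ) / 2 < δ) (hL : 0 < L) :
    Summable (siteRate (trap d c δ) L : Site d → ℝ) := by
  refine Summable.of_nonneg_of_le (siteRate_trap_nonneg hc hL) (siteRate_trap_le_sq hc hL) ?_
  refine ((summable_siteCoeff_sq (c := c) hδ).mul_left (2 * (L ^ δ) ^ 2)).congr fun x => ?_
  ring

lemma summable_siteRate_trap_sq (hc : 0 < c) (hδ : (d : ℝ) / 2 < δ) (hL : 0 < L) :
    Summable fun x : Site d => siteRate (trap d c δ) L x ^ 2 := by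
  refine Summable.of_nonneg_of_le (fun x => sq_nonneg _)
    (fun x => pow_le_pow_left₀ (siteRate_trap_nonneg hc hL x) (siteRate_trap_le hc hL x) 2) ?_
  refine ((summable_siteCoeff_sq (c := c) hδ).mul_left ((L ^ δ) ^ 2)).congr fun x => ?_
  ring

lemma scaled_siteRate_trap_le (hc : 0 < c) (hL : 0 < L) (x : Site d) :
    (L ^ δ)⁻¹ * siteRate (trap d c δ) L x ≤ siteCoeff c δ x := by
  rw [inv_mul_le_iff₀ (Real.rpow_pos_of_pos hL δ)]
  exact siteRate_trap_le hc hL x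

lemma scaled_siteRate_trap_sub_sq_le (hc : 0 < c) (hL : 0 < L) (x : Site d) :
    ((L ^ δ)⁻¹ * siteRate (trap d c δ) L x - siteCoeff c δ x) ^ 2 ≤ siteCoeff c δ x ^ 2 := by
  have h1 := scaled_siteRate_trap_le (δ := δ) hc hL x
  have h2 : 0 ≤ (L ^ δ)⁻¹ * siteRate (trap d c δ) L x :=
    mul_nonneg (inv_nonneg.2 (Real.rpow_nonneg hL.le δ)) (siteRate_trap_nonneg hc hL x)
  have h3 := siteCoeff_nonneg (δ := δ) hc x
  rw [sq_le_sq, abs_of_nonneg h3, abs_le]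
  constructor <;> linarith

lemma tendsto_scaled_siteRate_trap (hc : 0 < c) (hδ : 0 < δ) {L : ℕ → ℝ}
    (hL : Tendsto L atTop atTop) (x : Site d) :
    Tendsto (fun n => (L n ^ δ)⁻¹ * siteRate (trap d c δ) (L n) x) atTop (𝓝 (siteCoeff c δ x)) := by
  by_cases hx : x = 0
  · subst hx
    have : ∀ n, (L n ^ δ)⁻¹ * siteRate (trap d c δ) (L n) (0 : Site d) = 0 := by
      intro n
      rw [siteRate, trap_rescale_zero hδ]
      simp
    simp [this, siteCoeff_zero hδ]
  have ha := siteCoeff_pos (δ := δ) hc hx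
  have hpow : Tendsto (fun n => L n ^ δ * siteCoeff c δ x) atTop atTop :=
    ((tendsto_rpow_atTop hδ).comp hL).atTop_mul_const ha
  have hu : Tendsto (fun n => (L n ^ δ * siteCoeff c δ x)⁻¹) atTop (𝓝[≠] 0) := by
    refine tendsto_nhdsWithin_iff.2 ⟨hpow.inv_tendsto_atTop, ?_⟩
    filter_upwards [hpow.eventually_gt_atTop 0] with n hn
    exact (inv_pos.2 hn).ne'
  have h := (tendsto_mul_inv_exp_sub_one.comp hu).mul_const (siteCoeff c δ x)
  rw [one_mul] at h
  refine h.congr' ?_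
  filter_upwards [hL.eventually_gt_atTop 0] with n hn
  rw [siteRate, trap_rescale hn]
  simp only [Function.comp_apply]
  rw [mul_inv]
  field_simp

/-- Once the mean density of particles off the origin converges, the Bose factors of the trap at
density `ρ` satisfy the hypotheses of the limit theorem. -/
lemma ratesConverge_trap {θ β ρ : ℝ} (hc : 0 < c) (hδ : (d : ℝ) / 2 < δ) (hδd : δ < d)
    (hρ : 0 < ρ)
    (hmean : Tendsto (fun n : ℕ => (θ * ∑' x, siteRate (trap d c δ) (length d ρ n) x) / n) atTop
      (𝓝 β)) :
    RatesConverge θ β (siteCoeff c δ) (fun n => siteRate (trap d c δ) (length d ρ n))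
      (fun n => (length d ρ n ^ δ)⁻¹) (fun n => c / 2 * (length d ρ n ^ δ)⁻¹) := by
  have hd0 : (0 : ℝ) < d := by linarith [(Nat.cast_nonneg d : (0 : ℝ) ≤ d)]
  have hδ0 : 0 < δ := by linarith
  have hLt : Tendsto (fun n => length d ρ n) atTop atTop := by
    refine (tendsto_rpow_atTop (by positivity : 0 < 1 / (d : ℝ))).comp ?_
    exact tendsto_natCast_atTop_atTop.atTop_div_const hρ
  have hLpos : ∀ᶠ n in atTop, 0 < length d ρ n := hLt.eventually_gt_atTop 0
  have hpow : ∀ n : ℕ, length d ρ n ^ δ = ((n : ℝ) / ρ) ^ (δ / d) := by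
    intro n
    rw [length, ← Real.rpow_mul (by positivity)]
    congr 1
    ring
  have hnρ : Tendsto (fun n : ℕ => (n : ℝ) / ρ) atTop atTop :=
    tendsto_natCast_atTop_atTop.atTop_div_const hρ
  have hscale : Tendsto (fun n : ℕ => (length d ρ n ^ δ)⁻¹ ^ 2 * n) atTop (𝓝 0) := by
    have h1 : Tendsto (fun y : ℝ => ρ * y ^ (-(2 * (δ / d) - 1))) atTop (𝓝 (ρ * 0)) := by
      refine (tendsto_rpow_neg_atTop ?_).const_mul ρ
      -- Here `2δ > d` makes `L^{-2δ} n`, a multiple of `n^{1 - 2δ/d}`, tend to `0`.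
      rw [sub_pos, mul_div_assoc', one_lt_div hd0]
      linarith
    rw [mul_zero] at h1
    refine (h1.comp hnρ).congr' ?_
    filter_upwards [hnρ.eventually_gt_atTop 0] with n hn
    simp only [Function.comp_apply]
    rw [hpow, neg_sub, Real.rpow_sub hn, Real.rpow_one, mul_comm 2, Real.rpow_mul hn.le,
      Real.rpow_two]
    field_simp
  -- Here `δ < d` makes `t n`, a multiple of `n^{1 - δ/d}`, tend to infinity, so the exponential
  -- bound is effective.
  have hp : 0 < 1 - δ / d := by
    rw [sub_pos, div_lt_one hd0]
    exact hδd
  have htn : ∀ᶠ n : ℕ in atTop, c / 2 * (length d ρ n ^ δ)⁻¹ * n =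
      c / 2 * ρ * ((n : ℝ) / ρ) ^ (1 - δ / d) := by
    filter_upwards [hnρ.eventually_gt_atTop 0] with n hn
    rw [hpow, Real.rpow_sub hn, Real.rpow_one]
    field_simp
  constructor
  · filter_upwards [hLpos] with n hn x using siteRate_trap_nonneg hc hn x
  · filter_upwards [hLpos] with n hn using summable_siteRate_trap hc hδ hn
  · filter_upwards [hLpos] with n hn using summable_siteRate_trap_sq hc hδ hn
  · filter_upwards [hLpos] with n hn
    exact Summable.of_nonneg_of_le (fun x => sq_nonneg _)
      (scaled_siteRate_trap_sub_sq_le hc hn) (summable_siteCoeff_sq hδ)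
  · have h0 : (∑' x : Site d, (siteCoeff c δ x - siteCoeff c δ x) ^ 2) = 0 := by simp
    rw [← h0]
    refine tendsto_tsum_of_dominated_convergence (bound := fun x => siteCoeff c δ x ^ 2)
      (summable_siteCoeff_sq hδ) (fun x => ?_) ?_
    · exact ((tendsto_scaled_siteRate_trap hc hδ0 hLt x).sub_const _).pow 2
    · filter_upwards [hLpos] with n hn x
      rw [Real.norm_of_nonneg (sq_nonneg _)]
      exact scaled_siteRate_trap_sub_sq_le hc hn x
  · exact hmean
  · exact hscale
  · filter_upwards [hLpos] with n hn
    have := Real.rpow_pos_of_pos hn δ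
    positivity
  · filter_upwards [hLpos] with n hn x
    have h1 := scaled_siteRate_trap_le (δ := δ) hc hn x
    have h2 := siteCoeff_le (δ := δ) hc hδ0 x
    rw [mul_assoc]
    -- The factor `c / 2` in `t` is chosen for this: nonzero sites have norm at least `1`, so the
    -- rescaled rates are at most `c⁻¹`.
    calc c / 2 * _ ≤ c / 2 * c⁻¹ := mul_le_mul_of_nonneg_left (h1.trans h2) (by positivity)
      _ = 1 / 2 := by field_simp
  · refine ⟨(c / 2) ^ 2 * ∑' x : Site d, siteCoeff c δ x ^ 2, ?_⟩
    filter_upwards [hLpos] with n hn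
    rw [mul_pow, mul_assoc, ← tsum_mul_left]
    refine mul_le_mul_of_nonneg_left ?_ (sq_nonneg _)
    refine Summable.tsum_le_tsum (fun x => ?_)
      ((summable_siteRate_trap_sq hc hδ hn).mul_left _) (summable_siteCoeff_sq hδ)
    rw [← mul_pow]
    exact pow_le_pow_left₀ (mul_nonneg (inv_nonneg.2 (Real.rpow_nonneg hn.le δ))
      (siteRate_trap_nonneg hc hn x)) (scaled_siteRate_trap_le hc hn x) 2
  · have h := hscale.const_mul ((c / 2) ^ 2)
    rw [mul_zero] at h
    refine h.congr fun n => ?_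
    ring
  · refine Tendsto.congr' (htn.mono fun n hn => hn.symm) ?_
    exact ((tendsto_rpow_atTop hp).comp hnρ).const_mul_atTop (by positivity)
  · intro ε hε
    -- In the variable `y = (n/ρ)^{1 - δ/d}`, `n` is a power of `y` and the exponential is
    -- `e^{-const * y}`.
    have h1 := (tendsto_rpow_mul_exp_neg_mul_atTop_nhds_zero (1 - δ / d)⁻¹ (ε * (c / 2 * ρ))
      (by positivity)).const_mul ρ
    rw [mul_zero] at h1
    refine (h1.comp ((tendsto_rpow_atTop hp).comp hnρ)).congr' ?_
    filter_upwards [htn, hnρ.eventually_gt_atTop 0] with n hn hpos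
    simp only [Function.comp_apply]
    rw [hn, ← Real.rpow_mul hpos.le, mul_inv_cancel₀ hp.ne', Real.rpow_one, ← mul_assoc]
    congr 1
    · field_simp
    · congr 1
      ring

end

end SpatialPartitions

end

/-! ### Riemann sums of the Bose factor -/

noncomputable section

namespace SpatialPartitions

variable {d : ℕ}

/-! ### Riemann sums -/

/-- The lower corner of the unit lattice cube containing a point. -/
def siteFloor (y : EuclideanSpace ℝ (Fin d)) : Site d := fun i => ⌊y i⌋

lemma measurable_siteFloor : Measurable (siteFloor : EuclideanSpace ℝ (Fin d) → Site d) := by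
  refine measurable_pi_lambda _ fun i => Int.measurable_floor.comp ?_
  fun_prop

lemma volume_siteFloor_preimage (x : Site d) :
    volume (siteFloor ⁻¹' {x} : Set (EuclideanSpace ℝ (Fin d))) = 1 := by
  have h : (siteFloor ⁻¹' {x} : Set (EuclideanSpace ℝ (Fin d))) =
      WithLp.ofLp ⁻¹' (Set.univ.pi fun i => Set.Ico (x i : ℝ) (x i + 1)) := by
    ext y
    simp [siteFloor, funext_iff, Int.floor_eq_iff]
  rw [h, (PiLp.volume_preserving_ofLp (Fin d)).measure_preimage
    (MeasurableSet.univ_pi fun i => measurableSet_Ico).nullMeasurableSet, Real.volume_pi_Ico]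
  simp

/-- Unit cubes have volume `1`, so a lattice sum is exactly the integral of a step function, and
dominated convergence becomes available. -/
lemma lintegral_comp_siteFloor (h : Site d → ℝ≥0∞) :
    ∫⁻ y : EuclideanSpace ℝ (Fin d), h (siteFloor y) = ∑' x, h x := by
  rw [← lintegral_map (measurable_of_countable h) measurable_siteFloor, lintegral_countable']
  refine tsum_congr fun x => ?_
  rw [Measure.map_apply measurable_siteFloor (measurableSet_singleton x),
    volume_siteFloor_preimage, mul_one]

lemma lintegral_comp_smul_euclidean {f : EuclideanSpace ℝ (Fin d) → ℝ≥0∞} (hf : Measurable f)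
    {r : ℝ} (hr : 0 < r) :
    ∫⁻ y, f (r • y) = ENNReal.ofReal (r ^ d)⁻¹ * ∫⁻ y, f y := by
  rw [← lintegral_map hf (measurable_const_smul r), Measure.map_addHaar_smul volume hr.ne',
    lintegral_smul_measure, finrank_euclideanSpace_fin, abs_of_pos (by positivity), smul_eq_mul]

lemma ofReal_inv_pow_mul_tsum (h : Site d → ℝ≥0∞) {r : ℝ} (hr : 0 < r) :
    ENNReal.ofReal (r ^ d)⁻¹ * ∑' x, h x =
      ∫⁻ y : EuclideanSpace ℝ (Fin d), h (siteFloor (r • y)) := by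
  rw [← lintegral_comp_siteFloor, lintegral_comp_smul_euclidean
    (f := fun y => h (siteFloor y)) ((measurable_of_countable h).comp measurable_siteFloor) hr]

lemma norm_sub_siteFloor_le (y : EuclideanSpace ℝ (Fin d)) :
    ‖y - WithLp.toLp 2 (fun i => (siteFloor y i : ℝ))‖ ≤ √d := by
  rw [EuclideanSpace.norm_eq]
  refine Real.sqrt_le_sqrt ?_
  calc ∑ i, ‖(y - WithLp.toLp 2 (fun i => (siteFloor y i : ℝ))) i‖ ^ 2 ≤ ∑ _i : Fin d, 1 := by
        refine Finset.sum_le_sum fun i _ => ?_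
        have h1 := Int.floor_le (y i)
        have h2 := Int.lt_floor_add_one (y i)
        rw [Real.norm_eq_abs, sq_abs, PiLp.sub_apply]
        simp only [siteFloor]
        rw [sq_le_one_iff_abs_le_one, abs_le]
        constructor <;> linarith
    _ = d := by simp

lemma norm_le_siteNorm_siteFloor (y : EuclideanSpace ℝ (Fin d)) (hy : siteFloor y ≠ 0) :
    ‖y‖ ≤ (1 + √d) * siteNorm (siteFloor y) := by
  have h1 := norm_sub_siteFloor_le y
  have h2 := one_le_siteNorm hy
  have h3 := norm_le_norm_add_norm_sub'  y (WithLp.toLp 2 (fun i => (siteFloor y i : ℝ)))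
  have h4 : √d ≤ √d * siteNorm (siteFloor y) := le_mul_of_one_le_right (Real.sqrt_nonneg _) h2
  have h5 : ‖(WithLp.toLp 2 (fun i => (siteFloor y i : ℝ)) : EuclideanSpace ℝ (Fin d))‖ =
    siteNorm (siteFloor y) := rfl
  linarith

lemma tendsto_rescale_siteFloor {L : ℕ → ℝ} (hL : Tendsto L atTop atTop)
    (y : EuclideanSpace ℝ (Fin d)) :
    Tendsto (fun n => rescale (L n) (siteFloor (L n • y))) atTop (𝓝 y) := by
  rw [tendsto_iff_norm_sub_tendsto_zero]
  refine squeeze_zero' (Eventually.of_forall fun n => norm_nonneg _) ?_ (hL.const_div_atTop √d)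
  filter_upwards [hL.eventually_gt_atTop 0] with n hn
  have h : rescale (L n) (siteFloor (L n • y)) - y =
      -((L n)⁻¹ • (L n • y - WithLp.toLp 2 (fun i => (siteFloor (L n • y) i : ℝ)))) := by
    rw [smul_sub, inv_smul_smul₀ hn.ne', neg_sub]
    congr 1
    ext i
    simp [rescale, div_eq_inv_mul]
  rw [h, norm_neg, norm_smul, norm_inv, Real.norm_of_nonneg hn.le, ← div_eq_inv_mul]
  gcongr
  exact norm_sub_siteFloor_le _

/-- The Bose factor of the trap at a point. -/
def boseDensity (d : ℕ) (c δ : ℝ) (y : EuclideanSpace ℝ (Fin d)) : ℝ :=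
  (Real.exp (trap d c δ y) - 1)⁻¹

section

variable {c δ : ℝ}

lemma measurable_trap (d : ℕ) (c δ : ℝ) : Measurable (trap d c δ) := by
  unfold trap
  fun_prop

lemma continuous_trap (hδ : 0 < δ) : Continuous (trap d c δ) := by
  unfold trap
  exact continuous_const.mul (continuous_norm.rpow_const fun _ => Or.inr hδ.le)

lemma trap_nonneg (hc : 0 < c) (y : EuclideanSpace ℝ (Fin d)) : 0 ≤ trap d c δ y :=
  mul_nonneg hc.le (Real.rpow_nonneg (norm_nonneg y) δ)

lemma trap_pos (hc : 0 < c) {y : EuclideanSpace ℝ (Fin d)} (hy : y ≠ 0) : 0 < trap d c δ y :=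
  mul_pos hc (Real.rpow_pos_of_pos (norm_pos_iff.2 hy) δ)

lemma measurable_boseDensity (d : ℕ) (c δ : ℝ) : Measurable (boseDensity d c δ) :=
  (((measurable_trap d c δ).exp).sub_const 1).inv

lemma boseDensity_le_of_norm_le (hc : 0 < c) (hδ : 0 < δ) {y z : EuclideanSpace ℝ (Fin d)}
    (hy : y ≠ 0) (h : ‖y‖ ≤ ‖z‖) : boseDensity d c δ z ≤ boseDensity d c δ y := by
  have h1 : trap d c δ y ≤ trap d c δ z :=
    mul_le_mul_of_nonneg_left (Real.rpow_le_rpow (norm_nonneg y) h hδ.le) hc.le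
  refine inv_anti₀ ?_ (sub_le_sub_right (Real.exp_le_exp.2 h1) 1)
  rw [sub_pos]
  exact Real.one_lt_exp_iff.2 (trap_pos hc hy)

lemma boseDensity_zero (hδ : 0 < δ) : boseDensity d c δ 0 = 0 := by
  simp [boseDensity, trap, Real.zero_rpow hδ.ne']

lemma boseDensity_nonneg (hc : 0 < c) (y : EuclideanSpace ℝ (Fin d)) : 0 ≤ boseDensity d c δ y := by
  rw [boseDensity, inv_nonneg, sub_nonneg]
  exact Real.one_le_exp (trap_nonneg hc y)

/-- Outside the base cube, rounding to the corner shrinks the norm by at most `1 + √d`, and the Bose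
factor decreases with the norm. On the base cube the step function is `0` by the convention for the
inverse. The majorant is a dilate, hence integrable, and does not depend on `L`. -/
lemma boseDensity_rescale_siteFloor_le (hc : 0 < c) (hδ : 0 < δ) {L : ℝ} (hL : 0 < L)
    (y : EuclideanSpace ℝ (Fin d)) :
    boseDensity d c δ (rescale L (siteFloor (L • y))) ≤
      boseDensity d c δ ((1 + √d)⁻¹ • y) := by
  have hK : 0 < 1 + √(d : ℝ) := by positivity
  by_cases hm : siteFloor (L • y) = 0
  · have h0 : rescale L (0 : Site d) = 0 := by
      ext i
      simp [rescale]
    rw [hm, h0, boseDensity_zero hδ]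
    exact boseDensity_nonneg hc _
  · have hy : y ≠ 0 := by
      rintro rfl
      refine hm ?_
      ext i
      simp [siteFloor]
    refine boseDensity_le_of_norm_le hc hδ (smul_ne_zero (inv_ne_zero hK.ne') hy) ?_
    have h := norm_le_siteNorm_siteFloor _ hm
    rw [norm_smul, Real.norm_of_nonneg hL.le] at h
    rw [norm_rescale hL.le, norm_smul, norm_inv, Real.norm_of_nonneg hK.le, le_div_iff₀ hL,
      mul_assoc, inv_mul_le_iff₀ hK]
    linarith

/-- Riemann sums of the Bose factor converge to its integral. -/
lemma tendsto_riemann_sum (hc : 0 < c) (hδ : 0 < δ) {L : ℕ → ℝ} (hL : Tendsto L atTop atTop)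
    (hfin : ∫⁻ y, ENNReal.ofReal (boseDensity d c δ y) ≠ ∞) :
    Tendsto (fun n => ENNReal.ofReal (L n ^ d)⁻¹ *
        ∑' x : Site d, ENNReal.ofReal (siteRate (trap d c δ) (L n) x)) atTop
      (𝓝 (∫⁻ y, ENNReal.ofReal (boseDensity d c δ y))) := by
  have hpos := hL.eventually_gt_atTop 0
  have hK : 0 < (1 + √(d : ℝ))⁻¹ := by positivity
  have hm : Measurable fun y => ENNReal.ofReal (boseDensity d c δ y) :=
    (measurable_boseDensity d c δ).ennreal_ofReal
  have key : Tendsto (fun n => ∫⁻ y,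
      ENNReal.ofReal (boseDensity d c δ (rescale (L n) (siteFloor (L n • y))))) atTop
      (𝓝 (∫⁻ y, ENNReal.ofReal (boseDensity d c δ y))) := by
    refine tendsto_lintegral_filter_of_dominated_convergence
      (fun y => ENNReal.ofReal (boseDensity d c δ ((1 + √d)⁻¹ • y))) ?_ ?_ ?_ ?_
    · refine Eventually.of_forall fun n => ?_
      exact (measurable_of_countable
        (fun x : Site d => ENNReal.ofReal (boseDensity d c δ (rescale (L n) x)))).comp
        (measurable_siteFloor.comp (measurable_const_smul (L n)))
    · filter_upwards [hpos] with n hn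
      exact ae_of_all _ fun y =>
        ENNReal.ofReal_le_ofReal (boseDensity_rescale_siteFloor_le hc hδ hn y)
    · rw [lintegral_comp_smul_euclidean hm hK]
      exact ENNReal.mul_ne_top ENNReal.ofReal_ne_top hfin
    · refine ae_of_all _ fun y => (ENNReal.continuous_ofReal.tendsto _).comp ?_
      by_cases hy : y = 0
      · subst hy
        have h0 : ∀ n, boseDensity d c δ (rescale (L n)
            (siteFloor (L n • (0 : EuclideanSpace ℝ (Fin d))))) = boseDensity d c δ 0 := by
          intro n
          congr 1
          ext i
          simp [rescale, siteFloor]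
        simp only [h0]
        exact tendsto_const_nhds
      · have hcont : ContinuousAt (boseDensity d c δ) y := by
          refine ContinuousAt.inv₀ ?_ ?_
          · exact (((continuous_trap hδ).rexp).sub continuous_const).continuousAt
          · exact (sub_pos.2 (Real.one_lt_exp_iff.2 (trap_pos hc hy))).ne'
        exact hcont.tendsto.comp (tendsto_rescale_siteFloor hL y)
  refine key.congr' ?_
  filter_upwards [hpos] with n hn
  exact (ofReal_inv_pow_mul_tsum
    (fun x : Site d => ENNReal.ofReal (boseDensity d c δ (rescale (L n) x))) hn).symm

end

end SpatialPartitions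

end

/-! ### Critical fugacity and critical densities of the trap -/

noncomputable section

namespace SpatialPartitions

variable {d : ℕ}

/-! ### The critical density of the trap -/

lemma hasSum_pnat_exp_neg {v : ℝ} (hv : 0 < v) :
    HasSum (fun j : ℕ+ => Real.exp (-(j : ℝ) * v)) (Real.exp v - 1)⁻¹ := by
  have hq1 : Real.exp (-v) < 1 := Real.exp_lt_one_iff.2 (neg_lt_zero.2 hv)
  have h := (hasSum_geometric_of_lt_one (Real.exp_pos (-v)).le hq1).mul_left (Real.exp (-v))
  have hval : Real.exp (-v) * (1 - Real.exp (-v))⁻¹ = (Real.exp v - 1)⁻¹ := by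
    have h1 : 0 < Real.exp v - 1 := sub_pos.2 (Real.one_lt_exp_iff.2 hv)
    have h2 : Real.exp v - 1 = Real.exp v * (1 - Real.exp (-v)) := by
      rw [mul_sub, ← Real.exp_add]
      simp
    rw [h2, mul_inv, Real.exp_neg]
  rw [hval] at h
  rw [← Equiv.pnatEquivNat.symm.hasSum_iff]
  have he : (fun j : ℕ+ => Real.exp (-(j : ℝ) * v)) ∘ Equiv.pnatEquivNat.symm =
      fun n : ℕ => Real.exp (-v) * Real.exp (-v) ^ n := by
    ext n
    rw [← pow_succ', ← Real.exp_nat_mul]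
    simp [Function.comp_apply]
  rw [he]
  exact h

lemma tsum_pnat_ofReal_exp_neg {v : ℝ} (hv : 0 < v) :
    ∑' j : ℕ+, ENNReal.ofReal (Real.exp (-(j : ℝ) * v)) =
      ENNReal.ofReal (Real.exp v - 1)⁻¹ := by
  have h := hasSum_pnat_exp_neg hv
  rw [← ENNReal.ofReal_tsum_of_nonneg (fun j => (Real.exp_pos _).le) h.summable, h.tsum_eq]

section

variable {c δ θ : ℝ}

lemma lintegral_exp_neg_trap_lt_top (hd : 0 < d) (hc : 0 < c) (hδ : 0 < δ) :
    ∫⁻ y, ENNReal.ofReal (Real.exp (-trap d c δ y)) < ∞ := by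
  have : Nonempty (Fin d) := ⟨⟨0, hd⟩⟩
  have h : Integrable (fun y : EuclideanSpace ℝ (Fin d) => Real.exp (-c * ‖y‖ ^ δ)) := by
    refine (integrable_fun_norm_addHaar (volume : Measure (EuclideanSpace ℝ (Fin d)))
      (f := fun r => Real.exp (-c * r ^ δ))).2 ?_
    have h1 := integrableOn_rpow_mul_exp_neg_mul_rpow (p := δ) (s := ((d - 1 : ℕ) : ℝ)) (b := c)
      (by linarith [(Nat.cast_nonneg (d - 1) : (0 : ℝ) ≤ ((d - 1 : ℕ) : ℝ))]) hδ hc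
    simpa [Real.rpow_natCast] using h1
  have h2 := h.lintegral_lt_top
  refine lt_of_eq_of_lt ?_ h2
  simp [trap]

lemma density_trap_lt_top (hd : 0 < d) (hc : 0 < c) (hδ : 0 < δ) (θ : ℝ) {z : ℝ≥0∞} (hz : z < 1) :
    density (trap d c δ) (fun _ => θ) z < ∞ := by
  have hK := lintegral_exp_neg_trap_lt_top hd hc hδ
  set K := ∫⁻ y, ENNReal.ofReal (Real.exp (-trap d c δ y)) with hKdef
  have hle : density (trap d c δ) (fun _ => θ) z ≤
      ∑' j : ℕ, ENNReal.ofReal θ * K * z ^ j := by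
    calc density (trap d c δ) (fun _ => θ) z
        ≤ ∑' j : ℕ+, ENNReal.ofReal θ * K * z ^ (j : ℕ) := by
          refine ENNReal.tsum_le_tsum fun j => ?_
          rw [mul_right_comm]
          gcongr
          refine lintegral_mono fun y => ENNReal.ofReal_le_ofReal (Real.exp_le_exp.2 ?_)
          have h1 : (1 : ℝ) ≤ (j : ℝ) := by exact_mod_cast j.pos
          nlinarith [trap_nonneg (δ := δ) hc y]
      _ ≤ _ := ENNReal.tsum_comp_le_tsum_of_injective PNat.coe_injective
          (fun j : ℕ => ENNReal.ofReal θ * K * z ^ j)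
  refine hle.trans_lt ?_
  rw [ENNReal.tsum_mul_left, ENNReal.tsum_geometric]
  refine ENNReal.mul_lt_top (ENNReal.mul_lt_top ENNReal.ofReal_lt_top hK) ?_
  rw [ENNReal.inv_lt_top]
  exact tsub_pos_of_lt hz

/-- The trap vanishes at the origin, so for `1 < w < z` there is an open set where `w^j e^{-jV} ≥ 1`
for all `j`; the terms of the series do not tend to zero. -/
lemma density_trap_eq_top (hδ : 0 < δ) (hθ : 0 < θ) {z : ℝ≥0∞} (hz : 1 < z) :
    density (trap d c δ) (fun _ => θ) z = ∞ := by
  obtain ⟨w, hw1, hwz⟩ := ENNReal.lt_iff_exists_nnreal_btwn.1 hz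
  have hw : (1 : ℝ) < w := by exact_mod_cast hw1
  have hw0 : (0 : ℝ) < w := by linarith
  set B : Set (EuclideanSpace ℝ (Fin d)) := {y | trap d c δ y < Real.log w} with hB
  have hBo : IsOpen B := isOpen_lt (continuous_trap hδ) continuous_const
  have hB0 : (0 : EuclideanSpace ℝ (Fin d)) ∈ B := by
    change trap d c δ 0 < Real.log w
    rw [trap, norm_zero, Real.zero_rpow hδ.ne', mul_zero]
    exact Real.log_pos hw
  have hBpos : volume B ≠ 0 := (hBo.measure_pos volume ⟨0, hB0⟩).ne'
  have hterm : ∀ j : ℕ+, ENNReal.ofReal θ * volume B ≤ ENNReal.ofReal θ * z ^ (j : ℕ) *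
      ∫⁻ y, ENNReal.ofReal (Real.exp (-(j : ℝ) * trap d c δ y)) := by
    intro j
    rw [mul_assoc]
    gcongr
    calc volume B = (w : ℝ≥0∞) ^ (j : ℕ) * ∫⁻ _y in B, ENNReal.ofReal ((w : ℝ) ^ (j : ℕ))⁻¹ := by
          rw [setLIntegral_const, ← mul_assoc, ENNReal.ofReal_inv_of_pos (by positivity),
            ENNReal.ofReal_pow hw0.le, ENNReal.ofReal_coe_nnreal, ENNReal.mul_inv_cancel, one_mul]
          · refine pow_ne_zero _ ?_
            exact (zero_lt_one.trans hw1).ne'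
          · exact ENNReal.pow_ne_top ENNReal.coe_ne_top
      _ ≤ z ^ (j : ℕ) * ∫⁻ y in B, ENNReal.ofReal (Real.exp (-(j : ℝ) * trap d c δ y)) := by
          refine mul_le_mul' (pow_le_pow_left' hwz.le _) (setLIntegral_mono' hBo.measurableSet
            fun y hy => ENNReal.ofReal_le_ofReal ?_)
          have hy' : trap d c δ y < Real.log w := hy
          rw [← Real.exp_log (pow_pos hw0 (j : ℕ)), ← Real.exp_neg, Real.log_pow]
          refine Real.exp_le_exp.2 ?_
          have : (0 : ℝ) ≤ (j : ℕ) := Nat.cast_nonneg _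
          nlinarith
      _ ≤ _ := by
          gcongr
          exact Measure.restrict_le_self
  refine top_unique ?_
  calc (∞ : ℝ≥0∞) = ∑' _j : ℕ+, ENNReal.ofReal θ * volume B :=
        (ENNReal.tsum_const_eq_top_of_ne_zero
          (mul_ne_zero (ENNReal.ofReal_pos.2 hθ).ne' hBpos)).symm
    _ ≤ _ := ENNReal.tsum_le_tsum hterm

lemma criticalFugacity_trap (hd : 0 < d) (hc : 0 < c) (hδ : 0 < δ) (hθ : 0 < θ) :
    criticalFugacity (trap d c δ) (fun _ => θ) = 1 := by
  refine le_antisymm (sSup_le fun z hz => ?_) (le_of_forall_lt fun z hz => ?_)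
  · by_contra h
    exact (lt_of_eq_of_lt (density_trap_eq_top hδ hθ (not_le.1 h)).symm hz).false
  · obtain ⟨w, hzw, hw⟩ := exists_between hz
    exact hzw.trans_le (le_sSup (density_trap_lt_top hd hc hδ θ hw))

lemma criticalDensity_trap (hd : 0 < d) (hc : 0 < c) (hδ : 0 < δ) (hθ : 0 < θ) :
    criticalDensity (trap d c δ) (fun _ => θ) =
      ENNReal.ofReal θ * ∫⁻ y, ENNReal.ofReal (boseDensity d c δ y) := by
  have : Nonempty (Fin d) := ⟨⟨0, hd⟩⟩
  rw [criticalDensity, criticalFugacity_trap hd hc hδ hθ, density]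
  simp only [one_pow, mul_one]
  rw [ENNReal.tsum_mul_left, ← lintegral_tsum]
  · congr 1
    refine lintegral_congr_ae ?_
    have h0 : ∀ᵐ y : EuclideanSpace ℝ (Fin d), y ≠ 0 :=
      compl_mem_ae_iff.2 (measure_singleton 0)
    filter_upwards [h0] with y hy
    exact tsum_pnat_ofReal_exp_neg (trap_pos hc hy)
  · intro j
    exact ((measurable_trap d c δ).const_mul _).exp.ennreal_ofReal.aemeasurable

lemma lintegral_eval_grandCanonicalMeasure (V : EuclideanSpace ℝ (Fin d) → ℝ) (θ : ℕ+ → ℝ) (L : ℝ)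
    (z : ℝ≥0) (q : Site d × ℕ+) :
    ∫⁻ R, (R q : ℝ≥0∞) ∂grandCanonicalMeasure V θ L z = ENNReal.ofReal
      (θ q.2 / (q.2 : ℝ) * (z : ℝ) ^ (q.2 : ℕ) * Real.exp (-(q.2 : ℝ) * V (rescale L q.1))) := by
  rw [grandCanonicalMeasure, ← lintegral_map (f := fun m : ℕ => (m : ℝ≥0∞))
    (measurable_of_countable _) (measurable_pi_apply q), Measure.infinitePi_map_eval,
    lintegral_natCast_poissonMeasure]
  rfl

lemma measurable_natCast_eval (q : Site d × ℕ+) :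
    Measurable fun R : Site d × ℕ+ → ℕ => (R q : ℝ≥0∞) :=
  (measurable_of_countable fun m : ℕ => (m : ℝ≥0∞)).comp (measurable_pi_apply q)

lemma lintegral_siteOccupation {V : EuclideanSpace ℝ (Fin d) → ℝ} {L : ℝ} {x : Site d}
    (hpos : 0 < V (rescale L x)) (hθ : 0 < θ) :
    ∫⁻ R, ∑' j : ℕ+, (j : ℝ≥0∞) * (R (x, j) : ℝ≥0∞)
      ∂grandCanonicalMeasure V (fun _ => θ) L 1 = ENNReal.ofReal (θ * siteRate V L x) := by
  rw [lintegral_tsum fun j => ((measurable_natCast_eval (x, j)).const_mul _).aemeasurable,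
    ENNReal.ofReal_mul hθ.le, siteRate, ← tsum_pnat_ofReal_exp_neg hpos, ← ENNReal.tsum_mul_left]
  refine tsum_congr fun j => ?_
  rw [lintegral_const_mul _ (measurable_natCast_eval (x, j)),
    lintegral_eval_grandCanonicalMeasure, ← ENNReal.ofReal_mul hθ.le]
  have hj : ((j : ℕ) : ℝ≥0∞) = ENNReal.ofReal ((j : ℕ) : ℝ) := (ENNReal.ofReal_natCast _).symm
  rw [hj, ← ENNReal.ofReal_mul (Nat.cast_nonneg _)]
  congr 1
  have : ((j : ℕ) : ℝ) ≠ 0 := by exact_mod_cast j.ne_zero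
  simp only [NNReal.coe_one, one_pow, mul_one]
  field_simp

lemma lintegral_particlesOffOrigin {V : EuclideanSpace ℝ (Fin d) → ℝ} {L : ℝ}
    (h0 : V (rescale L 0) = 0) (hpos : ∀ x : Site d, x ≠ 0 → 0 < V (rescale L x)) (hθ : 0 < θ) :
    ∫⁻ R, particlesOffOrigin R ∂grandCanonicalMeasure V (fun _ => θ) L 1 =
      ∑' x : Site d, ENNReal.ofReal (θ * siteRate V L x) := by
  have hm : ∀ x : {x : Site d // x ≠ 0}, Measurable fun R : Site d × ℕ+ → ℕ =>
      ∑' j : ℕ+, (j : ℝ≥0∞) * (R (x.1, j) : ℝ≥0∞) := fun x =>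
    Measurable.tsum fun j => (measurable_natCast_eval (x.1, j)).const_mul _
  unfold particlesOffOrigin
  rw [lintegral_tsum fun x => (hm x).aemeasurable,
    tsum_congr fun x : {x : Site d // x ≠ 0} => lintegral_siteOccupation (hpos x.1 x.2) hθ]
  refine tsum_subtype_eq_of_support_subset
    (f := fun x : Site d => ENNReal.ofReal (θ * siteRate V L x)) (s := {x | x ≠ 0}) ?_
  intro x hx hx0
  refine hx ?_
  subst hx0
  simp [siteRate_zero h0]

/-- At `z_c = 1` the Poisson mean off the origin agrees with the mean `θ ∑ l_x` of the mixed Poisson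
count. The centring in the theorem is thus exact for every `L`, and no rate of convergence of
`ρ_c^L` is needed. -/
lemma finiteCriticalDensity_trap (hd : 0 < d) (hc : 0 < c) (hδ : 0 < δ) (hθ : 0 < θ) {L : ℝ}
    (hL : 0 < L) :
    finiteCriticalDensity (trap d c δ) (fun _ => θ) L =
      (θ * ∑' x : Site d, siteRate (trap d c δ) L x) / L ^ d := by
  have hnn : ∀ x : Site d, 0 ≤ θ * siteRate (trap d c δ) L x :=
    fun x => mul_nonneg hθ.le (siteRate_trap_nonneg hc hL x)
  rw [finiteCriticalDensity, criticalFugacity_trap hd hc hδ hθ, ENNReal.toNNReal_one,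
    lintegral_particlesOffOrigin (trap_rescale_zero hδ L) (fun x hx => trap_rescale_pos hc hL hx)
    hθ, ENNReal.tsum_toReal_eq fun x => ENNReal.ofReal_ne_top, ← tsum_mul_left]
  congr 1
  exact tsum_congr fun x => ENNReal.toReal_ofReal (hnn x)

lemma length_pow (hd : 0 < d) {ρ : ℝ} (hρ : 0 < ρ) (n : ℕ) : length d ρ n ^ d = n / ρ := by
  rw [length, one_div, Real.rpow_inv_natCast_pow (by positivity) hd.ne']

lemma length_pos {ρ : ℝ} (hρ : 0 < ρ) {n : ℕ} (hn : 0 < n) : 0 < length d ρ n :=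
  Real.rpow_pos_of_pos (by positivity) _

lemma tendsto_length (hd : 0 < d) {ρ : ℝ} (hρ : 0 < ρ) :
    Tendsto (fun n => length d ρ n) atTop atTop :=
  (tendsto_rpow_atTop (by positivity : 0 < 1 / (d : ℝ))).comp
    (tendsto_natCast_atTop_atTop.atTop_div_const hρ)

/-- The mean fraction of particles off the origin converges to `ρ_c / ρ`. -/
lemma tendsto_mean_siteRate_trap (hc : 0 < c) (hδ : (d : ℝ) / 2 < δ) (hd : 0 < d)
    (hθ : 0 < θ) {ρ : ℝ} (hρ : 0 < ρ)
    (hfin : criticalDensity (trap d c δ) (fun _ => θ) ≠ ∞) :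
    Tendsto (fun n : ℕ => (θ * ∑' x : Site d, siteRate (trap d c δ) (length d ρ n) x) / n) atTop
      (𝓝 ((criticalDensity (trap d c δ) fun _ => θ).toReal / ρ)) := by
  have hδ0 : 0 < δ := lt_of_le_of_lt (by positivity) hδ
  rw [criticalDensity_trap hd hc hδ0 hθ] at hfin ⊢
  have hI : ∫⁻ y, ENNReal.ofReal (boseDensity d c δ y) ≠ ∞ := by
    intro h
    rw [h, ENNReal.mul_top (ENNReal.ofReal_pos.2 hθ).ne'] at hfin
    exact hfin rfl
  have h := (ENNReal.tendsto_toReal hI).comp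
    (tendsto_riemann_sum hc hδ0 (tendsto_length hd hρ) hI)
  have h2 := (h.const_mul θ).div_const ρ
  rw [ENNReal.toReal_mul, ENNReal.toReal_ofReal hθ.le]
  refine h2.congr' ?_
  filter_upwards [eventually_gt_atTop 0] with n hn
  have hL : 0 < length d ρ n := length_pos hρ hn
  have hn' : (0 : ℝ) < n := by exact_mod_cast hn
  simp only [Function.comp_apply]
  rw [ENNReal.toReal_mul, ENNReal.toReal_ofReal (by positivity), length_pow hd hρ,
    ENNReal.tsum_toReal_eq fun x => ENNReal.ofReal_ne_top,
    tsum_congr fun x => ENNReal.toReal_ofReal (siteRate_trap_nonneg (δ := δ) hc hL x)]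
  field_simp

end

end SpatialPartitions

end

/-! ### Assembly of the limit theorem -/

noncomputable section

namespace SpatialPartitions

variable {d : ℕ} {c δ θ : ℝ}

lemma partialSum_eq_sum_siteCoeff {Ω : Type*} (hδ : 0 < δ) (G : Site d → Ω → ℝ)
    (Λ : Finset (Site d)) (ω : Ω) :
    partialSum δ θ G Λ ω = ∑ x ∈ Λ, siteCoeff 1 δ x * (θ - G x ω) := by
  rw [partialSum, ← Finset.sum_erase Λ (a := 0) (by rw [siteCoeff_zero hδ, zero_mul])]
  refine Finset.sum_congr rfl fun x _ => ?_
  rw [siteCoeff, inv_one, one_mul, div_eq_inv_mul]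

lemma siteCoeff_eq (c δ : ℝ) (x : Site d) : siteCoeff c δ x = c⁻¹ * siteCoeff 1 δ x := by
  simp [siteCoeff]

variable {Ω : Type*} [MeasurableSpace Ω] {P : Measure Ω} [IsProbabilityMeasure P]
  {G : Site d → Ω → ℝ}

lemma isProbabilityMeasure_canonicalMeasure_trap (hG : IsGammaFamily P θ G) (hc : 0 < c)
    (hδ : (d : ℝ) / 2 < δ) (hθ : 0 < θ) {ρ : ℝ} (hρ : 0 < ρ) (n : ℕ) :
    IsProbabilityMeasure (canonicalMeasure (trap d c δ) (fun _ => θ) (length d ρ n) n) := by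
  have hδ0 : 0 < δ := lt_of_le_of_lt (by positivity) hδ
  refine isProbabilityMeasure_canonicalMeasure _ hθ _ n ?_
  rcases n.eq_zero_or_pos with rfl | hn
  · exact partitionFunction_zero_ne_top _ _ _
  · have hL : 0 < length d ρ n := length_pos hρ hn
    exact partitionFunction_ne_top hG hθ (trap_rescale_zero hδ0 _)
      (fun x hx => trap_rescale_pos hc hL hx) (summable_siteRate_trap hc hδ hL) n

/-- Expectations of the normalized occupation of the origin as tilted expectations. -/
lemma integral_scaled_originOccupation (hG : IsGammaFamily P θ G) (hd : 0 < d) (hc : 0 < c)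
    (hδ : (d : ℝ) / 2 < δ) (hθ : 0 < θ) {ρ : ℝ} (hρ : 0 < ρ) {n : ℕ} (hn : 0 < n) (f : ℝ → ℝ) :
    ∫ p, f (((originOccupation p : ℝ) -
        (ρ - finiteCriticalDensity (trap d c δ) (fun _ => θ) (length d ρ n)) *
          length d ρ n ^ d) / length d ρ n ^ δ)
      ∂canonicalMeasure (trap d c δ) (fun _ => θ) (length d ρ n) n =
    (∫ q, tilt θ n q.2 * f ((length d ρ n ^ δ)⁻¹ *
        (θ * ∑' x, siteRate (trap d c δ) (length d ρ n) x - q.2))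
      ∂hG.jointLaw (siteRate (trap d c δ) (length d ρ n))) /
    ∫ q, tilt θ n q.2 ∂hG.jointLaw (siteRate (trap d c δ) (length d ρ n)) := by
  have hδ0 : 0 < δ := lt_of_le_of_lt (by positivity) hδ
  have hL : 0 < length d ρ n := length_pos hρ hn
  have h := (integral_canonicalMeasure hG hθ (trap_rescale_zero hδ0 (length d ρ n))
    (fun x hx => trap_rescale_pos hc hL hx) (summable_siteRate_trap hc hδ hL) n
    (fun m => f (((m : ℝ) -
      (ρ - finiteCriticalDensity (trap d c δ) (fun _ => θ) (length d ρ n)) *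
        length d ρ n ^ d) / length d ρ n ^ δ))).2
  rw [h]
  congr 1
  refine integral_congr_ae (ae_of_all _ fun q => ?_)
  by_cases hq : q.2 ≤ n
  · simp only
    congr 2
    rw [Nat.cast_sub hq, sub_mul, finiteCriticalDensity_trap hd hc hδ0 hθ hL,
      div_mul_cancel₀ _ (pow_pos hL d).ne', length_pow hd hρ, mul_div_cancel₀ _ hρ.ne',
      div_eq_inv_mul]
    congr 1
    ring
  -- Where the natural subtraction would truncate, both integrands are killed by the tilt.
  · simp [tilt, hq]

end SpatialPartitions

end

open SpatialPartitions

theorem theorem5p3 (d : ℕ) (c δ θ ρ : ℝ) (hc : 0 < c) (hδ : (d : ℝ) / 2 < δ) (hδd : δ < d)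
    (hθ : 0 < θ)
    (hρ : SpatialPartitions.criticalDensity (SpatialPartitions.trap d c δ) (fun _ => θ) <
      ENNReal.ofReal ρ)
    {Ω : Type*} [MeasurableSpace Ω] (P : Measure Ω) [IsProbabilityMeasure P]
    (G : SpatialPartitions.Site d → Ω → ℝ)
    (hG : ∀ x, HasLaw (G x) (gammaMeasure θ 1) P) (hindep : iIndepFun G P) :
    ∃ Y : Ω → ℝ, AEMeasurable Y P ∧ SpatialPartitions.IsRandomSeriesSum P δ θ G Y ∧
      ∃ _ : ∀ n : ℕ, IsProbabilityMeasure (SpatialPartitions.canonicalMeasure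
          (SpatialPartitions.trap d c δ) (fun _ => θ) (SpatialPartitions.length d ρ n) n),
        TendstoInDistribution
          (fun (n : ℕ) (p : SpatialPartitions.Configuration d n) =>
            ((SpatialPartitions.originOccupation p : ℝ) -
                (ρ - SpatialPartitions.finiteCriticalDensity (SpatialPartitions.trap d c δ)
                  (fun _ => θ) (SpatialPartitions.length d ρ n)) *
                SpatialPartitions.length d ρ n ^ d) /
              SpatialPartitions.length d ρ n ^ δ)
          atTop
          (fun ω => c⁻¹ * Y ω)
          (fun n => SpatialPartitions.canonicalMeasure
            (SpatialPartitions.trap d c δ) (fun _ => θ) (SpatialPartitions.length d ρ n) n)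
          P := by
  have hd0 : (0 : ℝ) < d := by linarith [(Nat.cast_nonneg d : (0 : ℝ) ≤ d)]
  have hd : 0 < d := by exact_mod_cast hd0
  have hδ0 : 0 < δ := lt_of_le_of_lt (by positivity) hδ
  have hρ0 : 0 < ρ := ENNReal.ofReal_pos.1 (bot_le.trans_lt hρ)
  -- Finiteness of the critical density is read off from `hρ`, so the singularity of the Bose factor
  -- at `0` need not be integrated by hand.
  have hfin : criticalDensity (trap d c δ) (fun _ => θ) ≠ ∞ := hρ.ne_top
  have hβ : (criticalDensity (trap d c δ) fun _ => θ).toReal / ρ < 1 := by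
    rw [div_lt_one hρ0]
    exact (ENNReal.lt_ofReal_iff_toReal_lt hfin).1 hρ
  obtain ⟨G', hG', hGG'⟩ := exists_isGammaFamily hG hindep
  obtain ⟨Y, hYm, hY⟩ := hG'.exists_series hθ (summable_siteCoeff_sq (c := 1) hδ)
  have hprob := isProbabilityMeasure_canonicalMeasure_trap hG' hc hδ hθ hρ0
  refine ⟨Y, hYm.aemeasurable, fun Λ hΛ hex => ?_, hprob, ?_⟩
  · filter_upwards [hY Λ hΛ hex, ae_all_iff.2 hGG'] with ω h1 h2
    refine h1.congr fun k => ?_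
    rw [partialSum_eq_sum_siteCoeff hδ0]
    exact Finset.sum_congr rfl fun x _ => by rw [h2 x]
  · have hmeas : ∀ n : ℕ, Measurable fun p : Configuration d n =>
        ((originOccupation p : ℝ) - (ρ - finiteCriticalDensity (trap d c δ) (fun _ => θ)
          (length d ρ n)) * length d ρ n ^ d) / length d ρ n ^ δ := fun n => measurable_from_top
    refine ⟨fun n => (hmeas n).aemeasurable, (hYm.const_mul _).aemeasurable, ?_⟩
    -- Weak convergence is tested on bounded Lipschitz functions, the class for which mean square
    -- closeness suffices.
    refine tendsto_iff_forall_lipschitz_integral_tendsto.2 ?_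
    rintro f ⟨C, hC⟩ ⟨K, hK⟩
    have hfm := hK.continuous.measurable
    have hlim : ∀ᵐ ω ∂P, Tendsto (fun k => ∑ x ∈ siteBox d k, siteCoeff c δ x * (θ - G' x ω))
        atTop (𝓝 (c⁻¹ * Y ω)) := by
      filter_upwards [hY (siteBox d) siteBox_mono exists_mem_siteBox] with ω h
      refine (h.const_mul c⁻¹).congr fun k => ?_
      rw [Finset.mul_sum]
      exact Finset.sum_congr rfl fun x _ => by rw [siteCoeff_eq c, mul_assoc]
    have h := (ratesConverge_trap hc hδ hδd hρ0
      (tendsto_mean_siteRate_trap hc hδ hd hθ hρ0 hfin)).tendsto_tilted_integral hG' hθ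
      (by positivity) hβ (hYm.const_mul c⁻¹) hlim hK hC
    simp only [ProbabilityMeasure.coe_mk]
    rw [integral_map (hYm.const_mul _).aemeasurable hfm.aestronglyMeasurable]
    refine h.congr' ?_
    -- The degenerate value `n = 0`, where the length is `0`, is irrelevant in the limit.
    filter_upwards [eventually_gt_atTop 0] with n hn
    rw [integral_map (hmeas n).aemeasurable hfm.aestronglyMeasurable,
      integral_scaled_originOccupation hG' hd hc hδ hθ hρ0 hn f]
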